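/- \textbf{Conventions.} A \emph{compact polyhedron} is a subset of some $\mathbb R^n$ that is a finite union of convex hulls of finite sets; a \emph{polyhedron} is a subset $P\subset\mathbb R^n$ each point of which has a neighborhood in $P$ that is a compact polyhedron. A map $f$ from a polyhedron $P$ to a Euclidean space is \emph{PL} if each point of $P$ has a neighborhood in $P$ that is a finite union of convex hulls of finite sets on each of which $f$ is affine. A \emph{PL embedding} is a PL map that is a PL homeomorphism onto its image. A PL map is \emph{non-degenerate} if it has no point-inverses of dimension $>0$. A map $e\colon N\to M\times\mathbb R^k$ \emph{lifts} $f\colon N\to M$ if its composition with the projection to $M$ is $f$; similarly, for a topological space $X$, a map $E\colon N\times X\to M\times\mathbb R^k\times X$ lifts $f\times\mathrm{id}_X$ if $E(p,x)=(f(p),g(p,x),x)$ for some map $g\colon N\times X\to\mathbb R^k$. Two such lifts, given by $g$ and $g'$, are \emph{$\delta$-close} if $\|g(p,x)-g'(p,x)\|<\delta$ for all $p\in N$, $x\in X$. An \emph{isotopy} $E_t$, $t\in I=[0,1]$, of such lifts is a family of lifts of $f\times\mathrm{id}_X$ such that $(p,x,t)\mapsto(E_t(p,x),t)$ is a topological embedding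 $N\times X\times I\to M\times\mathbb R^k\times X\times I$; it is an \emph{$\varepsilon$-isotopy} if $E_s$ and $E_t$ are $\varepsilon$-close for all $s,t\in I$, and it is a \emph{PL isotopy} (for a polyhedron $X$) if that map is a PL embedding. \textbf{Theorem.} Let $f\colon N\to M$ be a non-degenerate PL map between compact polyhedra, let $k\ge 0$, and let $e\colon N\to M\times\mathbb R^k$ be a topological embedding that lifts $f$. Let $N_0\subset N$ be a compact subpolyhedron (possibly empty) such that $e|_{N_0}$ is PL. Then for each $\varepsilon>0$ there exist a $\delta>0$ and a PL embedding $e^\star\colon N\to M\times\mathbb R^k$ that lifts $f$ such that the following holds. (1) Let $X$ be a topological space, let $Y\subset X$ be a subset (possibly empty), and let $E\colon N\times X\to M\times\mathbb R^k\times X$ be a topological embedding that lifts $f\times\mathrm{id}_X$, is $\delta$-close to $e\times\mathrm{id}_X$, and satisfies $E(p,x)=(e(p),x)$ for all $p\in N_0$, $x\in Y$. Then there is an $\varepsilon$-isotopy $E_t$ through lifts of $f\times\mathrm{id}_X$ from $E_0=E$ to $E_1=e^\star\times\mathrm{id}_X$ that keeps $N_0\times Y$ fixed: $E_t(p,x)=E(p,x)$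 for all $p\in N_0$, $x\in Y$, $t\in I$. (2) If, in addition, $X$ is a polyhedron and $E$ is PL, then the isotopy in (1) can be chosen to be a PL isotopy. -/

import Mathlib

open Set Topology

/-- A compact polyhedron: a finite union of convex hulls of finite sets. -/
def IsCompactPolyhedron {V : Type*} [AddCommGroup V] [Module ℝ V] (P : Set V) : Prop :=
  ∃ C : Finset (Finset V), P = ⋃ F ∈ C, convexHull ℝ (F : Set V)

/-- A (not necessarily compact) polyhedron: every point has a neighbourhood in `P`
which is a compact polyhedron. -/
def IsPolyhedron {V : Type*} [NormedAddCommGroup V] [NormedSpace ℝ V] (P : Set V) : Prop :=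
  ∀ x ∈ P, ∃ K : Set V, IsCompactPolyhedron K ∧ K ⊆ P ∧ K ∈ 𝓝[P] x

/-- `f` is piecewise linear on `P`: every point of `P` has a neighbourhood in `P` which is a finite
union of convex hulls of finite sets such that `f` is affine on each of these convex hulls.
(In particular `P` is a polyhedron.) -/
def IsPLOn {V W : Type*} [NormedAddCommGroup V] [NormedSpace ℝ V]
    [NormedAddCommGroup W] [NormedSpace ℝ W] (f : V → W) (P : Set V) : Prop :=
  ∀ x ∈ P, ∃ C : Finset (Finset V),
    (⋃ F ∈ C, convexHull ℝ (F : Set V)) ⊆ P ∧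
    (⋃ F ∈ C, convexHull ℝ (F : Set V)) ∈ 𝓝[P] x ∧
    ∀ F ∈ C, ∃ A : V →ᵃ[ℝ] W, EqOn f A (convexHull ℝ (F : Set V))

/-- `f` restricts to a PL embedding of `P`: a PL homeomorphism onto the image, that is, a PL map
with a PL inverse defined on the image. -/
def IsPLEmbeddingOn {V W : Type*} [NormedAddCommGroup V] [NormedSpace ℝ V]
    [NormedAddCommGroup W] [NormedSpace ℝ W] (f : V → W) (P : Set V) : Prop :=
  IsPLOn f P ∧ ∃ h : W → V, IsPLOn h (f '' P) ∧ ∀ x ∈ P, h (f x) = x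

/-- `f` restricts to a topological embedding of `S`. -/
def IsEmbeddingOn {A B : Type*} [TopologicalSpace A] [TopologicalSpace B]
    (f : A → B) (S : Set A) : Prop :=
  IsEmbedding (S.domRestrict f)

/-- The dimension of the polyhedron `P` is at most `d`: every simplex contained in `P` has at most
`d + 1` vertices. -/
def PolyhedralDimLE {V : Type*} [AddCommGroup V] [Module ℝ V] (P : Set V) (d : ℕ) : Prop :=
  ∀ s : Finset V, AffineIndependent ℝ ((↑) : s → V) → convexHull ℝ (s : Set V) ⊆ P →
    s.card ≤ d + 1

/-- `f` has no point-inverses of positive dimension on `N`. -/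
def NonDegenerateOn {V W : Type*} [AddCommGroup V] [Module ℝ V] (f : V → W) (N : Set V) : Prop :=
  ∀ y : W, PolyhedralDimLE (N ∩ f ⁻¹' {y}) 0

/-- `e : N → M × K` lifts `f : N → M`. -/
def IsLiftOn {V W K : Type*} (f : V → W) (N : Set V) (e : V → W × K) : Prop :=
  ∀ p ∈ N, (e p).1 = f p

/-- `E : N × X → (M × K) × X` lifts `f × id_X : N × X → M × X`. -/
def IsFamilyLiftOn {V W K U : Type*} (f : V → W) (N : Set V) (X : Set U)
    (E : V × U → (W × K) × U) : Prop :=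
  ∀ p ∈ N, ∀ x ∈ X, (E (p, x)).1.1 = f p ∧ (E (p, x)).2 = x

/-- The level-preserving map `(z, t) ↦ (H_t z, t)` associated with a homotopy `H`. -/
def track {A B : Type*} (H : A × ℝ → B) : A × ℝ → B × ℝ := fun z => (H z, z.2)

/-- `H` is an `ε`-isotopy, with time in `[0,1]`, through lifts of `f × id_X`, from the family `E` to
the constant family `e' × id_X`. Any two points of a track are at distance `< ε`; as all stages
lift `f × id_X`, the `X`-coordinate is constant along them and does not enter the distance. -/
structure IsLiftIsotopy {V W K U : Type*} [TopologicalSpace V] [MetricSpace W] [MetricSpace K]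
    [TopologicalSpace U] (f : V → W) (N : Set V) (X : Set U) (ε : ℝ)
    (E : V × U → (W × K) × U) (e' : V → W × K) (H : (V × U) × ℝ → (W × K) × U) : Prop where
  embedding : IsEmbeddingOn (track H) ((N ×ˢ X) ×ˢ Icc (0 : ℝ) 1)
  lift : ∀ t ∈ Icc (0 : ℝ) 1, IsFamilyLiftOn f N X (fun z => H (z, t))
  initial : ∀ p ∈ N, ∀ x ∈ X, H ((p, x), 0) = E (p, x)
  final : ∀ p ∈ N, ∀ x ∈ X, H ((p, x), 1) = (e' p, x)
  small : ∀ p ∈ N, ∀ x ∈ X, ∀ s ∈ Icc (0 : ℝ) 1, ∀ t ∈ Icc (0 : ℝ) 1,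
    dist (H ((p, x), s)).1 (H ((p, x), t)).1 < ε

/-! A lift of `f` is a pair `(f, g)`, and it is injective exactly when `g` separates the points of
each fibre of `f` (`FiberInjOn`); so the whole argument concerns functions `g : N → K`.
Straight-line interpolation between two close functions of this kind keeps apart those pairs in a
fibre that are far from each other, but may identify pairs that are close, near the places where
sheets of `N` merge. The point is to control these.

`N` is triangulated so that `f` is simplicial, with vertices coloured through the target
(`exists_coloredTriangulation`). Two points of a fibre carry the same weights colour by colour, and
non-degeneracy yields a colour `i` such that two distinct ones share all their vertices of colour `<
i` and none of colour `≥ i` (`exists_firstDiff`). Coning at colour `m` with scale `s` makes a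
function linear between the stratum of colours `≤ m` and relative distance `s` from it. For `m < i`
the two points of the pair have the same projection to that stratum, so the difference of the coned
values is a positive multiple of the difference of the original values at a pair pushed away from
the stratum (`FirstDiff.exists_cone_sub`). After coning at all colours, injectivity depends only on
pairs that are a definite distance apart, and there compactness gives `g` a positive gap. Hence
everything close enough to `g` becomes fibrewise injective after coning, injective before or not
(`GoodScales.fiberInjOn`). The isotopy from `G` to `g'` turns the cones on, interpolates linearly
under full coning, and turns the cones off (`exists_fiberwise_isotopy`). Turning them on in the
order of increasing colours preserves injectivity at every intermediate time.

The PL function `g'` comes from a random rounding (`exists_isCompactPL_approx`). The cumulative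
weights of a point by colour are rounded, with a common uniform parameter and without changing the
mean, to finitely many patterns, and `g'` is the expected value of `g` at the rounded point. For a
pair of first difference `i`, a pattern either does not see the difference or moves the pair to one
at a definite distance. The differences of `g` arising in the second case are nearly equal, so their
weighted sum does not vanish. Coning and rounding both reproduce functions that are affine on
simplices, which takes care of `N₀`.

The construction is given by a formula continuous in `G`, so arbitrary parameter spaces cost
nothing; since `N` is compact, a continuous family of injective lifts is automatically an embedding
(`isClosedEmbedding_of_fiberwise_injective`). For PL families the topological isotopy is itself
approximated by a PL one, relative to its ends and to the part that has to stay fixed. This uses the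
compact theorem for `f × id × id` over compact pieces of the parameter space, one piece after
another (`exists_piecewiseLinear_homotopy`). -/

/-! ### Convex polytopes: hulls of finite sets and intersections of half-spaces. -/

section Polytopes

theorem exists_between_finite_sets {L U : Set ℝ} (hL : L.Finite) (hne : L.Nonempty)
    (h : ∀ l ∈ L, ∀ u ∈ U, l ≤ u) : ∃ s, (∀ l ∈ L, l ≤ s) ∧ ∀ u ∈ U, s ≤ u :=
  ⟨sSup L, fun _ hl => le_csSup hL.bddAbove hl, fun _ hu => csSup_le hne fun _ hl => h _ hl _ hu⟩

/-- Fourier–Motzkin elimination of one variable. -/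
theorem fourier_motzkin {E : Type*} [AddCommGroup E] [Module ℝ E] {H : Set (E →ₗ[ℝ] ℝ)}
    (hH : H.Finite) (v : E) : ∃ H' : Set (E →ₗ[ℝ] ℝ), H'.Finite ∧
      ∀ x, (∃ s : ℝ, 0 ≤ s ∧ ∀ h ∈ H, 0 ≤ h (x - s • v)) ↔ ∀ h ∈ H', 0 ≤ h x := by
  classical
  -- Constraints with `h v < 0` bound `s` from below by `h x / h v`, those with `h v > 0` bound it
  -- from above. The combinations express that each lower bound is at most each upper bound; the
  -- constraints with `0 ≤ h v` express compatibility with `0 ≤ s`, or do not involve `s`.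
  refine ⟨{h ∈ H | 0 ≤ h v} ∪
    image2 (fun h h' => h v • h' - h' v • h) {h ∈ H | 0 < h v} {h ∈ H | h v < 0}, ?_, ?_⟩
  · exact (hH.subset (sep_subset _ _)).union
      (Finite.image2 _ (hH.subset (sep_subset _ _)) (hH.subset (sep_subset _ _)))
  intro x
  constructor
  · rintro ⟨s, hs, hx⟩ h (⟨hh, hv⟩ | ⟨a, ⟨ha, hav⟩, b, ⟨hb, hbv⟩, rfl⟩)
    · have := hx h hh
      simp only [map_sub, map_smul, smul_eq_mul] at this
      nlinarith [mul_nonneg hs hv]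
    · have h1 := hx a ha
      have h2 := hx b hb
      simp only [map_sub, map_smul, smul_eq_mul, LinearMap.sub_apply, LinearMap.smul_apply] at *
      nlinarith [mul_nonneg h2 hav.le, mul_nonneg h1 (neg_nonneg.2 hbv.le)]
  · intro hx
    obtain ⟨s, hs1, hs2⟩ := exists_between_finite_sets
      -- The extra element `0` encodes `0 ≤ s` and makes the set of lower bounds nonempty.
      (L := insert 0 ((fun h : E →ₗ[ℝ] ℝ => h x / h v) '' {h ∈ H | h v < 0}))
      (U := (fun h : E →ₗ[ℝ] ℝ => h x / h v) '' {h ∈ H | 0 < h v})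
      (((hH.subset (sep_subset _ _)).image _).insert _) (insert_nonempty _ _) (by
        rintro l (rfl | ⟨b, ⟨hb, hbv⟩, rfl⟩) u ⟨a, ⟨ha, hav⟩, rfl⟩
        · exact div_nonneg (hx a (Or.inl ⟨ha, hav.le⟩)) hav.le
        · have := hx _ (Or.inr ⟨a, ⟨ha, hav⟩, b, ⟨hb, hbv⟩, rfl⟩)
          simp only [smul_eq_mul, LinearMap.sub_apply, LinearMap.smul_apply] at this
          dsimp only
          rw [le_div_iff₀ hav, div_mul_eq_mul_div, div_le_iff_of_neg hbv]
          linarith)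
    refine ⟨s, hs1 0 (mem_insert _ _), fun h hh => ?_⟩
    simp only [map_sub, map_smul, smul_eq_mul]
    rcases lt_trichotomy (h v) 0 with hv | hv | hv
    · have := hs1 _ (mem_insert_of_mem _ ⟨h, ⟨hh, hv⟩, rfl⟩)
      dsimp only at this
      rw [div_le_iff_of_neg hv] at this
      linarith
    · have := hx h (Or.inl ⟨hh, hv.ge⟩)
      simpa [hv] using this
    · have := hs2 _ ⟨h, ⟨hh, hv⟩, rfl⟩
      dsimp only at this
      rw [le_div_iff₀ hv] at this
      linarith

/-- A finitely generated cone is a finite intersection of half-spaces. -/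
theorem exists_dual_of_cone {E ι : Type*} [AddCommGroup E] [Module ℝ E] [FiniteDimensional ℝ E]
    (g : ι → E) (S : Finset ι) : ∃ H : Set (E →ₗ[ℝ] ℝ), H.Finite ∧
      ∀ x, (∃ c : ι → ℝ, (∀ i ∈ S, 0 ≤ c i) ∧ ∑ i ∈ S, c i • g i = x) ↔ ∀ h ∈ H, 0 ≤ h x := by
  classical
  induction S using Finset.induction_on with
  | empty =>
    let b := Module.finBasis ℝ E
    refine ⟨range (fun i => b.coord i) ∪ range (fun i => -b.coord i),
      (finite_range _).union (finite_range _), fun x => ?_⟩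
    constructor
    · rintro ⟨c, -, rfl⟩ h -
      simp
    · intro h
      refine ⟨0, by simp, ?_⟩
      have : x = 0 := by
        refine b.ext_elem fun i => ?_
        have h1 := h _ (Or.inl ⟨i, rfl⟩)
        have h2 := h _ (Or.inr ⟨i, rfl⟩)
        simp at h1 h2 ⊢
        linarith
      simp [this]
  | insert a S ha ih =>
    obtain ⟨H, hH, hx⟩ := ih
    obtain ⟨H', hH', hx'⟩ := fourier_motzkin hH (g a)
    refine ⟨H', hH', fun x => ?_⟩
    rw [← hx']
    simp_rw [← hx]
    constructor
    · rintro ⟨c, hc, rfl⟩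
      refine ⟨c a, hc a (by simp), c, fun i hi => hc i (by simp [hi]), ?_⟩
      rw [Finset.sum_insert ha]
      abel
    · rintro ⟨s, hs, c, hc, h⟩
      refine ⟨Function.update c a s, fun i hi => ?_, ?_⟩
      · rcases eq_or_ne i a with rfl | hne
        · simpa using hs
        · simpa [hne] using hc i (by simpa [hne] using hi)
      · rw [Finset.sum_insert ha, Function.update_self, Finset.sum_congr rfl, h]
        · abel
        · intro i hi
          rw [Function.update_of_ne (ne_of_mem_of_not_mem hi ha)]

variable {V : Type*} [NormedAddCommGroup V] [NormedSpace ℝ V] [FiniteDimensional ℝ V]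

/-- The intersection of the closed half-spaces given by `H`. -/
def hPoly {V : Type*} [AddCommGroup V] [Module ℝ V] (H : Set (V →ᵃ[ℝ] ℝ)) : Set V :=
  {x | ∀ h ∈ H, 0 ≤ h x}

theorem exists_hPoly_of_convexHull (F : Finset V) :
    ∃ H : Set (V →ᵃ[ℝ] ℝ), H.Finite ∧ convexHull ℝ (F : Set V) = hPoly H := by
  -- Homogenisation: the hull is the slice at height `1` of the cone generated by the points `(v,
  -- 1)`.
  obtain ⟨H, hH, hx⟩ := exists_dual_of_cone (fun v : V => (v, (1 : ℝ))) F
  refine ⟨(fun h : V × ℝ →ₗ[ℝ] ℝ => h.toAffineMap.comp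
    ((AffineMap.id ℝ V).prod (AffineMap.const ℝ V (1 : ℝ)))) '' H, hH.image _, ?_⟩
  ext x
  rw [Finset.mem_convexHull']
  have := hx (x, 1)
  simp only [hPoly, mem_ofPred_eq, forall_mem_image]
  refine Iff.trans ?_ (this.trans ?_)
  · simp only [Prod.ext_iff, Prod.fst_sum, Prod.snd_sum, Prod.smul_mk, smul_eq_mul, mul_one]
    exact ⟨fun ⟨w, h1, h2, h3⟩ => ⟨w, h1, h3, h2⟩, fun ⟨w, h1, h2, h3⟩ => ⟨w, h1, h3, h2⟩⟩
  · rfl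

theorem convex_hPoly {V : Type*} [AddCommGroup V] [Module ℝ V] (H : Set (V →ᵃ[ℝ] ℝ)) :
    Convex ℝ (hPoly H) := by
  intro x hx y hy a b ha hb hab h hh
  rw [Convex.combo_affine_apply hab]
  exact add_nonneg (mul_nonneg ha (hx h hh)) (mul_nonneg hb (hy h hh))

theorem isClosed_hPoly (H : Set (V →ᵃ[ℝ] ℝ)) : IsClosed (hPoly H) := by
  simp only [hPoly, ofPred_forall]
  exact isClosed_biInter fun h _ => isClosed_le continuous_const h.continuous_of_finiteDimensional

/-- An extreme point is determined by the set of constraints that vanish there, so there are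
finitely many, and the Krein–Milman theorem applies. -/
theorem exists_convexHull_of_hPoly {H : Set (V →ᵃ[ℝ] ℝ)} (hH : H.Finite)
    (hb : Bornology.IsBounded (hPoly H)) : ∃ F : Finset V, hPoly H = convexHull ℝ (F : Set V) := by
  have : ProperSpace V := FiniteDimensional.proper ℝ V
  have hc : IsCompact (hPoly H) := Metric.isCompact_of_isClosed_isBounded (isClosed_hPoly H) hb
  have hfin : (extremePoints ℝ (hPoly H)).Finite := by
    refine Finite.of_finite_image (f := fun x => {h ∈ H | h x = 0})
      (hH.powerset.subset ?_) ?_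
    · rintro _ ⟨x, -, rfl⟩
      exact sep_subset _ _
    · intro x hx y hy hxy
      by_contra hne
      simp only [Set.ext_iff, mem_ofPred_eq, and_congr_right_iff] at hxy
      -- move from `x` slightly away from `y`
      have hev : ∀ᶠ t : ℝ in 𝓝[>] 0, ∀ h ∈ H, 0 ≤ h (AffineMap.lineMap x y (-t)) := by
        rw [Filter.eventually_all_finite hH]
        intro h hh
        have hform : ∀ t : ℝ, h (AffineMap.lineMap x y (-t)) = h x - t * (h y - h x) := by
          intro t
          rw [AffineMap.apply_lineMap, AffineMap.lineMap_apply_module]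
          simp only [smul_eq_mul]; ring
        simp only [hform]
        rcases (hx.1 h hh).eq_or_lt with h0 | h0
        · refine Filter.Eventually.of_forall fun t => ?_
          rw [← h0, (hxy h hh).1 h0.symm]; simp
        · have hcont : Continuous fun t : ℝ => h x - t * (h y - h x) := by fun_prop
          have := hcont.tendsto 0
          have h2 := this.eventually (lt_mem_nhds (by simpa using h0))
          exact nhdsWithin_le_nhds (h2.mono fun t ht => ht.le)
      obtain ⟨t, ht, ht0⟩ := (hev.and self_mem_nhdsWithin).exists
      have ht0 : (0 : ℝ) < t := ht0
      refine hne ((mem_extremePoints.1 hx).2 _ ht y hy.1 ?_).2.symm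
      rw [openSegment_eq_image_lineMap]
      -- This is the parameter of `x` on the segment from `x - t (y - x)` to `y`.
      refine ⟨t / (1 + t), ⟨by positivity, by rw [div_lt_one (by positivity)]; linarith⟩, ?_⟩
      have h1 : (1 + t) ≠ 0 := by positivity
      simp only [AffineMap.lineMap_apply_module]
      match_scalars <;> field_simp <;> ring
  refine ⟨hfin.toFinset, ?_⟩
  rw [Finite.coe_toFinset]
  conv_lhs => rw [← closure_convexHull_extremePoints hc (convex_hPoly H)]
  exact (hfin.isCompact_convexHull (𝕜 := ℝ)).isClosed.closure_eq

end Polytopes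

/-! ### Calculus of compact polyhedra and PL maps through hyperplane arrangements. -/

section PiecewiseLinear

variable {V W W' : Type*} [NormedAddCommGroup V] [NormedSpace ℝ V]
  [NormedAddCommGroup W] [NormedSpace ℝ W] [NormedAddCommGroup W'] [NormedSpace ℝ W']

/-- The closed cell of `p` in the arrangement of the hyperplanes `h = 0`, `h ∈ H`. -/
def closedCell (H : Set (V →ᵃ[ℝ] ℝ)) (p : V) : Set V :=
  {q | ∀ h ∈ H, (0 ≤ h p → 0 ≤ h q) ∧ (h p ≤ 0 → h q ≤ 0)}

theorem mem_closedCell_self (H : Set (V →ᵃ[ℝ] ℝ)) (p : V) : p ∈ closedCell H p :=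
  fun _ _ => ⟨id, id⟩

theorem closedCell_subset_of_mem {H : Set (V →ᵃ[ℝ] ℝ)} {p q : V} (hq : q ∈ closedCell H p) :
    closedCell H q ⊆ closedCell H p :=
  fun _ hr h hh => ⟨fun h0 => (hr h hh).1 ((hq h hh).1 h0), fun h0 => (hr h hh).2 ((hq h hh).2 h0)⟩

theorem closedCell_mono {H H' : Set (V →ᵃ[ℝ] ℝ)} (hHH : H ⊆ H') (p : V) :
    closedCell H' p ⊆ closedCell H p :=
  fun _ hq h hh => hq h (hHH hh)

theorem closedCell_subset_hPoly {H H' : Set (V →ᵃ[ℝ] ℝ)} (hHH : H ⊆ H') {p : V} (hp : p ∈ hPoly H) :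
    closedCell H' p ⊆ hPoly H :=
  fun _ hq h hh => (hq h (hHH hh)).1 (hp h hh)

theorem exists_hPoly_eq_closedCell {H : Set (V →ᵃ[ℝ] ℝ)} (hH : H.Finite) (p : V) :
    ∃ H' : Set (V →ᵃ[ℝ] ℝ), H'.Finite ∧ closedCell H p = hPoly H' := by
  refine ⟨{h ∈ H | 0 ≤ h p} ∪ (fun h => -h) '' {h ∈ H | h p ≤ 0},
    (hH.subset (sep_subset _ _)).union ((hH.subset (sep_subset _ _)).image _), ?_⟩
  ext q
  constructor
  · rintro hq h (⟨hh, h0⟩ | ⟨h, ⟨hh, h0⟩, rfl⟩)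
    · exact (hq h hh).1 h0
    · simpa using (hq h hh).2 h0
  · intro hq h hh
    exact ⟨fun h0 => hq h (Or.inl ⟨hh, h0⟩), fun h0 => by
      simpa using hq _ (Or.inr ⟨h, ⟨hh, h0⟩, rfl⟩)⟩

theorem convex_closedCell (H : Set (V →ᵃ[ℝ] ℝ)) (p : V) : Convex ℝ (closedCell H p) := by
  intro x hx y hy a b ha hb hab h hh
  rw [Convex.combo_affine_apply hab, smul_eq_mul, smul_eq_mul]
  exact ⟨fun h0 => add_nonneg (mul_nonneg ha ((hx h hh).1 h0)) (mul_nonneg hb ((hy h hh).1 h0)),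
    fun h0 => add_nonpos (mul_nonpos_of_nonneg_of_nonpos ha ((hx h hh).2 h0))
      (mul_nonpos_of_nonneg_of_nonpos hb ((hy h hh).2 h0))⟩

theorem finite_range_closedCell {H : Set (V →ᵃ[ℝ] ℝ)} (hH : H.Finite) :
    (range (closedCell H)).Finite := by
  let T : Set (Set (V →ᵃ[ℝ] ℝ) × Set (V →ᵃ[ℝ] ℝ)) := H.powerset ×ˢ H.powerset
  refine ((hH.powerset.prod hH.powerset).image fun T : Set (V →ᵃ[ℝ] ℝ) × Set (V →ᵃ[ℝ] ℝ) =>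
    {q : V | (∀ h ∈ T.1, 0 ≤ h q) ∧ ∀ h ∈ T.2, h q ≤ 0}).subset ?_
  rintro _ ⟨p, rfl⟩
  refine ⟨({h ∈ H | 0 ≤ h p}, {h ∈ H | h p ≤ 0}), ⟨sep_subset _ _, sep_subset _ _⟩, ?_⟩
  ext q
  simp only [closedCell, mem_ofPred_eq]
  constructor
  · intro h1 h hh
    exact ⟨fun h0 => h1.1 h ⟨hh, h0⟩, fun h0 => h1.2 h ⟨hh, h0⟩⟩
  · exact fun h1 => ⟨fun h hh => (h1 h hh.1).1 hh.2, fun h hh => (h1 h hh.1).2 hh.2⟩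

/-- `S` is a union of closed cells of the arrangement `H`. -/
def Adapted (H : Set (V →ᵃ[ℝ] ℝ)) (S : Set V) : Prop := ∀ p ∈ S, closedCell H p ⊆ S

/-- `f` is affine on the closed cell of each point of `S`. -/
def CellwiseAffine (H : Set (V →ᵃ[ℝ] ℝ)) (f : V → W) (S : Set V) : Prop :=
  ∀ p ∈ S, ∃ A : V →ᵃ[ℝ] W, EqOn f A (closedCell H p)

/-- `P` is a finite union of convex hulls of finite sets on each of which `f` is affine. -/
def IsCompactPL (f : V → W) (P : Set V) : Prop :=
  ∃ C : Finset (Finset V), P = ⋃ F ∈ C, convexHull ℝ (F : Set V) ∧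
    ∀ F ∈ C, ∃ A : V →ᵃ[ℝ] W, EqOn f A (convexHull ℝ (F : Set V))

theorem Adapted.mono {H H' : Set (V →ᵃ[ℝ] ℝ)} {S : Set V} (h : Adapted H S) (hHH : H ⊆ H') :
    Adapted H' S :=
  fun p hp => (closedCell_mono hHH p).trans (h p hp)

theorem CellwiseAffine.mono {H H' : Set (V →ᵃ[ℝ] ℝ)} {S S' : Set V} {f : V → W}
    (h : CellwiseAffine H f S) (hHH : H ⊆ H') (hS : S' ⊆ S) : CellwiseAffine H' f S' :=
  fun p hp => (h p (hS hp)).imp fun _ hA => hA.mono (closedCell_mono hHH p)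

theorem IsCompactPL.isCompactPolyhedron {f : V → W} {P : Set V} (h : IsCompactPL f P) :
    IsCompactPolyhedron P :=
  ⟨h.choose, h.choose_spec.1⟩

theorem IsCompactPolyhedron.isCompactPL_affine {P : Set V} (h : IsCompactPolyhedron P)
    (A : V →ᵃ[ℝ] W) : IsCompactPL A P :=
  ⟨h.choose, h.choose_spec, fun _ _ => ⟨A, fun _ _ => rfl⟩⟩

theorem IsCompactPL.congr {f g : V → W} {P : Set V} (h : IsCompactPL f P) (hfg : EqOn f g P) :
    IsCompactPL g P := by
  obtain ⟨C, hC, hA⟩ := h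
  refine ⟨C, hC, fun F hF => (hA F hF).imp fun A hA x hx => ?_⟩
  rw [← hfg, hA hx]
  rw [hC]
  exact mem_biUnion hF hx

theorem IsCompactPL.union {f : V → W} {P Q : Set V} (hP : IsCompactPL f P) (hQ : IsCompactPL f Q) :
    IsCompactPL f (P ∪ Q) := by
  classical
  obtain ⟨C, rfl, hC⟩ := hP
  obtain ⟨D, rfl, hD⟩ := hQ
  refine ⟨C ∪ D, by rw [Finset.set_biUnion_union], fun F hF => ?_⟩
  rcases Finset.mem_union.1 hF with h | h
  exacts [hC F h, hD F h]

theorem isCompactPL_biUnion {ι : Type*} {f : V → W} {T : Set ι} (hT : T.Finite) {P : ι → Set V}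
    (h : ∀ i ∈ T, IsCompactPL f (P i)) : IsCompactPL f (⋃ i ∈ T, P i) := by
  induction T, hT using Set.Finite.induction_on with
  | empty => exact ⟨∅, by simp, by simp⟩
  | insert _ _ ih =>
    rw [biUnion_insert]
    exact (h _ (mem_insert _ _)).union (ih fun i hi => h i (mem_insert_of_mem _ hi))

theorem isCompactPolyhedron_convexHull (F : Finset V) :
    IsCompactPolyhedron (convexHull ℝ (F : Set V)) := ⟨{F}, by simp⟩

theorem IsCompactPolyhedron.isCompact {P : Set V} (h : IsCompactPolyhedron P) : IsCompact P := by
  obtain ⟨C, rfl⟩ := h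
  exact C.finite_toSet.isCompact_biUnion fun F _ => F.finite_toSet.isCompact_convexHull (𝕜 := ℝ)

theorem IsCompactPL.isPLOn {f : V → W} {P : Set V} (h : IsCompactPL f P) : IsPLOn f P := by
  obtain ⟨C, rfl, hC⟩ := h
  exact fun x _ => ⟨C, subset_rfl, self_mem_nhdsWithin, hC⟩

theorem IsCompactPL.affine_comp {f : V → W} {P : Set V} (hf : IsCompactPL f P) (A : W →ᵃ[ℝ] W') :
    IsCompactPL (fun x => A (f x)) P := by
  obtain ⟨C, hC, h⟩ := hf
  exact ⟨C, hC, fun F hF => (h F hF).elim fun B hB => ⟨A.comp B, fun x hx => by simp [hB hx]⟩⟩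

theorem IsCompactPolyhedron.isCompactPL_const {P : Set V} (h : IsCompactPolyhedron P) (w : W) :
    IsCompactPL (fun _ => w) P :=
  h.isCompactPL_affine (AffineMap.const ℝ V w)

theorem IsCompactPL.smul_const {f : V → ℝ} {P : Set V} (hf : IsCompactPL f P) (w : W) :
    IsCompactPL (fun x => f x • w) P :=
  hf.affine_comp (LinearMap.toSpanSingleton ℝ W w).toAffineMap

theorem IsCompactPL.const_mul {f : V → ℝ} {P : Set V} (hf : IsCompactPL f P) (c : ℝ) :
    IsCompactPL (fun x => c * f x) P := by
  simpa [mul_comm] using hf.smul_const (W := ℝ) c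

theorem IsCompactPL.neg {f : V → ℝ} {P : Set V} (hf : IsCompactPL f P) :
    IsCompactPL (fun x => -f x) P := by
  simpa using hf.const_mul (-1)

section FiniteDimensional
variable [FiniteDimensional ℝ V]

theorem exists_cellwiseAffine_of_cover {f : V → W} {C : Finset (Finset V)}
    (hC : ∀ F ∈ C, ∃ A : V →ᵃ[ℝ] W, EqOn f A (convexHull ℝ (F : Set V))) :
    ∃ H : Set (V →ᵃ[ℝ] ℝ), H.Finite ∧ Adapted H (⋃ F ∈ C, convexHull ℝ (F : Set V)) ∧
      CellwiseAffine H f (⋃ F ∈ C, convexHull ℝ (F : Set V)) := by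
  choose K hK hFK using fun F : Finset V => exists_hPoly_of_convexHull F
  -- The arrangement consists of all half-spaces defining the hulls, so the closed cell of a point
  -- of a hull stays in that hull.
  have key : ∀ F ∈ C, ∀ p ∈ convexHull ℝ (F : Set V),
      closedCell (⋃ F ∈ C, K F) p ⊆ convexHull ℝ (F : Set V) := by
    intro F hF p hp
    rw [hFK F] at hp ⊢
    exact closedCell_subset_hPoly (subset_biUnion_of_mem (u := K) hF) hp
  refine ⟨⋃ F ∈ C, K F, C.finite_toSet.biUnion fun F _ => hK F, fun p hp => ?_, fun p hp => ?_⟩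
  · obtain ⟨F, hF, hpF⟩ := mem_iUnion₂.1 hp
    exact (key F hF p hpF).trans (subset_biUnion_of_mem (u := fun F : Finset V =>
      convexHull ℝ (F : Set V)) hF)
  · obtain ⟨F, hF, hpF⟩ := mem_iUnion₂.1 hp
    obtain ⟨A, hA⟩ := hC F hF
    exact ⟨A, hA.mono (key F hF p hpF)⟩

theorem IsCompactPL.exists_cellwiseAffine {f : V → W} {P : Set V} (h : IsCompactPL f P) :
    ∃ H : Set (V →ᵃ[ℝ] ℝ), H.Finite ∧ Adapted H P ∧ CellwiseAffine H f P := by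
  obtain ⟨C, rfl, hC⟩ := h
  exact exists_cellwiseAffine_of_cover hC

theorem IsCompactPolyhedron.exists_adapted {P : Set V} (h : IsCompactPolyhedron P) :
    ∃ H : Set (V →ᵃ[ℝ] ℝ), H.Finite ∧ Adapted H P := by
  obtain ⟨H, hH, hP, -⟩ := (h.isCompactPL_affine (AffineMap.const ℝ V (0 : ℝ))).exists_cellwiseAffine
  exact ⟨H, hH, hP⟩

/-- Together with the converse `IsCompactPL.exists_cellwiseAffine` this reduces operations on
polyhedra and PL maps to forming the union of two arrangements. Boundedness makes the closed cells
polytopes. -/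
theorem isCompactPL_of_cellwiseAffine {H : Set (V →ᵃ[ℝ] ℝ)} (hH : H.Finite) {f : V → W} {P : Set V}
    (hb : Bornology.IsBounded P) (hP : Adapted H P) (hf : CellwiseAffine H f P) :
    IsCompactPL f P := by
  have hPeq : P = ⋃ s ∈ closedCell H '' P, s := by
    rw [biUnion_image]
    exact subset_antisymm (fun p hp => mem_biUnion hp (mem_closedCell_self H p))
      (iUnion₂_subset hP)
  rw [hPeq]
  refine isCompactPL_biUnion ((finite_range_closedCell hH).subset (image_subset_range _ _)) ?_
  rintro _ ⟨p, hp, rfl⟩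
  obtain ⟨H', hH', he⟩ := exists_hPoly_eq_closedCell hH p
  obtain ⟨F, hF⟩ := exists_convexHull_of_hPoly hH' (he ▸ hb.subset (hP p hp))
  obtain ⟨A, hA⟩ := hf p hp
  exact ⟨{F}, by simp [he, hF], fun F' hF' => ⟨A, by
    rw [Finset.mem_singleton.1 hF', ← hF, ← he]; exact hA⟩⟩

theorem isCompactPolyhedron_of_adapted {H : Set (V →ᵃ[ℝ] ℝ)} (hH : H.Finite) {P : Set V}
    (hb : Bornology.IsBounded P) (hP : Adapted H P) : IsCompactPolyhedron P :=
  (isCompactPL_of_cellwiseAffine (f := fun _ => (0 : ℝ)) hH hb hP fun _ _ =>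
    ⟨AffineMap.const ℝ V 0, fun _ _ => rfl⟩).isCompactPolyhedron

theorem IsCompactPolyhedron.inter {P Q : Set V} (hP : IsCompactPolyhedron P)
    (hQ : IsCompactPolyhedron Q) : IsCompactPolyhedron (P ∩ Q) := by
  obtain ⟨H, hH, h1⟩ := hP.exists_adapted
  obtain ⟨H', hH', h2⟩ := hQ.exists_adapted
  exact isCompactPolyhedron_of_adapted (hH.union hH')
    (hP.isCompact.isBounded.subset inter_subset_left) fun p hp =>
    subset_inter ((h1.mono subset_union_left) p hp.1) ((h2.mono subset_union_right) p hp.2)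

theorem IsCompactPL.mono {f : V → W} {P Q : Set V} (hP : IsCompactPL f P)
    (hQ : IsCompactPolyhedron Q) (hQP : Q ⊆ P) : IsCompactPL f Q := by
  obtain ⟨H, hH, h1, h1'⟩ := hP.exists_cellwiseAffine
  obtain ⟨H', hH', h2⟩ := hQ.exists_adapted
  exact isCompactPL_of_cellwiseAffine (hH.union hH') hQ.isCompact.isBounded
    (h2.mono subset_union_right) (h1'.mono subset_union_left hQP)

theorem IsPLOn.isCompactPL {f : V → W} {P Q : Set V} (hf : IsPLOn f P)
    (hQ : IsCompactPolyhedron Q) (hQP : Q ⊆ P) : IsCompactPL f Q := by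
  choose! C hC1 hC2 hC3 using hf
  obtain ⟨T, hT, hcov⟩ := hQ.isCompact.elim_nhdsWithin_subcover
    (fun x => ⋃ F ∈ C x, convexHull ℝ (F : Set V))
    (fun x hx => nhdsWithin_mono x hQP (hC2 x (hQP hx)))
  have : IsCompactPL f (⋃ x ∈ (T : Set V), ⋃ F ∈ C x, convexHull ℝ (F : Set V)) :=
    isCompactPL_biUnion T.finite_toSet fun x hx => ⟨C x, rfl, hC3 x (hQP (hT x hx))⟩
  exact this.mono hQ hcov

theorem IsCompactPL.prodMk {f : V → W} {g : V → W'} {P : Set V} (hf : IsCompactPL f P)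
    (hg : IsCompactPL g P) : IsCompactPL (fun x => (f x, g x)) P := by
  obtain ⟨H, hH, h1, h1'⟩ := hf.exists_cellwiseAffine
  obtain ⟨H', hH', -, h2'⟩ := hg.exists_cellwiseAffine
  refine isCompactPL_of_cellwiseAffine (hH.union hH') hf.isCompactPolyhedron.isCompact.isBounded
    (h1.mono subset_union_left) fun p hp => ?_
  obtain ⟨A, hA⟩ := h1'.mono subset_union_left subset_rfl p hp
  obtain ⟨B, hB⟩ := h2'.mono subset_union_right subset_rfl p hp
  exact ⟨A.prod B, fun x hx => Prod.ext (hA hx) (hB hx)⟩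

theorem IsCompactPL.add {f g : V → W} {P : Set V} (hf : IsCompactPL f P) (hg : IsCompactPL g P) :
    IsCompactPL (fun x => f x + g x) P :=
  (hf.prodMk hg).affine_comp (LinearMap.fst ℝ W W + LinearMap.snd ℝ W W).toAffineMap

theorem isCompactPL_sum {ι : Type*} {P : Set V} (hP : IsCompactPolyhedron P) (s : Finset ι)
    {f : ι → V → W} (h : ∀ i ∈ s, IsCompactPL (f i) P) :
    IsCompactPL (fun x => ∑ i ∈ s, f i x) P := by
  classical
  induction s using Finset.induction_on with
  | empty => simpa using hP.isCompactPL_const (0 : W)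
  | insert a s ha ih =>
    simp only [Finset.sum_insert ha]
    exact (h a (by simp)).add (ih fun i hi => h i (by simp [hi]))

theorem IsCompactPL.posPart {f : V → ℝ} {P : Set V} (hf : IsCompactPL f P) :
    IsCompactPL (fun x => max (f x) 0) P := by
  classical
  obtain ⟨H, hH, h1, h2⟩ := hf.exists_cellwiseAffine
  choose! A hA using h2
  -- The affine pieces of `f` are added to the arrangement, so that on each new closed cell the
  -- piece is everywhere `≥ 0` or everywhere `≤ 0`.
  let D : Set (V →ᵃ[ℝ] ℝ) := (fun s : Set V => if h : ∃ B : V →ᵃ[ℝ] ℝ, EqOn f B s then h.choose else 0) ''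
    range (closedCell H)
  refine isCompactPL_of_cellwiseAffine (H := H ∪ D) (hH.union ((finite_range_closedCell hH).image _))
    hf.isCompactPolyhedron.isCompact.isBounded (h1.mono subset_union_left) fun p hp => ?_
  have hex : ∃ B : V →ᵃ[ℝ] ℝ, EqOn f B (closedCell H p) := ⟨A p, hA p hp⟩
  have hD : hex.choose ∈ D := ⟨_, ⟨p, rfl⟩, by simp only [dif_pos hex]⟩
  have hB := hex.choose_spec
  rcases le_total 0 (hex.choose p) with h0 | h0
  · refine ⟨hex.choose, fun q hq => ?_⟩
    have hq1 := (hq _ (Or.inr hD)).1 h0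
    dsimp only
    rw [hB (closedCell_mono subset_union_left p hq)]
    exact max_eq_left hq1
  · refine ⟨0, fun q hq => ?_⟩
    have hq1 := (hq _ (Or.inr hD)).2 h0
    dsimp only
    rw [hB (closedCell_mono subset_union_left p hq)]
    exact max_eq_right hq1

theorem IsCompactPL.max {f g : V → ℝ} {P : Set V} (hf : IsCompactPL f P) (hg : IsCompactPL g P) :
    IsCompactPL (fun x => max (f x) (g x)) P := by
  refine (((hf.add hg.neg).posPart).add hg).congr fun x _ => ?_
  dsimp only
  rw [← max_add_add_right]
  simp

theorem IsCompactPL.min {f g : V → ℝ} {P : Set V} (hf : IsCompactPL f P) (hg : IsCompactPL g P) :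
    IsCompactPL (fun x => min (f x) (g x)) P := by
  refine ((hf.neg.max hg.neg).neg).congr fun x _ => ?_
  simp [max_neg_neg]

theorem IsCompactPL.continuousOn {f : V → W} {P : Set V} (hf : IsCompactPL f P) :
    ContinuousOn f P := by
  obtain ⟨C, rfl, hC⟩ := hf
  have : (⋃ F ∈ C, convexHull ℝ (F : Set V)) = ⋃ F : C, convexHull ℝ ((F : Finset V) : Set V) := by
    rw [iUnion_subtype]
  rw [this]
  refine (locallyFinite_of_finite _).continuousOn_iUnion
    (fun F => (F.1.finite_toSet.isCompact_convexHull (𝕜 := ℝ)).isClosed) fun F => ?_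
  obtain ⟨A, hA⟩ := hC F.1 F.2
  exact (A.continuous_of_finiteDimensional.continuousOn).congr hA

theorem IsCompactPL.comp_affineMap {V' : Type*} [NormedAddCommGroup V'] [NormedSpace ℝ V']
    [FiniteDimensional ℝ V'] {f : V → W} {P : Set V} (hf : IsCompactPL f P) {R : Set V'}
    (hR : IsCompactPolyhedron R) (L : V' →ᵃ[ℝ] V) (hL : MapsTo L R P) :
    IsCompactPL (fun x => f (L x)) R := by
  obtain ⟨H, hH, -, h2⟩ := hf.exists_cellwiseAffine
  obtain ⟨H', hH', h3⟩ := hR.exists_adapted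
  refine isCompactPL_of_cellwiseAffine ((hH.image fun h => h.comp L).union hH')
    hR.isCompact.isBounded (h3.mono subset_union_right) fun p hp => ?_
  obtain ⟨A, hA⟩ := h2 (L p) (hL hp)
  exact ⟨A.comp L, fun q hq => hA fun h hh => hq _ (Or.inl ⟨h, hh, rfl⟩)⟩

end FiniteDimensional

/-- A map that respects convex combinations of the points `b i`, `i ∈ T`, extends to an affine
map. -/
theorem exists_affineMap_of_convexCombination {V W ι : Type*} [AddCommGroup V] [Module ℝ V]
    [AddCommGroup W] [Module ℝ W] (T : Finset ι) (b : ι → V) (φ : ι → W) (f : V → W)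
    (h : ∀ μ : ι → ℝ, (∀ i ∈ T, 0 ≤ μ i) → ∑ i ∈ T, μ i = 1 →
      f (∑ i ∈ T, μ i • b i) = ∑ i ∈ T, μ i • φ i) :
    ∃ A : V →ᵃ[ℝ] W, ∀ μ : ι → ℝ, (∀ i ∈ T, 0 ≤ μ i) → ∑ i ∈ T, μ i = 1 →
      f (∑ i ∈ T, μ i • b i) = A (∑ i ∈ T, μ i • b i) := by
  classical
  let Bm : (ι → ℝ) →ₗ[ℝ] V × ℝ :=
    (∑ i ∈ T, (LinearMap.proj i : (ι → ℝ) →ₗ[ℝ] ℝ).smulRight (b i)).prod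
      (∑ i ∈ T, (LinearMap.proj i : (ι → ℝ) →ₗ[ℝ] ℝ))
  let Φ : (ι → ℝ) →ₗ[ℝ] W := ∑ i ∈ T, (LinearMap.proj i : (ι → ℝ) →ₗ[ℝ] ℝ).smulRight (φ i)
  have hB : ∀ c, Bm c = (∑ i ∈ T, c i • b i, ∑ i ∈ T, c i) := fun c => by
    simp [Bm]
  have hΦ : ∀ c, Φ c = ∑ i ∈ T, c i • φ i := fun c => by simp [Φ, LinearMap.sum_apply]
  -- The points `b i` may be affinely dependent, so well-definedness is at stake. A relation with
  -- total weight zero is split into its positive and negative parts; divided by their common mass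
  -- `s` these are two convex combinations of the same point, to which `h` applies.
  have hker : LinearMap.ker Bm ≤ LinearMap.ker Φ := by
    intro c hc
    rw [LinearMap.mem_ker, hB, Prod.mk_eq_zero] at hc
    rw [LinearMap.mem_ker, hΦ]
    obtain ⟨hc1, hc2⟩ := hc
    set s := ∑ i ∈ T, max (c i) 0 with hs
    have hsp : ∀ i, c i = max (c i) 0 - max (-c i) 0 := fun i => by
      rcases le_total (c i) 0 with h0 | h0 <;> simp [h0]
    have hs' : ∑ i ∈ T, max (-c i) 0 = s := by
      have : ∑ i ∈ T, c i = s - ∑ i ∈ T, max (-c i) 0 := by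
        rw [hs, ← Finset.sum_sub_distrib]; exact Finset.sum_congr rfl fun i _ => hsp i
      linarith
    have hs0 : 0 ≤ s := Finset.sum_nonneg fun i _ => le_max_right _ _
    have hb : ∑ i ∈ T, max (c i) 0 • b i = ∑ i ∈ T, max (-c i) 0 • b i := by
      rw [← sub_eq_zero, ← Finset.sum_sub_distrib, ← hc1]
      refine Finset.sum_congr rfl fun i _ => ?_
      rw [← sub_smul, ← hsp]
    rcases hs0.eq_or_lt with h0 | h0
    · have h1 : ∀ i ∈ T, c i = 0 := by
        intro i hi
        have e1 := (Finset.sum_eq_zero_iff_of_nonneg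
          (fun i _ => le_max_right (c i) 0)).1 h0.symm i hi
        have e2 := (Finset.sum_eq_zero_iff_of_nonneg
          (fun i _ => le_max_right (-c i) 0)).1 (hs'.trans h0.symm) i hi
        rw [hsp i, e1, e2, sub_zero]
      exact Finset.sum_eq_zero fun i hi => by rw [h1 i hi, zero_smul]
    · have e1 := h (fun i => s⁻¹ * max (c i) 0)
        (fun i _ => mul_nonneg (inv_nonneg.2 hs0) (le_max_right _ _))
        (by rw [← Finset.mul_sum, ← hs, inv_mul_cancel₀ h0.ne'])
      have e2 := h (fun i => s⁻¹ * max (-c i) 0)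
        (fun i _ => mul_nonneg (inv_nonneg.2 hs0) (le_max_right _ _))
        (by rw [← Finset.mul_sum, hs', inv_mul_cancel₀ h0.ne'])
      simp only [mul_smul, ← Finset.smul_sum] at e1 e2
      rw [hb, e2] at e1
      have e3 := smul_right_injective W (inv_ne_zero h0.ne') e1
      rw [Finset.sum_congr rfl fun i _ => by rw [hsp i, sub_smul], Finset.sum_sub_distrib]
      simpa [sub_eq_zero] using e3.symm
  obtain ⟨G, hG⟩ : ∃ G : V × ℝ →ₗ[ℝ] W, G ∘ₗ Bm = Φ := by
    let f0 : LinearMap.range Bm →ₗ[ℝ] W :=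
      ((LinearMap.ker Bm).liftQ Φ hker) ∘ₗ Bm.quotKerEquivRange.symm.toLinearMap
    obtain ⟨G, hG⟩ := LinearMap.exists_extend f0
    refine ⟨G, LinearMap.ext fun c => ?_⟩
    have := LinearMap.congr_fun hG ⟨Bm c, LinearMap.mem_range_self Bm c⟩
    simp only [LinearMap.comp_apply, Submodule.subtype_apply] at this ⊢
    rw [this]
    simp only [f0, LinearMap.comp_apply, LinearEquiv.coe_coe]
    have hq : Bm.quotKerEquivRange.symm ⟨Bm c, LinearMap.mem_range_self Bm c⟩ =
        (LinearMap.ker Bm).mkQ c := by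
      rw [LinearEquiv.symm_apply_eq]
      rfl
    rw [hq]
    simp
  refine ⟨G.toAffineMap.comp ((AffineMap.id ℝ V).prod (AffineMap.const ℝ V (1 : ℝ))), fun μ h0 h1 => ?_⟩
  rw [h μ h0 h1, ← hΦ, ← hG]
  simp [hB, h1]

theorem Convex.sum_mem_and_map_eq {V W ι : Type*} [AddCommGroup V] [Module ℝ V]
    [AddCommGroup W] [Module ℝ W] [Fintype ι] {C : Set V} (hC : Convex ℝ C) {f : V → W}
    {A : V →ᵃ[ℝ] W} (hA : EqOn f A C) {μ : ι → ℝ} {x : ι → V} (h0 : ∀ a, 0 ≤ μ a)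
    (h1 : ∑ a, μ a = 1) (hx : ∀ a, 0 < μ a → x a ∈ C) :
    ∑ a, μ a • x a ∈ C ∧ f (∑ a, μ a • x a) = ∑ a, μ a • f (x a) := by
  classical
  have hμ : ∀ a, ¬ 0 < μ a → μ a = 0 := fun a h => le_antisymm (not_lt.1 h) (h0 a)
  obtain ⟨a0, ha0⟩ : ∃ a, 0 < μ a := by
    by_contra! h
    have : ∑ a, μ a ≤ 0 := Finset.sum_nonpos fun a _ => h a
    linarith
  -- Points of weight zero need not lie in `C`; they are replaced by one that does.
  set x' : ι → V := fun a => if 0 < μ a then x a else x a0 with hx'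
  have hmem : ∀ a, x' a ∈ C := by
    intro a
    by_cases h : 0 < μ a
    · simpa [hx', h] using hx a h
    · simpa [hx', h] using hx a0 ha0
  have hsum : ∑ a, μ a • x a = ∑ a, μ a • x' a := Finset.sum_congr rfl fun a _ => by
    by_cases h : 0 < μ a
    · simp [hx', h]
    · simp [hμ a h]
  have hS : ∑ a, μ a • x a ∈ C := by
    rw [hsum]
    exact hC.sum_mem (fun a _ => h0 a) h1 fun a _ => hmem a
  refine ⟨hS, ?_⟩
  rw [hA hS, hsum]
  have := Finset.univ.map_affineCombination x' μ h1 A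
  rw [Finset.univ.affineCombination_eq_linear_combination _ _ h1,
    Finset.univ.affineCombination_eq_linear_combination _ _ h1] at this
  rw [this]
  refine Finset.sum_congr rfl fun a _ => ?_
  by_cases h : 0 < μ a
  · simp only [Function.comp]
    rw [← hA (hmem a)]
    simp [hx', h]
  · simp [hμ a h]

theorem mem_convexHull_image_iff {V ι : Type*} [AddCommGroup V] [Module ℝ V] [DecidableEq V]
    (T : Finset ι) (b : ι → V) (x : V) :
    x ∈ convexHull ℝ ((T.image b : Finset V) : Set V) ↔
      ∃ μ : ι → ℝ, (∀ i ∈ T, 0 ≤ μ i) ∧ ∑ i ∈ T, μ i = 1 ∧ ∑ i ∈ T, μ i • b i = x := by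
  constructor
  · intro hx
    rw [Finset.coe_image] at hx
    have : convexHull ℝ (b '' (T : Set ι)) ⊆ {x | ∃ μ : ι → ℝ, (∀ i ∈ T, 0 ≤ μ i) ∧
        ∑ i ∈ T, μ i = 1 ∧ ∑ i ∈ T, μ i • b i = x} := by
      classical
      refine convexHull_min ?_ ?_
      · rintro _ ⟨i, hi, rfl⟩
        have hi : i ∈ T := hi
        exact ⟨Pi.single i 1, fun j _ => by
          by_cases h : j = i <;> simp [h], by simp [Pi.single_apply, hi], by
          simp [Pi.single_apply, hi]⟩
      · rintro _ ⟨μ, h1, h2, rfl⟩ _ ⟨ν, k1, k2, rfl⟩ r s hr hs hrs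
        refine ⟨fun i => r * μ i + s * ν i, fun i hi => add_nonneg (mul_nonneg hr (h1 i hi))
          (mul_nonneg hs (k1 i hi)), ?_, ?_⟩
        · rw [Finset.sum_add_distrib, ← Finset.mul_sum, ← Finset.mul_sum, h2, k2]; linarith
        · simp only [add_smul, Finset.sum_add_distrib, mul_smul, Finset.smul_sum]
    exact this hx
  · rintro ⟨μ, h0, h1, rfl⟩
    refine (convex_convexHull ℝ _).sum_mem h0 h1 fun i hi => subset_convexHull ℝ _ ?_
    simpa using ⟨i, hi, rfl⟩

/-- The image of each hull is the hull of the images of its generators, and by injectivity the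
inverse respects convex combinations of these, hence is affine there. -/
theorem IsCompactPL.exists_inverse {f : V → W} {P : Set V} (hf : IsCompactPL f P)
    (hinj : InjOn f P) : ∃ C : Finset (Finset W), f '' P = ⋃ F ∈ C, convexHull ℝ (F : Set W) ∧
      ∀ F ∈ C, ∃ A : W →ᵃ[ℝ] V, EqOn (Function.invFunOn f P) A (convexHull ℝ (F : Set W)) := by
  classical
  obtain ⟨C, hP, hC⟩ := hf
  have himg : ∀ F ∈ C, ∀ μ : V → ℝ, (∀ i ∈ F, 0 ≤ μ i) → ∑ i ∈ F, μ i = 1 →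
      ∑ i ∈ F, μ i • i ∈ P ∧ f (∑ i ∈ F, μ i • i) = ∑ i ∈ F, μ i • f i := by
    intro F hF μ h0 h1
    obtain ⟨A, hA⟩ := hC F hF
    have hm : ∑ i ∈ F, μ i • i ∈ convexHull ℝ (F : Set V) := Finset.mem_convexHull'.2 ⟨μ, h0, h1, rfl⟩
    refine ⟨by rw [hP]; exact mem_biUnion hF hm, ?_⟩
    rw [hA hm]
    have := F.map_affineCombination (fun i => i) μ h1 A
    rw [F.affineCombination_eq_linear_combination _ _ h1,
      F.affineCombination_eq_linear_combination _ _ h1] at this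
    rw [this]
    exact Finset.sum_congr rfl fun i hi => by
      rw [hA (subset_convexHull ℝ _ (Finset.mem_coe.2 hi))]; rfl
  refine ⟨C.image fun F => F.image f, ?_, ?_⟩
  · ext y
    simp only [mem_image, mem_iUnion, Finset.mem_image, exists_prop]
    constructor
    · rintro ⟨x, hx, rfl⟩
      rw [hP] at hx
      obtain ⟨F, hF, hxF⟩ := mem_iUnion₂.1 hx
      obtain ⟨μ, h0, h1, rfl⟩ := Finset.mem_convexHull'.1 hxF
      exact ⟨_, ⟨F, hF, rfl⟩, (mem_convexHull_image_iff F f _).2 ⟨μ, h0, h1, (himg F hF μ h0 h1).2.symm⟩⟩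
    · rintro ⟨_, ⟨F, hF, rfl⟩, hy⟩
      obtain ⟨μ, h0, h1, rfl⟩ := (mem_convexHull_image_iff F f _).1 hy
      exact ⟨_, himg F hF μ h0 h1⟩
  · intro F' hF'
    obtain ⟨F, hF, rfl⟩ := Finset.mem_image.1 hF'
    obtain ⟨A, hA⟩ := exists_affineMap_of_convexCombination F f id (Function.invFunOn f P)
      fun μ h0 h1 => by
        obtain ⟨hm, he⟩ := himg F hF μ h0 h1
        rw [← he]
        exact hinj.leftInvOn_invFunOn hm
    refine ⟨A, fun y hy => ?_⟩
    obtain ⟨μ, h0, h1, rfl⟩ := (mem_convexHull_image_iff F f _).1 hy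
    exact hA μ h0 h1

theorem IsCompactPL.isPLEmbeddingOn {f : V → W} {P : Set V} (hf : IsCompactPL f P)
    (hinj : InjOn f P) : IsPLEmbeddingOn f P := by
  obtain ⟨C, h1, h2⟩ := hf.exists_inverse hinj
  exact ⟨hf.isPLOn, Function.invFunOn f P, IsCompactPL.isPLOn ⟨C, h1, h2⟩,
    fun x hx => hinj.leftInvOn_invFunOn hx⟩

theorem IsCompactPolyhedron.prod {P : Set V} {Q : Set W} (hP : IsCompactPolyhedron P)
    (hQ : IsCompactPolyhedron Q) : IsCompactPolyhedron (P ×ˢ Q) := by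
  classical
  obtain ⟨C, rfl⟩ := hP
  obtain ⟨D, rfl⟩ := hQ
  refine ⟨(C ×ˢ D).image fun F => F.1 ×ˢ F.2, ?_⟩
  ext ⟨x, y⟩
  simp only [mem_prod, mem_iUnion, Finset.mem_image, Finset.mem_product, Prod.exists, exists_prop]
  constructor
  · rintro ⟨⟨F, hF, hx⟩, G, hG, hy⟩
    refine ⟨_, ⟨F, G, ⟨hF, hG⟩, rfl⟩, ?_⟩
    rw [Finset.coe_product, convexHull_prod]
    exact ⟨hx, hy⟩
  · rintro ⟨_, ⟨F, G, ⟨hF, hG⟩, rfl⟩, h⟩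
    rw [Finset.coe_product, convexHull_prod] at h
    exact ⟨⟨F, hF, h.1⟩, G, hG, h.2⟩

end PiecewiseLinear

/-! ### Flags of strata as barycentric coordinates. -/

section Flags

/-- The sign vector `s` is obtained from `t` by zeroing some entries. -/
def ZLe {I : Type*} (s t : I → SignType) : Prop := ∀ i, s i = 0 ∨ s i = t i

theorem ZLe.refl {I : Type*} (s : I → SignType) : ZLe s s := fun _ => Or.inr rfl

theorem ZLe.trans {I : Type*} {s t u : I → SignType} (h : ZLe s t) (h' : ZLe t u) : ZLe s u := by
  intro i
  rcases h i with h1 | h1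
  · exact Or.inl h1
  · rw [h1]; exact h' i

/-- The number of nonzero entries. -/
def nzCard {I : Type*} [Fintype I] (s : I → SignType) : ℕ := (Finset.univ.filter fun i => s i ≠ 0).card

theorem ZLe.nzCard_le {I : Type*} [Fintype I] {s t : I → SignType} (h : ZLe s t) :
    nzCard s ≤ nzCard t := by
  refine Finset.card_le_card fun i hi => ?_
  simp only [Finset.mem_filter, Finset.mem_univ, true_and] at hi ⊢
  rcases h i with h1 | h1
  · exact absurd h1 hi
  · rwa [← h1]

theorem ZLe.eq_of_nzCard_le {I : Type*} [Fintype I] {s t : I → SignType} (h : ZLe s t)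
    (hc : nzCard t ≤ nzCard s) : s = t := by
  have hsub : (Finset.univ.filter fun i => s i ≠ 0) ⊆ Finset.univ.filter fun i => t i ≠ 0 := by
    intro i hi
    simp only [Finset.mem_filter, Finset.mem_univ, true_and] at hi ⊢
    rcases h i with h1 | h1
    · exact absurd h1 hi
    · rwa [← h1]
  have heq := Finset.eq_of_subset_of_card_le hsub hc
  funext i
  rcases h i with h1 | h1
  · have : i ∉ Finset.univ.filter fun i => s i ≠ 0 := by simp [h1]
    rw [heq] at this
    simp only [Finset.mem_filter, Finset.mem_univ, true_and, not_not] at this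
    rw [h1, this]
  · exact h1

/-- The sign vector of a point with respect to a family of functions. -/
noncomputable def signVec {I V : Type*} (φ : I → V → ℝ) (p : V) : I → SignType := fun i => SignType.sign (φ i p)

/-- The points of `N` in the closure of the stratum of `p`. -/
def stratumClosure {I V : Type*} (φ : I → V → ℝ) (N : Set V) (p : V) : Set V :=
  {q ∈ N | ZLe (signVec φ q) (signVec φ p)}

/-- The strata closures are convex and the functions are affine on them. -/
def AffineStrata {I V : Type*} [AddCommGroup V] [Module ℝ V] (φ : I → V → ℝ) (N : Set V) : Prop :=
  ∀ p ∈ N, Convex ℝ (stratumClosure φ N p) ∧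
    ∀ i, ∃ A : V →ᵃ[ℝ] ℝ, EqOn (φ i) A (stratumClosure φ N p)

/-- The support of `μ` is a chain of sign vectors. -/
def ChainSupp {I ι : Type*} (s : ι → I → SignType) (μ : ι → ℝ) : Prop :=
  ∀ a b, 0 < μ a → 0 < μ b → ZLe (s a) (s b) ∨ ZLe (s b) (s a)

theorem ChainSupp.mono {I ι : Type*} {s : ι → I → SignType} {μ ν : ι → ℝ} (h : ChainSupp s μ)
    (hνμ : ∀ a, 0 < ν a → 0 < μ a) : ChainSupp s ν :=
  fun a b ha hb => h a b (hνμ a ha) (hνμ b hb)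

theorem ChainSupp.exists_top {I ι : Type*} [Fintype I] [Fintype ι] {s : ι → I → SignType}
    {μ : ι → ℝ} (h : ChainSupp s μ) (hpos : ∃ a, 0 < μ a) :
    ∃ a, 0 < μ a ∧ ∀ b, 0 < μ b → ZLe (s b) (s a) := by
  obtain ⟨a0, ha0⟩ := hpos
  obtain ⟨a, ha, hmax⟩ := Finset.exists_max_image (Finset.univ.filter fun a => 0 < μ a)
    (fun a => nzCard (s a)) ⟨a0, by simpa using ha0⟩
  simp only [Finset.mem_filter, Finset.mem_univ, true_and] at ha hmax
  refine ⟨a, ha, fun b hb => ?_⟩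
  rcases h b a hb ha with h1 | h1
  · exact h1
  · rw [h1.eq_of_nzCard_le (hmax b hb)]; exact ZLe.refl _

variable {I ι V : Type*} [Fintype ι] [AddCommGroup V] [Module ℝ V]
  {φ : I → V → ℝ} {N : Set V} {s : ι → I → SignType} {b : ι → V}

theorem sum_mem_stratumClosure (hA : AffineStrata φ N) {p : V} (hp : p ∈ N) {μ : ι → ℝ}
    (h0 : ∀ a, 0 ≤ μ a) (h1 : ∑ a, μ a = 1) (hb : ∀ a, 0 < μ a → b a ∈ stratumClosure φ N p) :
    ∑ a, μ a • b a ∈ stratumClosure φ N p ∧ ∀ i, φ i (∑ a, μ a • b a) = ∑ a, μ a * φ i (b a) := by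
  have h := (hA p hp).1.sum_mem_and_map_eq (f := id) (A := AffineMap.id ℝ V) (fun _ _ => rfl) h0 h1 hb
  refine ⟨h.1, fun i => ?_⟩
  obtain ⟨A, hAi⟩ := (hA p hp).2 i
  exact ((hA p hp).1.sum_mem_and_map_eq hAi h0 h1 hb).2

/-- Each `φ i` is affine on the closure of the top stratum. There every term is zero or has the sign
prescribed by the top vertex, and the term of the top vertex itself has exactly that sign. Hence a
combination along a flag reveals its top vertex. -/
theorem signVec_sum_of_top (hA : AffineStrata φ N) (hbN : ∀ a, b a ∈ N)
    (hbs : ∀ a, signVec φ (b a) = s a) {μ : ι → ℝ} (h0 : ∀ a, 0 ≤ μ a) (h1 : ∑ a, μ a = 1)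
    {a : ι} (ha : 0 < μ a) (htop : ∀ c, 0 < μ c → ZLe (s c) (s a)) :
    signVec φ (∑ c, μ c • b c) = s a := by
  obtain ⟨-, hφ⟩ := sum_mem_stratumClosure hA (hbN a) h0 h1
    fun c hc => (⟨hbN c, by rw [hbs, hbs]; exact htop c hc⟩ : b c ∈ stratumClosure φ N (b a))
  have hcmp : ∀ i c, 0 < μ c → SignType.sign (φ i (b c)) = 0 ∨ SignType.sign (φ i (b c)) = s a i := by
    intro i c hc
    have := htop c hc i
    rw [← hbs c] at this
    exact this
  have hai : ∀ i, SignType.sign (φ i (b a)) = s a i := fun i => congrFun (hbs a) i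
  funext i
  rw [signVec, hφ i]
  rcases hs : s a i with _ | _ | _
  · refine sign_eq_zero_iff.2 (Finset.sum_eq_zero fun c _ => ?_)
    rcases (h0 c).eq_or_lt with h | h
    · rw [← h, zero_mul]
    · have := hcmp i c h
      rw [hs] at this
      rw [sign_eq_zero_iff.1 (or_self_iff.1 this), mul_zero]
  · refine sign_eq_neg_one_iff.2 (Finset.sum_neg' (fun c _ => ?_) ⟨a, Finset.mem_univ a, ?_⟩)
    · rcases (h0 c).eq_or_lt with h | h
      · rw [← h, zero_mul]
      · refine mul_nonpos_of_nonneg_of_nonpos (h0 c) ?_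
        rcases hcmp i c h with h2 | h2
        · exact (sign_eq_zero_iff.1 h2).le
        · rw [hs] at h2; exact (sign_eq_neg_one_iff.1 h2).le
    · have := hai i
      rw [hs] at this
      exact mul_neg_of_pos_of_neg ha (sign_eq_neg_one_iff.1 this)
  · refine sign_eq_one_iff.2 (Finset.sum_pos' (fun c _ => ?_) ⟨a, Finset.mem_univ a, ?_⟩)
    · rcases (h0 c).eq_or_lt with h | h
      · rw [← h, zero_mul]
      · refine mul_nonneg (h0 c) ?_
        rcases hcmp i c h with h2 | h2
        · exact (sign_eq_zero_iff.1 h2).ge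
        · rw [hs] at h2; exact (sign_eq_one_iff.1 h2).le
    · have := hai i
      rw [hs] at this
      exact mul_pos ha (sign_eq_one_iff.1 this)

variable [Fintype I]

/-- Uniqueness of the representation of a point by a flag. -/
theorem flag_unique_of_card_le (hA : AffineStrata φ N) (hbN : ∀ a, b a ∈ N)
    (hbs : ∀ a, signVec φ (b a) = s a) (hs : Function.Injective s) (n : ℕ) : ∀ μ ν : ι → ℝ,
    (∀ a, 0 ≤ μ a) → (∀ a, 0 ≤ ν a) → ChainSupp s μ → ChainSupp s ν → ∑ a, μ a = ∑ a, ν a →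
    ∑ a, μ a • b a = ∑ a, ν a • b a →
    (Finset.univ.filter fun a => 0 < μ a).card + (Finset.univ.filter fun a => 0 < ν a).card ≤ n →
    μ = ν := by
  classical
  induction n with
  | zero =>
    intro μ ν hμ hν _ _ _ _ hc
    have h1 : ∀ a, ¬ 0 < μ a := fun a ha => by
      have := Finset.card_eq_zero.1 (show (Finset.univ.filter fun a => 0 < μ a).card = 0 by omega)
      simpa [ha] using Finset.ext_iff.1 this a
    have h2 : ∀ a, ¬ 0 < ν a := fun a ha => by
      have := Finset.card_eq_zero.1 (show (Finset.univ.filter fun a => 0 < ν a).card = 0 by omega)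
      simpa [ha] using Finset.ext_iff.1 this a
    funext a
    rw [le_antisymm (not_lt.1 (h1 a)) (hμ a), le_antisymm (not_lt.1 (h2 a)) (hν a)]
  | succ n ih =>
    intro μ ν hμ hν cμ cν hsum hvec hc
    rcases (Finset.sum_nonneg fun a (_ : a ∈ Finset.univ) => hμ a).eq_or_lt with h0 | h0
    · have e1 := (Finset.sum_eq_zero_iff_of_nonneg fun a _ => hμ a).1 h0.symm
      have e2 := (Finset.sum_eq_zero_iff_of_nonneg fun a _ => hν a).1 (hsum ▸ h0.symm)
      funext a
      rw [e1 a (Finset.mem_univ a), e2 a (Finset.mem_univ a)]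
    · set S := ∑ a, μ a with hS
      -- The sign vector of the normalised point names the top vertex of any flag representing it,
      -- so both representations have the same top vertex.
      have topS : ∀ {κ : ι → ℝ}, (∀ a, 0 ≤ κ a) → ChainSupp s κ → ∑ a, κ a = S →
          ∃ a, 0 < κ a ∧ signVec φ (S⁻¹ • ∑ c, κ c • b c) = s a := by
        intro κ hκ cκ hκS
        obtain ⟨a, ha, htop⟩ := cκ.exists_top (by
          by_contra! h
          have : ∑ a, κ a ≤ 0 := Finset.sum_nonpos fun a _ => h a
          linarith)
        refine ⟨a, ha, ?_⟩
        have := signVec_sum_of_top hA hbN hbs (μ := fun c => S⁻¹ * κ c)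
          (fun c => mul_nonneg (inv_nonneg.2 h0.le) (hκ c))
          (by rw [← Finset.mul_sum, hκS, inv_mul_cancel₀ h0.ne']) (a := a)
          (mul_pos (inv_pos.2 h0) ha)
          (fun c hc => htop c ((mul_pos_iff_of_pos_left (inv_pos.2 h0)).1 hc))
        simpa only [Finset.smul_sum, mul_smul] using this
      obtain ⟨a, ha, hsa⟩ := topS hμ cμ rfl
      obtain ⟨a', ha', hsa'⟩ := topS hν cν hsum.symm
      obtain rfl : a = a' := hs (by rw [← hsa, ← hsa', hvec])
      -- Subtracting the smaller top coefficient from both sides kills at least one positive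
      -- coefficient. This is why the induction allows arbitrary equal totals instead of total `1`.
      set m := min (μ a) (ν a) with hm
      have hm0 : 0 < m := lt_min ha ha'
      have hdec : ∀ {κ : ι → ℝ}, (∀ c, 0 ≤ κ c) → m ≤ κ a →
          (∀ c, 0 ≤ (κ - Pi.single a m : ι → ℝ) c) ∧ (∀ c, 0 < (κ - Pi.single a m : ι → ℝ) c → 0 < κ c) ∧
          ∑ c, (κ - Pi.single a m : ι → ℝ) c = ∑ c, κ c - m ∧
          ∑ c, (κ - Pi.single a m : ι → ℝ) c • b c = ∑ c, κ c • b c - m • b a := by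
        intro κ hκ hmκ
        refine ⟨fun c => ?_, fun c hc => ?_, ?_, ?_⟩
        · rcases eq_or_ne c a with rfl | h
          · simpa using hmκ
          · simpa [h] using hκ c
        · rcases eq_or_ne c a with rfl | h
          · simp at hc; linarith
          · simpa [h] using hc
        · simp [Finset.sum_sub_distrib]
        · simp [sub_smul, Finset.sum_sub_distrib, Pi.single_apply, ite_smul]
      obtain ⟨d1, d2, d3, d4⟩ := hdec hμ (min_le_left _ _)
      obtain ⟨e1, e2, e3, e4⟩ := hdec hν (min_le_right _ _)
      have hsub : ∀ {κ : ι → ℝ}, (∀ c, 0 < (κ - Pi.single a m : ι → ℝ) c → 0 < κ c) →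
          (Finset.univ.filter fun c => 0 < (κ - Pi.single a m : ι → ℝ) c) ⊆
            Finset.univ.filter fun c => 0 < κ c := by
        intro κ h c hc
        simp only [Finset.mem_filter, Finset.mem_univ, true_and] at hc ⊢
        exact h c hc
      have hlt : ∀ {κ : ι → ℝ}, (∀ c, 0 < (κ - Pi.single a m : ι → ℝ) c → 0 < κ c) → κ a = m →
          (Finset.univ.filter fun c => 0 < (κ - Pi.single a m : ι → ℝ) c).card <
            (Finset.univ.filter fun c => 0 < κ c).card := by
        intro κ h hκ
        refine Finset.card_lt_card ⟨hsub h, fun hcon => ?_⟩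
        have : a ∈ Finset.univ.filter fun c => 0 < (κ - Pi.single a m : ι → ℝ) c :=
          hcon (by simpa [hκ] using hm0)
        simp [hκ] at this
      have heq : μ - Pi.single a m = ν - Pi.single a m := by
        refine ih _ _ d1 e1 (cμ.mono d2) (cν.mono e2) (by rw [d3, e3, ← hsum])
          (by rw [d4, e4, hvec]) ?_
        have c1 := Finset.card_le_card (hsub d2)
        have c2 := Finset.card_le_card (hsub e2)
        rcases min_choice (μ a) (ν a) with h | h
        · have := hlt d2 (by rw [hm, h])
          omega
        · have := hlt e2 (by rw [hm, h])
          omega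
      exact sub_left_injective heq

theorem flag_unique (hA : AffineStrata φ N) (hbN : ∀ a, b a ∈ N)
    (hbs : ∀ a, signVec φ (b a) = s a) (hs : Function.Injective s) {μ ν : ι → ℝ}
    (hμ : ∀ a, 0 ≤ μ a) (hν : ∀ a, 0 ≤ ν a) (cμ : ChainSupp s μ) (cν : ChainSupp s ν)
    (hsum : ∑ a, μ a = ∑ a, ν a) (hvec : ∑ a, μ a • b a = ∑ a, ν a • b a) : μ = ν :=
  flag_unique_of_card_le hA hbN hbs hs _ μ ν hμ hν cμ cν hsum hvec le_rfl

/-- Every ray inside a stratum leaves it through a smaller stratum. -/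
def RayExit (φ : I → V → ℝ) (N : Set V) : Prop :=
  ∀ p ∈ N, ∀ q ∈ N, signVec φ q = signVec φ p → p ≠ q → ∃ θ : ℝ, 1 < θ ∧
    q + θ • (p - q) ∈ N ∧ ZLe (signVec φ (q + θ • (p - q))) (signVec φ p) ∧
    signVec φ (q + θ • (p - q)) ≠ signVec φ p

/-- The ray from the vertex `b a` of the stratum of `p` through `p` leaves the stratum at a point
with fewer nonzero signs. That point has a flag by induction, and `p` lies between it and `b a`. -/
theorem exists_flag (hR : RayExit φ N) (hbN : ∀ a, b a ∈ N)
    (hbs : ∀ a, signVec φ (b a) = s a) (hall : ∀ p ∈ N, ∃ a, s a = signVec φ p) (n : ℕ) :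
    ∀ p ∈ N, nzCard (signVec φ p) ≤ n → ∃ μ : ι → ℝ, (∀ a, 0 ≤ μ a) ∧ ∑ a, μ a = 1 ∧
      ChainSupp s μ ∧ ∑ a, μ a • b a = p ∧ ∀ a, 0 < μ a → ZLe (s a) (signVec φ p) := by
  classical
  induction n with
  | zero =>
    intro p hp hn
    obtain ⟨a, ha⟩ := hall p hp
    have hpb : p = b a := by
      by_contra hne
      obtain ⟨θ, -, hN, h1, h2⟩ := hR p hp (b a) (hbN a) (by rw [hbs, ha]) hne
      exact h2 (h1.eq_of_nzCard_le (by omega))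
    have hsing : ∀ c, 0 < (Pi.single a 1 : ι → ℝ) c → c = a := fun c hc => by
      by_contra h; simp [h] at hc
    refine ⟨Pi.single a 1, fun c => ?_, by simp, fun c c' hc hc' => ?_, ?_, fun c hc => ?_⟩
    · by_cases h : c = a <;> simp [h]
    · rw [hsing c hc, hsing c' hc']; exact Or.inl (ZLe.refl _)
    · simp [Pi.single_apply, ite_smul, hpb]
    · rw [hsing c hc, ha]; exact ZLe.refl _
  | succ n ih =>
    intro p hp hn
    obtain ⟨a, ha⟩ := hall p hp
    by_cases hpb : p = b a
    · have hsing : ∀ c, 0 < (Pi.single a 1 : ι → ℝ) c → c = a := fun c hc => by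
        by_contra h; simp [h] at hc
      refine ⟨Pi.single a 1, fun c => ?_, by simp, fun c c' hc hc' => ?_, ?_, fun c hc => ?_⟩
      · by_cases h : c = a <;> simp [h]
      · rw [hsing c hc, hsing c' hc']; exact Or.inl (ZLe.refl _)
      · simp [Pi.single_apply, ite_smul, hpb]
      · rw [hsing c hc, ha]; exact ZLe.refl _
    · obtain ⟨θ, hθ, hN, h1, h2⟩ := hR p hp (b a) (hbN a) (by rw [hbs, ha]) hpb
      have hlt : nzCard (signVec φ (b a + θ • (p - b a))) < nzCard (signVec φ p) :=
        lt_of_not_ge fun h => h2 (h1.eq_of_nzCard_le h)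
      obtain ⟨μ, m0, m1, mc, mv, mz⟩ := ih _ hN (by omega)
      have hθ0 : 0 < θ := by linarith
      have hθ1 : 0 ≤ 1 - θ⁻¹ := sub_nonneg.2 (inv_le_one_of_one_le₀ hθ.le)
      have hsupp : ∀ c, 0 < (fun c => θ⁻¹ * μ c + (1 - θ⁻¹) * (Pi.single a 1 : ι → ℝ) c) c →
          c = a ∨ 0 < μ c := by
        intro c hc
        by_cases h : c = a
        · exact Or.inl h
        · right
          simpa [h, hθ0] using hc
      have hz : ∀ c, 0 < (fun c => θ⁻¹ * μ c + (1 - θ⁻¹) * (Pi.single a 1 : ι → ℝ) c) c →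
          ZLe (s c) (signVec φ p) := by
        intro c hc
        rcases hsupp c hc with rfl | h
        · rw [ha]; exact ZLe.refl _
        · exact (mz c h).trans h1
      -- If `r = b a + θ (p - b a)` is the exit point, then `p = θ⁻¹ r + (1 - θ⁻¹) b a`.
      refine ⟨fun c => θ⁻¹ * μ c + (1 - θ⁻¹) * (Pi.single a 1 : ι → ℝ) c, fun c => ?_, ?_, ?_, ?_, hz⟩
      · refine add_nonneg (mul_nonneg (inv_nonneg.2 hθ0.le) (m0 c)) (mul_nonneg hθ1 ?_)
        by_cases h : c = a <;> simp [h]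
      · rw [Finset.sum_add_distrib, ← Finset.mul_sum, ← Finset.mul_sum, m1]
        simp
      · intro c c' hc hc'
        rcases hsupp c hc with rfl | h
        · right; rw [ha]; exact hz c' hc'
        rcases hsupp c' hc' with rfl | h'
        · left; rw [ha]; exact hz c hc
        exact mc c c' h h'
      · simp only [add_smul, mul_smul, Finset.sum_add_distrib, ← Finset.smul_sum, mv]
        simp only [Pi.single_apply, ite_smul, zero_smul, one_smul, Finset.sum_ite_eq', Finset.mem_univ, if_true]
        match_scalars
        · field_simp
          ring
        · field_simp

end Flags

/-! ### Coloured triangulations and arrangements compatible with a non-degenerate map. -/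

section Triangulation

/-- On the ray `α + θ (β - α)` an entry with `|β i| < |α i|` reaches zero at `θ = |α i| / (|α i| -
|β i|)`, and the other entries never change sign. The earliest of these times works. -/
theorem exists_exit_time {I : Type*} [Fintype I] (α β : I → ℝ)
    (h : ∀ i, SignType.sign (α i) = SignType.sign (β i)) (hlt : ∃ i, |β i| < |α i|) :
    ∃ θ : ℝ, 1 < θ ∧ (∀ i, SignType.sign (α i + θ * (β i - α i)) = 0 ∨
        SignType.sign (α i + θ * (β i - α i)) = SignType.sign (β i)) ∧
      ∃ i, SignType.sign (α i + θ * (β i - α i)) = 0 ∧ SignType.sign (β i) ≠ 0 := by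
  obtain ⟨i0, hi0⟩ := hlt
  obtain ⟨j, hj, hmin⟩ := Finset.exists_min_image (Finset.univ.filter fun i => |β i| < |α i|)
    (fun i => |α i| / (|α i| - |β i|)) ⟨i0, by simpa using hi0⟩
  simp only [Finset.mem_filter, Finset.mem_univ, true_and] at hj hmin
  have hβ0 : ∀ i, |β i| < |α i| → β i ≠ 0 := by
    intro i hi h0
    have := h i
    rw [h0, sign_zero, sign_eq_zero_iff] at this
    simp [this, h0] at hi
  have hj' : 0 < |α j| - |β j| := by linarith
  set θ := |α j| / (|α j| - |β j|) with hθ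
  have hβj := abs_pos.2 (hβ0 j hj)
  have hθ1 : 1 < θ := by
    rw [hθ, lt_div_iff₀ hj']; linarith
  have hθj : θ * (|α j| - |β j|) = |α j| := div_mul_cancel₀ _ hj'.ne'
  refine ⟨θ, hθ1, fun i => ?_, j, ?_, fun h0 => hβ0 j hj (sign_eq_zero_iff.1 h0)⟩
  · have hle : θ * (|α i| - |β i|) ≤ |α i| := by
      by_cases hi : |β i| < |α i|
      · have := hmin i hi
        rwa [le_div_iff₀ (by linarith)] at this
      · have h1 := abs_nonneg (α i)
        nlinarith
    rcases lt_trichotomy (β i) 0 with hb | hb | hb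
    · have ha : α i < 0 := by
        have := h i
        rwa [sign_neg hb, sign_eq_neg_one_iff] at this
      rw [abs_of_neg hb, abs_of_neg ha] at hle
      rcases (show α i + θ * (β i - α i) ≤ 0 by linarith).eq_or_lt with h2 | h2
      · left; rw [h2, sign_zero]
      · right; rw [sign_neg h2, sign_neg hb]
    · have ha : α i = 0 := by
        have := h i
        rwa [hb, sign_zero, sign_eq_zero_iff] at this
      simp [ha, hb]
    · have ha : 0 < α i := by
        have := h i
        rwa [sign_pos hb, sign_eq_one_iff] at this
      rw [abs_of_pos hb, abs_of_pos ha] at hle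
      rcases (show 0 ≤ α i + θ * (β i - α i) by linarith).eq_or_lt with h2 | h2
      · left; rw [← h2, sign_zero]
      · right; rw [sign_pos h2, sign_pos hb]
  · rw [sign_eq_zero_iff]
    rcases lt_or_gt_of_ne (hβ0 j hj) with hb | hb
    · have ha : α j < 0 := by
        have := h j
        rwa [sign_neg hb, sign_eq_neg_one_iff] at this
      rw [abs_of_neg hb, abs_of_neg ha] at hθj
      linarith
    · have ha : 0 < α j := by
        have := h j
        rwa [sign_pos hb, sign_eq_one_iff] at this
      rw [abs_of_pos hb, abs_of_pos ha] at hθj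
      linarith

theorem mem_closedCell_iff_sign {V : Type*} [NormedAddCommGroup V] [NormedSpace ℝ V]
    {H : Set (V →ᵃ[ℝ] ℝ)} {p q : V} : q ∈ closedCell H p ↔
      ∀ h ∈ H, SignType.sign (h q) = 0 ∨ SignType.sign (h q) = SignType.sign (h p) := by
  refine forall₂_congr fun h _ => ?_
  rcases lt_trichotomy (h p) 0 with hp | hp | hp
  · rw [sign_neg hp, sign_eq_zero_iff, sign_eq_neg_one_iff, ← le_iff_eq_or_lt]
    exact ⟨fun h1 => h1.2 hp.le, fun h1 => ⟨fun h2 => absurd h2 hp.not_ge, fun _ => h1⟩⟩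
  · rw [hp, sign_zero, or_self_iff, sign_eq_zero_iff]
    exact ⟨fun h1 => le_antisymm (h1.2 le_rfl) (h1.1 le_rfl), fun h1 => by simp [h1]⟩
  · rw [sign_pos hp, sign_eq_zero_iff, sign_eq_one_iff]
    exact ⟨fun h1 => (h1.1 hp.le).eq_or_lt.imp Eq.symm id,
      fun h1 => ⟨fun _ => h1.elim Eq.ge le_of_lt, fun h2 => absurd h2 hp.not_ge⟩⟩

variable {V W K : Type} [NormedAddCommGroup V] [NormedSpace ℝ V]
  [NormedAddCommGroup W] [NormedSpace ℝ W]
  [NormedAddCommGroup K] [NormedSpace ℝ K]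

/-- A triangulation of `N`, with vertices `v a`, colours `c a` and barycentric coordinates `lam a`,
compatible with the map `f`. Vertices of a simplex have distinct colours, `f` is affine on each
simplex, and if two simplices with the same image share a vertex then they share all vertices of
smaller colours. -/
structure ColoredTriangulation (f : V → W) (N : Set V) where
  ι : Type
  fintype : Fintype ι
  v : ι → V
  c : ι → ℕ
  lam : ι → V → ℝ
  nonneg : ∀ p ∈ N, ∀ a, 0 ≤ lam a p
  sum_one : ∀ p ∈ N, ∑ a, lam a p = 1
  sum_smul : ∀ p ∈ N, ∑ a, lam a p • v a = p
  color_inj : ∀ p ∈ N, ∀ a b, 0 < lam a p → 0 < lam b p → c a = c b → a = b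
  face : ∀ p ∈ N, ∀ μ : ι → ℝ, (∀ a, 0 ≤ μ a) → ∑ a, μ a = 1 → (∀ a, 0 < μ a → 0 < lam a p) →
    ∑ a, μ a • v a ∈ N ∧ (∀ a, lam a (∑ a, μ a • v a) = μ a) ∧
      f (∑ a, μ a • v a) = ∑ a, μ a • f (v a)
  matching : ∀ p ∈ N, ∀ q ∈ N, f p = f q → ∀ a, 0 < lam a p →
    ∃ b, c b = c a ∧ f (v b) = f (v a) ∧ lam b q = lam a p
  common : ∀ p ∈ N, ∀ q ∈ N, f p = f q → ∀ a b, 0 < lam a p → 0 < lam a q → 0 < lam b p →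
    c b < c a → 0 < lam b q

attribute [instance] ColoredTriangulation.fintype

/-- `N₀` is a union of simplices on each of which `g` is affine. -/
def ColoredTriangulation.AffineOnSimplices {f : V → W} {N : Set V} (S : ColoredTriangulation f N)
    (N₀ : Set V) (g : V → K) : Prop :=
  ∀ p ∈ N₀, ∀ μ : S.ι → ℝ, (∀ a, 0 ≤ μ a) → ∑ a, μ a = 1 → (∀ a, 0 < μ a → 0 < S.lam a p) →
    ∑ a, μ a • S.v a ∈ N₀ ∧ g (∑ a, μ a • S.v a) = ∑ a, μ a • g (S.v a)

section cells
variable {H : Set (V →ᵃ[ℝ] ℝ)} {f : V → W} {N : Set V}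

/-- If two points of a cell had the same image, affinity would put the whole segment between them
into one fibre, which would then contain a 1-simplex. -/
theorem injOn_closedCell (hN : Adapted H N) (hf : CellwiseAffine H f N)
    (hnd : NonDegenerateOn f N) {p : V} (hp : p ∈ N) : InjOn f (closedCell H p) := by
  classical
  intro x hx y hy hxy
  by_contra hne
  obtain ⟨A, hA⟩ := hf p hp
  have hsub : convexHull ℝ (({x, y} : Finset V) : Set V) ⊆ closedCell H p := by
    refine convexHull_min ?_ (convex_closedCell H p)
    simp [insert_subset_iff, hx, hy]
  have := hnd (f x) {x, y} ?_ ?_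
  · rw [Finset.card_pair hne] at this
    omega
  · have h2 := affineIndependent_of_ne ℝ hne
    have h3 := h2.range
    have : range ![x, y] = (({x, y} : Finset V) : Set V) := by
      simp [Set.pair_comm]
    rw [this] at h3
    exact h3
  · intro z hz
    refine ⟨hN p hp (hsub hz), ?_⟩
    have hz' := hz
    rw [Finset.coe_pair, convexHull_pair] at hz'
    obtain ⟨t, -, rfl⟩ := (segment_eq_image_lineMap ℝ x y) ▸ hz'
    rw [mem_preimage, mem_singleton_iff, hA (hsub hz), AffineMap.apply_lineMap, ← hA hx, ← hA hy, hxy,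
      AffineMap.lineMap_same_apply]

theorem exists_affine_leftInverse (hH : H.Finite) (hf : CellwiseAffine H f N)
    {p : V} (hp : p ∈ N) (hinj : InjOn f (closedCell H p)) :
    ∃ B : W →ᵃ[ℝ] V, ∀ q ∈ closedCell H p, B (f q) = q := by
  obtain ⟨A, hA⟩ := hf p hp
  -- This is the direction space of the cell. The cell contains `p + t u` for each `u` in it and all
  -- small `t > 0`, so injectivity on the cell makes the linear part of `f` injective on this space.
  let D : Submodule ℝ V := ⨅ h ∈ {h ∈ H | h p = 0}, LinearMap.ker h.linear
  have hD : ∀ u, u ∈ D ↔ ∀ h ∈ H, h p = 0 → h.linear u = 0 := by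
    intro u
    simp only [D, Submodule.mem_iInf, LinearMap.mem_ker, mem_ofPred_eq, and_imp]
  have hker : LinearMap.ker (A.linear.domRestrict D) = ⊥ := by
    rw [LinearMap.ker_eq_bot']
    rintro ⟨u, hu⟩ hAu
    have hAu : A.linear u = 0 := hAu
    have hev : ∀ᶠ t : ℝ in 𝓝[>] 0, ∀ h ∈ H, (0 ≤ h p → 0 ≤ h (p + t • u)) ∧
        (h p ≤ 0 → h (p + t • u) ≤ 0) := by
      rw [Filter.eventually_all_finite hH]
      intro h hh
      have hform : ∀ t : ℝ, h (p + t • u) = h p + t * h.linear u := by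
        intro t
        have := h.map_vadd p (t • u)
        simp only [vadd_eq_add, map_smul, smul_eq_mul] at this
        rw [add_comm p, this, add_comm]
      have hcont : Continuous fun t : ℝ => h (p + t • u) := by
        simp only [hform]; fun_prop
      have ht := hcont.tendsto 0
      simp only [zero_smul, add_zero] at ht
      rcases lt_trichotomy (h p) 0 with h0 | h0 | h0
      · exact nhdsWithin_le_nhds ((ht.eventually (gt_mem_nhds h0)).mono fun t ht' =>
          ⟨fun h1 => absurd h1 h0.not_ge, fun _ => ht'.le⟩)
      · refine Filter.Eventually.of_forall fun t => ?_
        rw [hform, h0, (hD u).1 hu h hh h0]; simp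
      · exact nhdsWithin_le_nhds ((ht.eventually (lt_mem_nhds h0)).mono fun t ht' =>
          ⟨fun _ => ht'.le, fun h1 => absurd h1 h0.not_ge⟩)
    obtain ⟨t, ht, ht0⟩ := (hev.and self_mem_nhdsWithin).exists
    have ht0 : (0 : ℝ) < t := ht0
    have hmem : p + t • u ∈ closedCell H p := ht
    have := hinj hmem (mem_closedCell_self H p) (by
      rw [hA hmem, hA (mem_closedCell_self H p)]
      have := A.map_vadd p (t • u)
      simp only [vadd_eq_add, map_smul, hAu, smul_zero, zero_add] at this
      rw [add_comm, this])
    have h3 : t • u = 0 := by simpa using this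
    exact Subtype.ext ((smul_eq_zero.1 h3).resolve_left ht0.ne')
  obtain ⟨G, hG⟩ := LinearMap.exists_leftInverse_of_injective _ hker
  refine ⟨(D.subtype ∘ₗ G).toAffineMap.comp (AffineMap.id ℝ W - AffineMap.const ℝ W (A p)) +
    AffineMap.const ℝ W p, fun q hq => ?_⟩
  have hqD : q - p ∈ D := by
    rw [hD]
    intro h hh h0
    have h1 : h q = 0 := le_antisymm ((hq h hh).2 h0.le) ((hq h hh).1 h0.ge)
    have := h.linearMap_vsub q p
    simp only [vsub_eq_sub] at this
    rw [this, h1, h0, sub_zero]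
  have h2 := LinearMap.congr_fun hG ⟨q - p, hqD⟩
  have h3 : A.linear (q - p) = A q - A p := by
    have := A.linearMap_vsub q p
    simpa only [vsub_eq_sub] using this
  simp only [LinearMap.comp_apply, LinearMap.domRestrict_apply, h3, LinearMap.id_apply] at h2
  simp [hA hq, h2]

variable [FiniteDimensional ℝ W]

/-- An arrangement in the target such that the image of each cell is a union of cells. -/
theorem exists_image_arrangement (hH : H.Finite) (hN : Adapted H N) (hf : CellwiseAffine H f N)
    (hnd : NonDegenerateOn f N) : ∃ L : Set (W →ᵃ[ℝ] ℝ), L.Finite ∧ ∀ p ∈ N, ∀ y : W,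
      (∀ l ∈ L, SignType.sign (l y) = SignType.sign (l (f p))) →
      ∃ q, (∀ h ∈ H, SignType.sign (h q) = SignType.sign (h p)) ∧ f q = y := by
  have hex : ∀ s ∈ closedCell H '' N, ∃ A : V →ᵃ[ℝ] W, ∃ B : W →ᵃ[ℝ] V, EqOn f A s ∧
      ∀ q ∈ s, B (f q) = q := by
    rintro _ ⟨p, hp, rfl⟩
    obtain ⟨A, hA⟩ := hf p hp
    obtain ⟨B, hB⟩ := exists_affine_leftInverse hH hf hp (injOn_closedCell hN hf hnd hp)
    exact ⟨A, B, hA, hB⟩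
  choose! A B hA hB using hex
  have hfin : (closedCell H '' N).Finite := (finite_range_closedCell hH).subset (image_subset_range _ _)
  let bW := Module.finBasis ℝ W
  -- The functions `h ∘ B` transport the signs of the source to the target. The coordinates of `A ∘
  -- B - id` vanish at `f p`, hence at `y`, which forces `A (B y) = y`.
  refine ⟨⋃ s ∈ closedCell H '' N, ((fun h => h.comp (B s)) '' H ∪
    range fun i => (bW.coord i).toAffineMap.comp ((A s).comp (B s) - AffineMap.id ℝ W)),
    hfin.biUnion fun s _ => (hH.image _).union (finite_range _), fun p hp y hy => ?_⟩
  have hs : closedCell H p ∈ closedCell H '' N := mem_image_of_mem _ hp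
  have hpp := mem_closedCell_self H p
  refine ⟨B (closedCell H p) y, fun h hh => ?_, ?_⟩
  · have := hy (h.comp (B (closedCell H p))) (mem_biUnion hs (Or.inl ⟨h, hh, rfl⟩))
    rw [AffineMap.comp_apply, AffineMap.comp_apply, hB _ hs p hpp] at this
    exact this
  · have hq : B (closedCell H p) y ∈ closedCell H p := by
      rw [mem_closedCell_iff_sign]
      intro h hh
      have := hy (h.comp (B (closedCell H p))) (mem_biUnion hs (Or.inl ⟨h, hh, rfl⟩))
      rw [AffineMap.comp_apply, AffineMap.comp_apply, hB _ hs p hpp] at this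
      exact Or.inr this
    rw [hA _ hs hq, ← sub_eq_zero]
    refine bW.ext_elem fun i => ?_
    have := hy _ (mem_biUnion hs (Or.inr ⟨i, rfl⟩))
    simp only [AffineMap.comp_apply, Pi.sub_apply, AffineMap.id_apply, hB _ hs p hpp, AffineMap.coe_sub,
      ← hA _ hs hpp, sub_self, LinearMap.coe_toAffineMap, map_zero, sign_zero, sign_eq_zero_iff] at this
    simpa using this

end cells

end Triangulation

/-! ### Existence of the coloured triangulation. -/

section TriangulationExists

theorem sign_combo {u v a b : ℝ} (ha : 0 ≤ a) (hb : 0 ≤ b) {σ : SignType}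
    (hu : SignType.sign u = 0 ∨ SignType.sign u = σ) (hv : SignType.sign v = 0 ∨ SignType.sign v = σ) :
    SignType.sign (a * u + b * v) = 0 ∨ SignType.sign (a * u + b * v) = σ := by
  rcases σ with _ | _ | _
  · rw [show SignType.zero = 0 from rfl, or_self_iff, sign_eq_zero_iff] at hu hv
    simp [hu, hv]
  · rw [show SignType.neg = -1 from rfl, sign_eq_zero_iff, sign_eq_neg_one_iff, ← le_iff_eq_or_lt] at *
    exact add_nonpos (mul_nonpos_of_nonneg_of_nonpos ha hu) (mul_nonpos_of_nonneg_of_nonpos hb hv)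
  · rw [show SignType.pos = 1 from rfl, sign_eq_zero_iff, sign_eq_one_iff] at *
    have hu' : 0 ≤ u := hu.elim Eq.ge le_of_lt
    have hv' : 0 ≤ v := hv.elim Eq.ge le_of_lt
    exact (add_nonneg (mul_nonneg ha hu') (mul_nonneg hb hv')).eq_or_lt.imp Eq.symm id

theorem sum_fiberwise_smul {ι R W : Type*} [Fintype ι] [Fintype R] [DecidableEq R]
    [AddCommGroup W] [Module ℝ W] (π : ι → R) (μ : ι → ℝ) (y : R → W) :
    ∑ r, (∑ a with π a = r, μ a) • y r = ∑ a, μ a • y (π a) := by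
  rw [← Finset.sum_fiberwise Finset.univ π (fun a => μ a • y (π a))]
  refine Finset.sum_congr rfl fun r _ => ?_
  rw [Finset.sum_smul]
  refine Finset.sum_congr rfl fun a ha => ?_
  rw [(Finset.mem_filter.1 ha).2]

variable {V W : Type} [NormedAddCommGroup V] [NormedSpace ℝ V]
  [NormedAddCommGroup W] [NormedSpace ℝ W]

/-- The functions cutting out the strata of the source. -/
def stratFun (H : Set (V →ᵃ[ℝ] ℝ)) (L : Set (W →ᵃ[ℝ] ℝ)) (f : V → W) : H ⊕ L → V → ℝ :=
  Sum.elim (fun h p => h.1 p) fun l p => l.1 (f p)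

variable {H : Set (V →ᵃ[ℝ] ℝ)} {L : Set (W →ᵃ[ℝ] ℝ)} {f : V → W} {N : Set V}

theorem mem_closedCell_of_zLe {p q : V}
    (h : ZLe (signVec (stratFun H L f) q) (signVec (stratFun H L f) p)) : q ∈ closedCell H p :=
  mem_closedCell_iff_sign.2 fun k hk => h (Sum.inl ⟨k, hk⟩)

theorem exists_affine_stratFun (hf : CellwiseAffine H f N) {p : V} (hp : p ∈ N) (i : H ⊕ L) :
    ∃ A : V →ᵃ[ℝ] ℝ, EqOn (stratFun H L f i) A (closedCell H p) := by
  rcases i with h | l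
  · exact ⟨h.1, fun _ _ => rfl⟩
  · obtain ⟨A, hA⟩ := hf p hp
    exact ⟨l.1.comp A, fun x hx => by simp [stratFun, hA hx]⟩

theorem affineStrata_stratFun (hN : Adapted H N) (hf : CellwiseAffine H f N) :
    AffineStrata (stratFun H L f) N := by
  intro p hp
  refine ⟨?_, fun i => (exists_affine_stratFun hf hp i).imp fun A hA => hA.mono fun q hq =>
    mem_closedCell_of_zLe hq.2⟩
  intro x hx y hy a b ha hb hab
  have hz := convex_closedCell H p (mem_closedCell_of_zLe hx.2) (mem_closedCell_of_zLe hy.2) ha hb hab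
  refine ⟨hN p hp hz, fun i => ?_⟩
  obtain ⟨A, hA⟩ := exists_affine_stratFun (L := L) hf hp i
  have h1 : stratFun H L f i (a • x + b • y) = a * stratFun H L f i x + b * stratFun H L f i y := by
    rw [hA hz, hA (mem_closedCell_of_zLe hx.2), hA (mem_closedCell_of_zLe hy.2),
      Convex.combo_affine_apply hab, smul_eq_mul, smul_eq_mul]
  change SignType.sign _ = 0 ∨ SignType.sign _ = _
  rw [h1]
  exact sign_combo ha hb (hx.2 i) (hy.2 i)

theorem affineStrata_affine {I : Type*} (l : I → W →ᵃ[ℝ] ℝ) :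
    AffineStrata (fun i y => l i y) (univ : Set W) := by
  intro p _
  refine ⟨?_, fun i => ⟨l i, fun _ _ => rfl⟩⟩
  intro x hx y hy a b ha hb hab
  refine ⟨mem_univ _, fun i => ?_⟩
  change SignType.sign (l i _) = 0 ∨ SignType.sign (l i _) = _
  rw [Convex.combo_affine_apply hab, smul_eq_mul, smul_eq_mul]
  exact sign_combo ha hb (hx.2 i) (hy.2 i)

/-- If some function is smaller in absolute value at `p` than at `q`, the ray from `q` through `p`
leaves the stratum at a finite time. Otherwise it would stay in the closed cell of `p`, and so in
`N`, forever, against boundedness. -/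
theorem rayExit_stratFun [Fintype H] [Fintype L] (hb : Bornology.IsBounded N) (hN : Adapted H N)
    (hf : CellwiseAffine H f N) : RayExit (stratFun H L f) N := by
  intro p hp q hq hsign hne
  have hqp : q ∈ closedCell H p := mem_closedCell_of_zLe (by rw [hsign]; exact ZLe.refl _)
  have hform : ∀ (i : H ⊕ L) (A : V →ᵃ[ℝ] ℝ), EqOn (stratFun H L f i) A (closedCell H p) → ∀ θ : ℝ,
      A (q + θ • (p - q)) = stratFun H L f i q + θ * (stratFun H L f i p - stratFun H L f i q) := by
    intro i A hA θ
    have : q + θ • (p - q) = AffineMap.lineMap q p θ := by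
      rw [AffineMap.lineMap_apply, vsub_eq_sub, vadd_eq_add, add_comm]
    rw [this, AffineMap.apply_lineMap, hA hqp, hA (mem_closedCell_self H p), AffineMap.lineMap_apply,
      vsub_eq_sub, vadd_eq_add, smul_eq_mul, add_comm]
  by_cases hlt : ∃ i, |stratFun H L f i p| < |stratFun H L f i q|
  · obtain ⟨θ, hθ, h1, i0, h2, h3⟩ := exists_exit_time (fun i => stratFun H L f i q)
      (fun i => stratFun H L f i p) (fun i => congrFun hsign i) hlt
    have hmem : q + θ • (p - q) ∈ closedCell H p := by
      rw [mem_closedCell_iff_sign]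
      intro h hh
      have e := hform (Sum.inl ⟨h, hh⟩) h (fun _ _ => rfl) θ
      rw [e]
      exact h1 (Sum.inl ⟨h, hh⟩)
    have hval : ∀ i, stratFun H L f i (q + θ • (p - q)) =
        stratFun H L f i q + θ * (stratFun H L f i p - stratFun H L f i q) := by
      intro i
      obtain ⟨A, hA⟩ := exists_affine_stratFun (L := L) hf hp i
      rw [hA hmem, hform i A hA]
    refine ⟨θ, hθ, hN p hp hmem, fun i => ?_, fun heq => ?_⟩
    · change SignType.sign _ = 0 ∨ SignType.sign _ = _
      rw [hval]
      exact h1 i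
    · have := congrFun heq i0
      change SignType.sign _ = SignType.sign _ at this
      rw [hval, h2] at this
      exact h3 this.symm
  · exfalso
    push Not at hlt
    have hray : ∀ θ : ℝ, 1 ≤ θ → q + θ • (p - q) ∈ N := by
      intro θ hθ
      refine hN p hp (mem_closedCell_iff_sign.2 fun h hh => ?_)
      rw [hform (Sum.inl ⟨h, hh⟩) h (fun _ _ => rfl) θ]
      have h1 : |h q| ≤ |h p| := hlt (Sum.inl ⟨h, hh⟩)
      have h2 : SignType.sign (h q) = SignType.sign (h p) := congrFun hsign (Sum.inl ⟨h, hh⟩)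
      change SignType.sign (h q + θ * (h p - h q)) = 0 ∨
        SignType.sign (h q + θ * (h p - h q)) = SignType.sign (h p)
      right
      rcases lt_trichotomy (h p) 0 with h0 | h0 | h0
      · rw [sign_neg h0] at h2 ⊢
        rw [sign_eq_neg_one_iff] at h2 ⊢
        rw [abs_of_neg h0, abs_of_neg h2] at h1
        nlinarith
      · rw [h0, sign_zero, sign_eq_zero_iff] at h2 ⊢
        simp [h2]
      · rw [sign_pos h0] at h2 ⊢
        rw [sign_eq_one_iff] at h2 ⊢
        rw [abs_of_pos h0, abs_of_pos h2] at h1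
        nlinarith
    obtain ⟨R, hR⟩ := hb.exists_norm_le
    have hpq : 0 < ‖p - q‖ := norm_pos_iff.2 (sub_ne_zero.2 hne)
    have hR0 : 0 ≤ R := (norm_nonneg _).trans (hR p hp)
    -- Then `θ ‖p - q‖ > 2 R`, more than the distance between two points of norm at most `R`.
    set θ := 1 + (R + R + 1) / ‖p - q‖ with hθ
    have h1 := hR _ (hray θ (by rw [hθ]; have : 0 ≤ (R + R + 1) / ‖p - q‖ := by positivity
                                linarith))
    have h2 : ‖θ • (p - q)‖ ≤ R + R := by
      calc ‖θ • (p - q)‖ = ‖(q + θ • (p - q)) - q‖ := by rw [add_sub_cancel_left]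
        _ ≤ _ := norm_sub_le _ _
        _ ≤ R + R := add_le_add h1 (hR q hq)
    rw [norm_smul, Real.norm_eq_abs] at h2
    have h3 : θ * ‖p - q‖ ≤ R + R := (mul_le_mul_of_nonneg_right (le_abs_self θ) hpq.le).trans h2
    rw [hθ, add_mul, div_mul_cancel₀ _ hpq.ne'] at h3
    linarith

variable [FiniteDimensional ℝ W]

/-- One point is chosen in each target stratum meeting the image, and above it one vertex in each
source stratum over it; simplices are flags of strata. Thus `f` carries flags to flags, and the
colour of a vertex is the number of nonzero signs of its target stratum. The combinatorial
properties combine uniqueness of flags in source and target with the injectivity of `f` on closed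
cells. -/
theorem exists_coloredTriangulation (hb : Bornology.IsBounded N) (hH : H.Finite)
    (hN : Adapted H N) (hf : CellwiseAffine H f N) (hnd : NonDegenerateOn f N) :
    ∃ S : ColoredTriangulation f N, ∀ (K : Type) [NormedAddCommGroup K] [NormedSpace ℝ K]
      (N₀ : Set V) (g : V → K), N₀ ⊆ N → Adapted H N₀ → CellwiseAffine H g N₀ →
        S.AffineOnSimplices N₀ g := by
  classical
  obtain ⟨L, hL, himg⟩ := exists_image_arrangement hH hN hf hnd
  have : Fintype H := hH.fintype
  have : Fintype L := hL.fintype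
  set φ := stratFun H L f with hφ
  let ψ : L → W → ℝ := fun l y => l.1 y
  have hψφ : ∀ p, signVec ψ (f p) = fun l => signVec φ p (Sum.inr l) := fun p => rfl
  let ι := {s : H ⊕ L → SignType // ∃ p ∈ N, signVec φ p = s}
  let R := {r : L → SignType // ∃ p ∈ N, signVec ψ (f p) = r}
  have : Fintype ι := Fintype.ofFinite ι
  have : Fintype R := Fintype.ofFinite R
  choose y0 hy0N hy0 using fun r : R => r.2
  let y : R → W := fun r => f (y0 r)
  have hy : ∀ r, signVec ψ (y r) = r.1 := hy0
  let π : ι → R := fun a => ⟨fun l => a.1 (Sum.inr l), by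
    obtain ⟨p, hp, h⟩ := a.2
    exact ⟨p, hp, by rw [hψφ, h]⟩⟩
  have hb' : ∀ a : ι, ∃ q ∈ N, signVec φ q = a.1 ∧ f q = y (π a) := by
    intro a
    obtain ⟨p, hp, h⟩ := a.2
    have hsg : ∀ l : L, SignType.sign (l.1 (y (π a))) = SignType.sign (l.1 (f p)) := by
      intro l
      have h1 := congrFun (hy (π a)) l
      have h2 := congrFun h (Sum.inr l)
      exact h1.trans h2.symm
    obtain ⟨q, hq1, hq2⟩ := himg p hp (y (π a)) fun l hl => hsg ⟨l, hl⟩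
    have hqc : q ∈ closedCell H p := mem_closedCell_iff_sign.2 fun h hh => Or.inr (hq1 h hh)
    refine ⟨q, hN p hp hqc, ?_, hq2⟩
    rw [← h]
    funext i
    rcases i with h' | l
    · exact hq1 h'.1 h'.2
    · change SignType.sign (l.1 (f q)) = SignType.sign (l.1 (f p))
      rw [hq2]
      exact hsg l
  choose b hbN hbs hbf using hb'
  let s : ι → H ⊕ L → SignType := fun a => a.1
  have hA : AffineStrata φ N := affineStrata_stratFun hN hf
  have hAψ : AffineStrata ψ (univ : Set W) := affineStrata_affine fun l : L => l.1
  have hflag : ∀ p, ∃ μ : ι → ℝ, p ∈ N → (∀ a, 0 ≤ μ a) ∧ ∑ a, μ a = 1 ∧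
      ChainSupp s μ ∧ ∑ a, μ a • b a = p ∧ ∀ a, 0 < μ a → ZLe (s a) (signVec φ p) := by
    intro p
    by_cases hp : p ∈ N
    · obtain ⟨μ, h⟩ := exists_flag (s := s) (rayExit_stratFun hb hN hf) hbN hbs
        (fun p hp => ⟨⟨_, p, hp, rfl⟩, rfl⟩) _ p hp le_rfl
      exact ⟨μ, fun _ => h⟩
    · exact ⟨0, fun h => absurd h hp⟩
  choose lam hlam using hflag
  have hcell : ∀ p ∈ N, ∀ a, 0 < lam p a → b a ∈ closedCell H p := fun p hp a ha =>
    mem_closedCell_of_zLe (by rw [← hφ, hbs]; exact (hlam p hp).2.2.2.2 a ha)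
  -- Non-degeneracy enters here: two faces of one stratum lying over the same target stratum have
  -- vertices with the same image in one closed cell, so they coincide.
  have hsame : ∀ t a a' : ι, ZLe a.1 t.1 → ZLe a'.1 t.1 → π a = π a' → a = a' := by
    intro t a a' h1 h2 h3
    have hba : b a ∈ closedCell H (b t) := mem_closedCell_of_zLe (by rw [← hφ, hbs, hbs]; exact h1)
    have hba' : b a' ∈ closedCell H (b t) := mem_closedCell_of_zLe (by rw [← hφ, hbs, hbs]; exact h2)
    have := injOn_closedCell hN hf hnd (hbN t) hba hba' (by rw [hbf, hbf, h3])
    exact Subtype.ext (by rw [← hbs a, ← hbs a', this])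
  have hπ : ∀ a a' : ι, ZLe a.1 a'.1 → ZLe (π a).1 (π a').1 := fun a a' h l => h (Sum.inr l)
  have hcol : ∀ a a' : ι, ZLe a.1 a'.1 → nzCard (π a').1 ≤ nzCard (π a).1 → a = a' := fun a a' h h' =>
    hsame a' a a' h (ZLe.refl _) (Subtype.ext ((hπ a a' h).eq_of_nzCard_le h'))
  have hmatch : ∀ p ∈ N, ∀ q ∈ N, f p = f q → ∀ a, 0 < lam p a → ∃ b, π b = π a ∧ lam q b = lam p a := by
    intro p hp q hq hfpq a ha
    -- The weights of `p`, pushed to the target strata, are flag coordinates of `f p`. Distinct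
    -- vertices of one flag go to distinct target strata, so no two positive weights are added up.
    -- Uniqueness of flags in the target then matches the weights of `p` and `q`.
    have hpush : ∀ p ∈ N, (∀ r, 0 ≤ ∑ a with π a = r, lam p a) ∧
        ChainSupp (fun r : R => r.1) (fun r => ∑ a with π a = r, lam p a) ∧
        ∑ r, (∑ a with π a = r, lam p a) = 1 ∧ ∑ r, (∑ a with π a = r, lam p a) • y r = f p ∧
        ∀ a, 0 < lam p a → ∑ a' with π a' = π a, lam p a' = lam p a := by
      intro p hp
      obtain ⟨l0, l1, lc, lv, lz⟩ := hlam p hp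
      have hex : ∀ r, 0 < ∑ a with π a = r, lam p a → ∃ a, 0 < lam p a ∧ π a = r := by
        intro r hr
        by_contra! hcon
        refine hr.not_ge (Finset.sum_nonpos fun a ha => ?_)
        by_contra hneg
        exact hcon a (not_le.1 hneg) (Finset.mem_filter.1 ha).2
      refine ⟨fun r => Finset.sum_nonneg fun a _ => l0 a, ?_, ?_, ?_, ?_⟩
      · intro r r' hr hr'
        obtain ⟨a, ha, rfl⟩ := hex r hr
        obtain ⟨a', ha', rfl⟩ := hex r' hr'
        exact (lc a a' ha ha').imp (hπ _ _) (hπ _ _)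
      · rw [Finset.sum_fiberwise, l1]
      · rw [sum_fiberwise_smul]
        obtain ⟨A, hA⟩ := hf p hp
        have := ((convex_closedCell H p).sum_mem_and_map_eq hA l0 l1 (hcell p hp)).2
        rw [lv] at this
        rw [this]
        exact Finset.sum_congr rfl fun a _ => by rw [hbf]
      · intro a ha
        refine Finset.sum_eq_single_of_mem a (by simp) fun a' ha' hne => ?_
        by_contra h0
        have hpos : 0 < lam p a' := lt_of_le_of_ne (l0 a') (Ne.symm h0)
        have hπa := (Finset.mem_filter.1 ha').2
        rcases lc a a' ha hpos with h | h
        · exact hne (hsame a' a a' h (ZLe.refl _) hπa.symm).symm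
        · exact hne (hsame a a' a h (ZLe.refl _) hπa)
    obtain ⟨p0, pc, p1, pv, ps⟩ := hpush p hp
    obtain ⟨q0, qc, q1, qv, qs⟩ := hpush q hq
    have huniq := flag_unique (b := y) hAψ (fun _ => mem_univ _) hy Subtype.val_injective p0 q0 pc qc
      (by rw [p1, q1]) (by rw [pv, qv, hfpq])
    have h1 := congrFun huniq (π a)
    rw [ps a ha] at h1
    obtain ⟨a', ha', hπ'⟩ : ∃ a', 0 < lam q a' ∧ π a' = π a := by
      by_contra! hcon
      have : ∑ a' with π a' = π a, lam q a' ≤ 0 := Finset.sum_nonpos fun a' ha' => by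
        by_contra hneg
        exact hcon a' (not_le.1 hneg) (Finset.mem_filter.1 ha').2
      linarith
    refine ⟨a', hπ', ?_⟩
    rw [← qs a' ha', hπ', h1]
  have hface : ∀ p ∈ N, ∀ μ : ι → ℝ, (∀ a, 0 < μ a → 0 < lam p a) → ∀ a, 0 < μ a → b a ∈ closedCell H p :=
    fun p hp μ hμ a ha => hcell p hp a (hμ a ha)
  refine ⟨{
    ι := ι
    fintype := inferInstance
    v := b
    c := fun a => nzCard (π a).1
    lam := fun a p => lam p a
    nonneg := fun p hp => (hlam p hp).1
    sum_one := fun p hp => (hlam p hp).2.1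
    sum_smul := fun p hp => (hlam p hp).2.2.2.1
    color_inj := fun p hp a a' ha ha' hc => ?_
    face := fun p hp μ h0 h1 hμ => ?_
    matching := fun p hp q hq hfpq a ha => ?_
    common := fun p hp q hq hfpq a c ha ha' hc hlt => ?_ }, ?_⟩
  · rcases (hlam p hp).2.2.1 a a' ha ha' with h | h
    · exact hcol a a' h hc.ge
    · exact (hcol a' a h hc.le).symm
  · obtain ⟨A, hAf⟩ := hf p hp
    obtain ⟨m1, m2⟩ := (convex_closedCell H p).sum_mem_and_map_eq hAf h0 h1 (hface p hp μ hμ)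
    refine ⟨hN p hp m1, fun a => ?_, m2⟩
    obtain ⟨l0, l1, lc, lv, -⟩ := hlam _ (hN p hp m1)
    exact congrFun (flag_unique hA hbN hbs Subtype.val_injective l0 h0 lc
      ((hlam p hp).2.2.1.mono hμ) (by rw [l1, h1]) lv) a
  · obtain ⟨a', h1, h2⟩ := hmatch p hp q hq hfpq a ha
    exact ⟨a', by rw [h1], by rw [hbf, hbf, h1], h2⟩
  · obtain ⟨c', h1, h2⟩ := hmatch p hp q hq hfpq c hc
    have hc' : 0 < lam q c' := by rw [h2]; exact hc
    -- In a flag the smaller colour belongs to the smaller stratum. So `c` and its partner `c'` in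
    -- the flag of `q` are both faces of the shared vertex `a`, over the same target stratum, and
    -- therefore equal.
    have hca : ZLe c.1 a.1 := by
      rcases (hlam p hp).2.2.1 c a hc ha with h | h
      · exact h
      · exact absurd (hπ _ _ h).nzCard_le hlt.not_ge
    have hca' : ZLe c'.1 a.1 := by
      rcases (hlam q hq).2.2.1 c' a hc' ha' with h | h
      · exact h
      · refine absurd (hπ _ _ h).nzCard_le ?_
        rw [h1]
        exact hlt.not_ge
    rw [hsame a c c' hca hca' h1.symm]
    exact hc'
  · intro K _ _ N₀ g hN₀ hHN₀ hg p hp μ h0 h1 hμ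
    obtain ⟨A, hAg⟩ := hg p hp
    obtain ⟨m1, m2⟩ := (convex_closedCell H p).sum_mem_and_map_eq hAg h0 h1 (hface p (hN₀ hp) μ hμ)
    exact ⟨hHN₀ p hp m1, m2⟩

end TriangulationExists

/-! ### Rescaling weights by colour, and pairs of points in a fibre. -/

section Rescale

namespace ColoredTriangulation

variable {V W : Type} [NormedAddCommGroup V] [NormedSpace ℝ V]
  [NormedAddCommGroup W] [NormedSpace ℝ W] {f : V → W} {N : Set V} (S : ColoredTriangulation f N)

/-- The total weight of the vertices of colour at least `m`. -/
noncomputable def tau (m : ℕ) (p : V) : ℝ := ∑ a with m ≤ S.c a, S.lam a p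

/-- The weight of the vertex of colour `m`. -/
noncomputable def lvl (m : ℕ) (p : V) : ℝ := ∑ a with S.c a = m, S.lam a p

/-- The point obtained by multiplying the weight of each vertex by a function of its colour. -/
noncomputable def rescale (κ : ℕ → ℝ) (p : V) : V := ∑ a, (κ (S.c a) * S.lam a p) • S.v a

variable {S}

theorem tau_nonneg {p : V} (hp : p ∈ N) (m : ℕ) : 0 ≤ S.tau m p :=
  Finset.sum_nonneg fun a _ => S.nonneg p hp a

theorem lvl_nonneg {p : V} (hp : p ∈ N) (m : ℕ) : 0 ≤ S.lvl m p :=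
  Finset.sum_nonneg fun a _ => S.nonneg p hp a

theorem tau_eq_ite (m : ℕ) (p : V) : S.tau m p = ∑ a, if m ≤ S.c a then S.lam a p else 0 := by
  rw [tau, Finset.sum_filter]

theorem lvl_eq_ite (m : ℕ) (p : V) : S.lvl m p = ∑ a, if S.c a = m then S.lam a p else 0 := by
  rw [lvl, Finset.sum_filter]

theorem tau_succ (m : ℕ) (p : V) : S.tau m p = S.lvl m p + S.tau (m + 1) p := by
  simp only [tau_eq_ite, lvl_eq_ite, ← Finset.sum_add_distrib]
  refine Finset.sum_congr rfl fun a _ => ?_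
  rcases lt_trichotomy (S.c a) m with h | h | h
  · simp [h.not_ge, h.ne, show ¬ m + 1 ≤ S.c a by omega]
  · simp [h]
  · simp [h.le, h.ne', show m + 1 ≤ S.c a by omega]

theorem tau_zero {p : V} (hp : p ∈ N) : S.tau 0 p = 1 := by simp [tau, S.sum_one p hp]

theorem tau_anti {p : V} (hp : p ∈ N) {i j : ℕ} (hij : i ≤ j) : S.tau j p ≤ S.tau i p :=
  Finset.sum_le_sum_of_subset_of_nonneg
    (fun a ha => by simp only [Finset.mem_filter, Finset.mem_univ, true_and] at ha ⊢; omega)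
    fun a _ _ => S.nonneg p hp a

theorem tau_le_one {p : V} (hp : p ∈ N) (m : ℕ) : S.tau m p ≤ 1 :=
  (tau_anti hp (Nat.zero_le m)).trans (tau_zero hp).le

theorem rescale_mem {p : V} (hp : p ∈ N) {κ : ℕ → ℝ} (hκ : ∀ a, 0 < S.lam a p → 0 ≤ κ (S.c a))
    (h1 : ∑ a, κ (S.c a) * S.lam a p = 1) : S.rescale κ p ∈ N ∧
      (∀ a, S.lam a (S.rescale κ p) = κ (S.c a) * S.lam a p) ∧
      f (S.rescale κ p) = ∑ a, (κ (S.c a) * S.lam a p) • f (S.v a) := by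
  refine S.face p hp (fun a => κ (S.c a) * S.lam a p) (fun a => ?_) h1 fun a ha => ?_
  · rcases (S.nonneg p hp a).eq_or_lt with h | h
    · simp [← h]
    · exact mul_nonneg (hκ a h) h.le
  · refine lt_of_le_of_ne (S.nonneg p hp a) fun h => ?_
    rw [← h, mul_zero] at ha
    exact lt_irrefl _ ha

theorem rescale_one {p : V} (hp : p ∈ N) {κ : ℕ → ℝ} (hκ : ∀ a, 0 < S.lam a p → κ (S.c a) = 1) :
    S.rescale κ p = p := by
  rw [rescale]
  conv_rhs => rw [← S.sum_smul p hp]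
  refine Finset.sum_congr rfl fun a _ => ?_
  rcases (S.nonneg p hp a).eq_or_lt with h | h
  · simp [← h]
  · rw [hκ a h, one_mul]

/-- Sums depending only on colours, weights and images of vertices agree for points with the same
image. -/
theorem sum_eq_of_image_eq {M : Type*} [AddCommMonoid M] {p q : V} (hp : p ∈ N) (hq : q ∈ N)
    (hpq : f p = f q) (F : ℕ → W → ℝ → M) (hF : ∀ j w, F j w 0 = 0) :
    ∑ a, F (S.c a) (f (S.v a)) (S.lam a p) = ∑ a, F (S.c a) (f (S.v a)) (S.lam a q) := by
  classical
  have hsupp : ∀ p ∈ N, ∑ a, F (S.c a) (f (S.v a)) (S.lam a p) =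
      ∑ a with 0 < S.lam a p, F (S.c a) (f (S.v a)) (S.lam a p) := by
    intro p hp
    refine (Finset.sum_filter_of_ne fun a _ h => ?_).symm
    refine lt_of_le_of_ne (S.nonneg p hp a) fun h0 => h ?_
    rw [← h0, hF]
  rw [hsupp p hp, hsupp q hq]
  -- Matching gives a bijection between the supports of `p` and `q` that preserves colours, images
  -- and weights; it is injective because colours are distinct within a simplex.
  have hm := S.matching p hp q hq hpq
  choose! σ h1 h2 h3 using hm
  refine Finset.sum_bij (fun a _ => σ a) (fun a ha => ?_) (fun a ha a' ha' h => ?_) (fun b hb => ?_)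
    fun a ha => ?_
  all_goals simp only [Finset.mem_filter, Finset.mem_univ, true_and] at *
  · rw [h3 a ha]; exact ha
  · exact S.color_inj p hp a a' ha ha' (by rw [← h1 a ha, ← h1 a' ha', h])
  · obtain ⟨a, e1, e2, e3⟩ := S.matching q hq p hp hpq.symm b hb
    have ha : 0 < S.lam a p := by rw [e3]; exact hb
    refine ⟨a, ha, S.color_inj q hq _ _ (by rw [h3 a ha]; exact ha) hb (by rw [h1 a ha, e1])⟩
  · rw [h1 a ha, h2 a ha, h3 a ha]

theorem tau_eq_of_image_eq {p q : V} (hp : p ∈ N) (hq : q ∈ N) (hpq : f p = f q) (m : ℕ) :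
    S.tau m p = S.tau m q := by
  rw [tau_eq_ite, tau_eq_ite]
  exact sum_eq_of_image_eq hp hq hpq (fun j _ x => if m ≤ j then x else 0) (by simp)

theorem lvl_eq_of_image_eq {p q : V} (hp : p ∈ N) (hq : q ∈ N) (hpq : f p = f q) (m : ℕ) :
    S.lvl m p = S.lvl m q := by
  rw [lvl_eq_ite, lvl_eq_ite]
  exact sum_eq_of_image_eq hp hq hpq (fun j _ x => if j = m then x else 0) (by simp)

theorem lvl_eq_lam {p : V} (hp : p ∈ N) {a : S.ι} (ha : 0 < S.lam a p) :
    S.lvl (S.c a) p = S.lam a p := by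
  refine Finset.sum_eq_single_of_mem a (by simp) fun b hb hne => ?_
  by_contra h
  exact hne (S.color_inj p hp b a (lt_of_le_of_ne (S.nonneg p hp b) (Ne.symm h)) ha
    (Finset.mem_filter.1 hb).2)

theorem sum_mul_eq_of_image_eq {p q : V} (hp : p ∈ N) (hq : q ∈ N) (hpq : f p = f q) (κ : ℕ → ℝ) :
    ∑ a, κ (S.c a) * S.lam a p = ∑ a, κ (S.c a) * S.lam a q :=
  sum_eq_of_image_eq hp hq hpq (fun j _ x => κ j * x) (by simp)

theorem rescale_image_eq {p q : V} (hp : p ∈ N) (hq : q ∈ N) (hpq : f p = f q) {κ : ℕ → ℝ}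
    (hκ : ∀ a, 0 < S.lam a p → 0 ≤ κ (S.c a)) (h1 : ∑ a, κ (S.c a) * S.lam a p = 1) :
    S.rescale κ q ∈ N ∧ (∀ a, S.lam a (S.rescale κ q) = κ (S.c a) * S.lam a q) ∧
      f (S.rescale κ p) = f (S.rescale κ q) := by
  have hκ' : ∀ a, 0 < S.lam a q → 0 ≤ κ (S.c a) := by
    intro a ha
    obtain ⟨b, e1, -, e3⟩ := S.matching q hq p hp hpq.symm a ha
    rw [← e1]
    exact hκ b (by rw [e3]; exact ha)
  obtain ⟨q1, q2, q3⟩ := rescale_mem hq hκ' (by rw [← sum_mul_eq_of_image_eq hp hq hpq, h1])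
  refine ⟨q1, q2, ?_⟩
  rw [(rescale_mem hp hκ h1).2.2, q3]
  exact sum_eq_of_image_eq hp hq hpq (fun j w x => (κ j * x) • w) (by simp)

/-- The two points share their vertices of colour less than `i` and no others. -/
structure FirstDiff (S : ColoredTriangulation f N) (i : ℕ) (p q : V) : Prop where
  left_mem : p ∈ N
  right_mem : q ∈ N
  image_eq : f p = f q
  below : ∀ a, S.c a < i → S.lam a p = S.lam a q
  above : ∀ a, i ≤ S.c a → 0 < S.lam a p → S.lam a q = 0
  tau_pos : 0 < S.tau i p

/-- Take the vertex of least colour that belongs to `p` and not to `q`. By `common`, a shared vertex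
of larger colour would force this vertex to be shared too. -/
theorem exists_firstDiff (S : ColoredTriangulation f N) {p q : V} (hp : p ∈ N) (hq : q ∈ N)
    (hpq : f p = f q) (hne : p ≠ q) : ∃ i, S.FirstDiff i p q ∧ ∃ a, S.c a = i := by
  classical
  have hval : ∀ p ∈ N, ∀ q ∈ N, f p = f q → ∀ a, 0 < S.lam a p → 0 < S.lam a q →
      S.lam a p = S.lam a q := fun p hp q hq hpq a h1 h2 => by
    rw [← lvl_eq_lam hp h1, ← lvl_eq_lam hq h2, lvl_eq_of_image_eq hp hq hpq]
  -- Otherwise every weight of `p` is at most that of `q`; both families sum to `1`, so they agree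
  -- and `p = q`.
  have hex : ∃ a, 0 < S.lam a p ∧ S.lam a q = 0 := by
    by_contra! hcon
    have hle : ∀ a ∈ Finset.univ, S.lam a p ≤ S.lam a q := by
      intro a _
      rcases (S.nonneg p hp a).eq_or_lt with h | h
      · rw [← h]; exact S.nonneg q hq a
      · exact (hval p hp q hq hpq a h (lt_of_le_of_ne (S.nonneg q hq a) (hcon a h).symm)).le
    have heq := (Finset.sum_eq_sum_iff_of_le hle).1 (by rw [S.sum_one p hp, S.sum_one q hq])
    refine hne ?_
    rw [← S.sum_smul p hp, ← S.sum_smul q hq]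
    exact Finset.sum_congr rfl fun a ha => by rw [heq a ha]
  obtain ⟨a0, ha0, hmin⟩ := Finset.exists_min_image
    (Finset.univ.filter fun a => 0 < S.lam a p ∧ S.lam a q = 0) S.c
    (by obtain ⟨a, ha⟩ := hex; exact ⟨a, by simpa using ha⟩)
  simp only [Finset.mem_filter, Finset.mem_univ, true_and] at ha0 hmin
  have hbelow : ∀ a, S.c a < S.c a0 → 0 < S.lam a p → 0 < S.lam a q := by
    intro a hlt ha
    refine lt_of_le_of_ne (S.nonneg q hq a) fun h => ?_
    exact absurd (hmin a ⟨ha, h.symm⟩) hlt.not_ge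
  refine ⟨S.c a0, ⟨hp, hq, hpq, fun a hlt => ?_, fun a hle ha => ?_, ?_⟩, a0, rfl⟩
  · rcases (S.nonneg p hp a).eq_or_lt with h | h
    · rw [← h]
      by_contra hne'
      have hq' : 0 < S.lam a q := lt_of_le_of_ne (S.nonneg q hq a) hne'
      obtain ⟨b, e1, -, e3⟩ := S.matching q hq p hp hpq.symm a hq'
      have hb : 0 < S.lam b p := by rw [e3]; exact hq'
      have hb' := hbelow b (by rw [e1]; exact hlt) hb
      have := S.color_inj q hq a b hq' hb' e1.symm
      rw [← this, ← h] at hb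
      exact lt_irrefl _ hb
    · exact hval p hp q hq hpq a h (hbelow a hlt h)
  · by_contra hne'
    have hq' : 0 < S.lam a q := lt_of_le_of_ne (S.nonneg q hq a) (Ne.symm hne')
    rcases hle.eq_or_lt with h | h
    · have := S.color_inj p hp a a0 ha ha0.1 h.symm
      rw [this] at hq'
      exact hq'.ne' ha0.2
    · have := S.common p hp q hq hpq a a0 ha hq' ha0.1 h
      exact this.ne' ha0.2
  · refine ha0.1.trans_le ?_
    exact Finset.single_le_sum (f := fun a => S.lam a p) (fun a _ => S.nonneg p hp a) (by simp)

/-- Both points get the same factors, so shared weights stay equal and unshared vertices stay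
unshared. The last hypothesis only ensures that some weight of colour `≥ i` survives. -/
theorem FirstDiff.rescale {i : ℕ} {p q : V} (h : S.FirstDiff i p q) {κ : ℕ → ℝ}
    (hκ : ∀ a, 0 < S.lam a p → 0 ≤ κ (S.c a)) (h1 : ∑ a, κ (S.c a) * S.lam a p = 1)
    (hτ : ∃ a, i ≤ S.c a ∧ 0 < κ (S.c a) * S.lam a p) :
    S.FirstDiff i (S.rescale κ p) (S.rescale κ q) := by
  obtain ⟨p1, p2, -⟩ := rescale_mem h.left_mem hκ h1
  obtain ⟨q1, q2, q3⟩ := rescale_image_eq h.left_mem h.right_mem h.image_eq hκ h1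
  refine ⟨p1, q1, q3, fun a ha => ?_, fun a ha h0 => ?_, ?_⟩
  · rw [p2, q2, h.below a ha]
  · rw [p2] at h0
    have : 0 < S.lam a p := lt_of_le_of_ne (S.nonneg p h.left_mem a) fun h2 => by
      rw [← h2, mul_zero] at h0; exact lt_irrefl _ h0
    rw [q2, h.above a ha this, mul_zero]
  · obtain ⟨a, ha, h0⟩ := hτ
    refine h0.trans_le ?_
    rw [← p2]
    exact Finset.single_le_sum (f := fun a => S.lam a (S.rescale κ p)) (fun a _ => S.nonneg _ p1 a) (by simpa)

/-- Points with this first difference are far apart in barycentric coordinates. -/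
theorem FirstDiff.tau_le_sum {i : ℕ} {p q : V} (h : S.FirstDiff i p q) :
    S.tau i p ≤ ∑ a, |S.lam a p - S.lam a q| := by
  rw [tau]
  refine (Finset.sum_le_sum fun a ha => ?_).trans
    (Finset.sum_le_sum_of_subset_of_nonneg (Finset.filter_subset _ _) fun _ _ _ => abs_nonneg _)
  rcases (S.nonneg p h.left_mem a).eq_or_lt with h0 | h0
  · rw [← h0]; exact abs_nonneg _
  · rw [h.above a (Finset.mem_filter.1 ha).2 h0, sub_zero]; exact le_abs_self _

end ColoredTriangulation

end Rescale

/-! ### The coning operator and its effect on pairs in a fibre. -/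

section ConeOperator

namespace ColoredTriangulation

variable {V W K : Type} [NormedAddCommGroup V] [NormedSpace ℝ V]
  [NormedAddCommGroup W] [NormedSpace ℝ W] [NormedAddCommGroup K] [NormedSpace ℝ K]
  {f : V → W} {N : Set V} {S : ColoredTriangulation f N}

/-- The multiplier fixing colours `< m`, multiplying colour `m` by `α` and colours `> m` by `β`. -/
def threeMul (m : ℕ) (α β : ℝ) (j : ℕ) : ℝ := if j < m then 1 else if j = m then α else β

/-- The parameter `F` serves two sums at once: that of the new weights and that of the absolute
displacements. -/
theorem sum_threeMul_aux (S : ColoredTriangulation f N) (F : ℝ → ℝ → ℝ) (m : ℕ) (α β : ℝ) (p : V)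
    (hF : ∀ c x, F c x = F c 1 * x) :
    ∑ a, F (threeMul m α β (S.c a)) (S.lam a p) =
      F 1 1 * (∑ a, S.lam a p - S.tau m p) + F α 1 * S.lvl m p + F β 1 * S.tau (m + 1) p := by
  rw [tau_eq_ite, lvl_eq_ite, tau_eq_ite, ← Finset.sum_sub_distrib, Finset.mul_sum, Finset.mul_sum,
    Finset.mul_sum, ← Finset.sum_add_distrib, ← Finset.sum_add_distrib]
  refine Finset.sum_congr rfl fun a _ => ?_
  rw [hF]
  rcases lt_trichotomy (S.c a) m with h | h | h
  · simp [threeMul, h, h.not_ge, h.ne, show ¬ m + 1 ≤ S.c a by omega]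
  · simp [threeMul, h]
  · simp [threeMul, h.le, h.ne', h.not_gt, show m + 1 ≤ S.c a by omega]

theorem sum_threeMul {p : V} (hp : p ∈ N) (m : ℕ) (α β : ℝ) :
    ∑ a, threeMul m α β (S.c a) * S.lam a p =
      1 - S.tau m p + α * S.lvl m p + β * S.tau (m + 1) p := by
  have := sum_threeMul_aux S (fun c x => c * x) m α β p (fun c x => by ring)
  rw [this, S.sum_one p hp]; ring

theorem sum_abs_threeMul {p : V} (hp : p ∈ N) (m : ℕ) (α β : ℝ) :
    ∑ a, |threeMul m α β (S.c a) * S.lam a p - S.lam a p| =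
      |α - 1| * S.lvl m p + |β - 1| * S.tau (m + 1) p := by
  have h1 : ∑ a, |threeMul m α β (S.c a) * S.lam a p - S.lam a p| =
      ∑ a, |threeMul m α β (S.c a) - 1| * S.lam a p := Finset.sum_congr rfl fun a _ => by
    rw [← sub_one_mul, abs_mul, abs_of_nonneg (S.nonneg p hp a)]
  rw [h1, sum_threeMul_aux S (fun c x => |c - 1| * x) m α β p (fun c x => by ring)]
  simp

theorem threeMul_nonneg {m : ℕ} {α β : ℝ} (hα : 0 ≤ α) (hβ : 0 ≤ β) (j : ℕ) :
    0 ≤ threeMul m α β j := by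
  unfold threeMul
  split_ifs <;> first | assumption | norm_num

/-- Push all weight of colours `> m` into colour `m`. -/
noncomputable def collapse (S : ColoredTriangulation f N) (m : ℕ) (p : V) : V :=
  S.rescale (threeMul m (S.tau m p / S.lvl m p) 0) p

/-- The factor by which `expand` multiplies the weights of colours `> m`. -/
noncomputable def expandFactor (S : ColoredTriangulation f N) (m : ℕ) (s : ℝ) (p : V) : ℝ :=
  max 1 (s * S.tau m p / S.tau (m + 1) p)

/-- Push weight from colour `m` to the colours `> m` until these have at least the share `s`. -/
noncomputable def expand (S : ColoredTriangulation f N) (m : ℕ) (s : ℝ) (p : V) : V :=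
  S.rescale (threeMul m ((S.tau m p - S.expandFactor m s p * S.tau (m + 1) p) / S.lvl m p)
    (S.expandFactor m s p)) p

/-- The coning operator: near the stratum of colours `≤ m` the function is replaced by the linear
interpolation between its values on the stratum and at the distance `s` from it. -/
noncomputable def cone (S : ColoredTriangulation f N) (m : ℕ) (s : ℝ) (G : V → K) (p : V) : K :=
  if s * S.tau m p ≤ S.tau (m + 1) p then G p else
    (1 - S.tau (m + 1) p / (s * S.tau m p)) • G (S.collapse m p) +
      (S.tau (m + 1) p / (s * S.tau m p)) • G (S.expand m s p)

theorem cone_of_le {m : ℕ} {s : ℝ} {p : V} (h : s * S.tau m p ≤ S.tau (m + 1) p) (G : V → K) :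
    S.cone m s G p = G p := by rw [cone, if_pos h]

theorem cone_zero {m : ℕ} {p : V} (hp : p ∈ N) (G : V → K) : S.cone m 0 G p = G p :=
  cone_of_le (by rw [zero_mul]; exact tau_nonneg hp _) G

theorem tau_pos_of_lt {m : ℕ} {s : ℝ} {p : V} (hp : p ∈ N) (hs : 0 ≤ s)
    (h : S.tau (m + 1) p < s * S.tau m p) : 0 < s ∧ 0 < S.tau m p := by
  have h1 := (tau_nonneg (S := S) hp (m + 1)).trans_lt h
  have h2 := tau_nonneg (S := S) hp m
  constructor
  · by_contra hs'
    rw [le_antisymm (not_lt.1 hs') hs, zero_mul] at h1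
    exact lt_irrefl _ h1
  · by_contra hs'
    rw [le_antisymm (not_lt.1 hs') h2, mul_zero] at h1
    exact lt_irrefl _ h1

theorem lvl_pos_of_lt {m : ℕ} {s : ℝ} {p : V} (hp : p ∈ N) (hs : 0 ≤ s) (hs1 : s ≤ 1)
    (h : S.tau (m + 1) p < s * S.tau m p) : 0 < S.lvl m p := by
  have h1 := tau_succ (S := S) m p
  have h2 := (tau_pos_of_lt hp hs h).2
  nlinarith

/-- The mass `tau (m + 1)` leaves the higher colours and arrives at colour `m`, so it counts twice
in the total displacement. -/
theorem collapse_weights {m : ℕ} {p : V} (hp : p ∈ N) (hl : 0 < S.lvl m p) :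
    (∀ j, 0 ≤ threeMul m (S.tau m p / S.lvl m p) 0 j) ∧
      ∑ a, threeMul m (S.tau m p / S.lvl m p) 0 (S.c a) * S.lam a p = 1 ∧
      ∑ a, |threeMul m (S.tau m p / S.lvl m p) 0 (S.c a) * S.lam a p - S.lam a p| =
        2 * S.tau (m + 1) p := by
  have h1 := tau_succ (S := S) m p
  have h2 := tau_nonneg (S := S) hp (m + 1)
  refine ⟨threeMul_nonneg (div_nonneg (tau_nonneg hp m) hl.le) le_rfl, ?_, ?_⟩
  · rw [sum_threeMul hp, div_mul_cancel₀ _ hl.ne']; ring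
  · have h3 : 0 ≤ S.tau m p / S.lvl m p - 1 := by
      rw [sub_nonneg, le_div_iff₀ hl]; linarith
    rw [sum_abs_threeMul hp, abs_of_nonneg h3, sub_mul, div_mul_cancel₀ _ hl.ne', h1]
    norm_num
    ring

theorem expandFactor_mul {m : ℕ} {s : ℝ} {p : V} (h0 : 0 < S.tau (m + 1) p) :
    S.expandFactor m s p * S.tau (m + 1) p = max (S.tau (m + 1) p) (s * S.tau m p) := by
  rw [expandFactor, max_mul_of_nonneg _ _ h0.le, div_mul_cancel₀ _ h0.ne', one_mul]

theorem one_le_expandFactor (S : ColoredTriangulation f N) (m : ℕ) (s : ℝ) (p : V) :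
    1 ≤ S.expandFactor m s p := le_max_left _ _

theorem expand_weights {m : ℕ} {s : ℝ} {p : V} (hp : p ∈ N) (hs1 : s ≤ 1)
    (hl : 0 < S.lvl m p) (h0 : 0 < S.tau (m + 1) p) :
    (∀ j, 0 ≤ threeMul m ((S.tau m p - S.expandFactor m s p * S.tau (m + 1) p) / S.lvl m p)
        (S.expandFactor m s p) j) ∧
      ∑ a, threeMul m ((S.tau m p - S.expandFactor m s p * S.tau (m + 1) p) / S.lvl m p)
        (S.expandFactor m s p) (S.c a) * S.lam a p = 1 ∧
      ∑ a, |threeMul m ((S.tau m p - S.expandFactor m s p * S.tau (m + 1) p) / S.lvl m p)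
        (S.expandFactor m s p) (S.c a) * S.lam a p - S.lam a p| =
        2 * (max (S.tau (m + 1) p) (s * S.tau m p) - S.tau (m + 1) p) := by
  have h1 := tau_succ (S := S) m p
  have hτ := tau_nonneg (S := S) hp m
  have hβ := one_le_expandFactor S m s p
  have hmul := expandFactor_mul (S := S) (m := m) (s := s) h0
  have hle : S.expandFactor m s p * S.tau (m + 1) p ≤ S.tau m p := by
    rw [hmul]
    exact max_le (by linarith) (by nlinarith)
  refine ⟨threeMul_nonneg (div_nonneg (sub_nonneg.2 hle) hl.le) (by linarith), ?_, ?_⟩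
  · rw [sum_threeMul hp, div_mul_cancel₀ _ hl.ne']; ring
  · have h3 : (S.tau m p - S.expandFactor m s p * S.tau (m + 1) p) / S.lvl m p - 1 ≤ 0 := by
      rw [sub_nonpos, div_le_one hl]
      nlinarith
    rw [sum_abs_threeMul hp, abs_of_nonpos h3, abs_of_nonneg (by linarith : 0 ≤ S.expandFactor m s p - 1),
      neg_mul, sub_mul, div_mul_cancel₀ _ hl.ne', sub_mul, hmul]
    linarith

/-- The value of the coning operator as a convex combination of values at two nearby points of the
same simplex. -/
theorem exists_cone_eq {m : ℕ} {s : ℝ} {p : V} (hp : p ∈ N) (hs : 0 ≤ s) (hs1 : s ≤ 1) :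
    ∃ w : ℝ, 0 ≤ w ∧ w ≤ 1 ∧ ∃ μ₀ μ₁ : S.ι → ℝ,
      ((∀ a, 0 ≤ μ₀ a) ∧ ∑ a, μ₀ a = 1 ∧ (∀ a, 0 < μ₀ a → 0 < S.lam a p) ∧
        ∑ a, |μ₀ a - S.lam a p| ≤ 2 * (s * S.tau m p)) ∧
      ((∀ a, 0 ≤ μ₁ a) ∧ ∑ a, μ₁ a = 1 ∧ (∀ a, 0 < μ₁ a → 0 < S.lam a p) ∧
        ∑ a, |μ₁ a - S.lam a p| ≤ 2 * (s * S.tau m p)) ∧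
      (∀ a, (1 - w) * μ₀ a + w * μ₁ a = S.lam a p) ∧
      ∀ G : V → K, S.cone m s G p = (1 - w) • G (∑ a, μ₀ a • S.v a) + w • G (∑ a, μ₁ a • S.v a) := by
  have hτ := tau_nonneg (S := S) hp m
  have hself : (∀ a, 0 ≤ S.lam a p) ∧ ∑ a, S.lam a p = 1 ∧ (∀ a, 0 < S.lam a p → 0 < S.lam a p) ∧
      ∑ a, |S.lam a p - S.lam a p| ≤ 2 * (s * S.tau m p) :=
    ⟨S.nonneg p hp, S.sum_one p hp, fun _ => id, by simp only [sub_self, abs_zero, Finset.sum_const_zero]; positivity⟩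
  by_cases hle : s * S.tau m p ≤ S.tau (m + 1) p
  · exact ⟨0, le_rfl, zero_le_one, fun a => S.lam a p, fun a => S.lam a p, hself, hself, by simp,
      fun G => by rw [cone_of_le hle, S.sum_smul p hp]; simp⟩
  · push Not at hle
    obtain ⟨hs0, hτ0⟩ := tau_pos_of_lt hp hs hle
    have hl := lvl_pos_of_lt hp hs hs1 hle
    have hsτ : 0 < s * S.tau m p := mul_pos hs0 hτ0
    have hpos : ∀ (κ : ℕ → ℝ) a, 0 < κ (S.c a) * S.lam a p → 0 < S.lam a p := fun κ a h =>
      lt_of_le_of_ne (S.nonneg p hp a) fun h2 => by rw [← h2, mul_zero] at h; exact lt_irrefl _ h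
    obtain ⟨c1, c2, c3⟩ := collapse_weights hp hl
    have hcol : (∀ a, 0 ≤ threeMul m (S.tau m p / S.lvl m p) 0 (S.c a) * S.lam a p) ∧
        ∑ a, threeMul m (S.tau m p / S.lvl m p) 0 (S.c a) * S.lam a p = 1 ∧
        (∀ a, 0 < threeMul m (S.tau m p / S.lvl m p) 0 (S.c a) * S.lam a p → 0 < S.lam a p) ∧
        ∑ a, |threeMul m (S.tau m p / S.lvl m p) 0 (S.c a) * S.lam a p - S.lam a p| ≤
          2 * (s * S.tau m p) :=
      ⟨fun a => mul_nonneg (c1 _) (S.nonneg p hp a), c2, hpos _, by rw [c3]; linarith⟩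
    -- If there is no weight of colour `> m`, the definition of `expandFactor` divides by zero. This
    -- is harmless: the expanded point enters with coefficient `0`, and the collapsed point is `p`.
    rcases (tau_nonneg (S := S) hp (m + 1)).eq_or_lt with h0 | h0
    · refine ⟨0, le_rfl, zero_le_one, _, _, hself, hself, by simp, fun G => ?_⟩
      have hcp : S.collapse m p = p := by
        refine rescale_one hp fun a ha => ?_
        have h1 := tau_succ (S := S) m p
        rw [← h0, add_zero] at h1
        rw [h1, div_self hl.ne', threeMul]
        have : ¬ m < S.c a := fun hlt => by
          have : S.lam a p ≤ S.tau (m + 1) p :=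
            Finset.single_le_sum (f := fun a => S.lam a p) (fun a _ => S.nonneg p hp a) (by simpa using hlt)
          linarith
        split_ifs <;> first | rfl | omega
      rw [cone, if_neg (not_le.2 hle), ← h0, hcp, S.sum_smul p hp]
      simp
    · obtain ⟨e1, e2, e3⟩ := expand_weights hp hs1 hl h0
      refine ⟨S.tau (m + 1) p / (s * S.tau m p), by positivity, by rw [div_le_one hsτ]; exact hle.le, _, _,
        hcol, ⟨fun a => mul_nonneg (e1 _) (S.nonneg p hp a), e2, hpos _, ?_⟩, fun a => ?_, fun G => ?_⟩
      · rw [e3, max_eq_right hle.le]; linarith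
      · have hβ : S.expandFactor m s p = s * S.tau m p / S.tau (m + 1) p := by
          rw [expandFactor, max_eq_right]
          rw [one_le_div h0]; exact hle.le
        rw [hβ, div_mul_cancel₀ _ h0.ne']
        have h1 := tau_succ (S := S) m p
        unfold threeMul
        split_ifs
        · ring
        · field_simp
          rw [h1]; ring
        · field_simp
          ring
      · rw [cone, if_neg (not_le.2 hle)]
        rfl

theorem norm_combo_le {u v : K} {w r : ℝ} (h0 : 0 ≤ w) (h1 : w ≤ 1) (hu : ‖u‖ ≤ r) (hv : ‖v‖ ≤ r) :
    ‖(1 - w) • u + w • v‖ ≤ r := by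
  refine (norm_add_le _ _).trans ?_
  rw [norm_smul, norm_smul, Real.norm_of_nonneg h0, Real.norm_of_nonneg (sub_nonneg.2 h1)]
  nlinarith

theorem norm_cone_sub_le {m : ℕ} {s r : ℝ} (hs : 0 ≤ s) (hs1 : s ≤ 1) {G G' : V → K}
    (h : ∀ p ∈ N, ‖G p - G' p‖ ≤ r) : ∀ p ∈ N, ‖S.cone m s G p - S.cone m s G' p‖ ≤ r := by
  intro p hp
  obtain ⟨w, w0, w1, μ₀, μ₁, ⟨a1, a2, a3, -⟩, ⟨b1, b2, b3, -⟩, -, hG⟩ :=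
    exists_cone_eq (K := K) (S := S) (m := m) hp hs hs1
  rw [hG, hG, show ∀ x y z t : K, (1 - w) • x + w • y - ((1 - w) • z + w • t) =
    (1 - w) • (x - z) + w • (y - t) by intros; simp only [smul_sub]; abel]
  exact norm_combo_le w0 w1 (h _ (S.face p hp μ₀ a1 a2 a3).1) (h _ (S.face p hp μ₁ b1 b2 b3).1)

/-- A bound for the norms of the vertices. -/
noncomputable def vertexBound (S : ColoredTriangulation f N) : ℝ := ∑ a, ‖S.v a‖

theorem norm_sum_sub_le {p : V} (hp : p ∈ N) {μ : S.ι → ℝ} {r : ℝ} (h : ∑ a, |μ a - S.lam a p| ≤ r) :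
    ‖∑ a, μ a • S.v a - p‖ ≤ r * S.vertexBound := by
  conv_lhs => rw [← S.sum_smul p hp]
  rw [← Finset.sum_sub_distrib]
  calc ‖∑ a, (μ a • S.v a - S.lam a p • S.v a)‖ ≤ ∑ a, |μ a - S.lam a p| * S.vertexBound := by
        refine norm_sum_le_of_le _ fun a ha => ?_
        rw [← sub_smul, norm_smul, Real.norm_eq_abs]
        exact mul_le_mul_of_nonneg_left
          (Finset.single_le_sum (f := fun a => ‖S.v a‖) (fun _ _ => norm_nonneg _) ha) (abs_nonneg _)
    _ = (∑ a, |μ a - S.lam a p|) * S.vertexBound := by rw [Finset.sum_mul]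
    _ ≤ r * S.vertexBound :=
        mul_le_mul_of_nonneg_right h (Finset.sum_nonneg fun a _ => norm_nonneg _)

theorem vertexBound_nonneg (S : ColoredTriangulation f N) : 0 ≤ S.vertexBound :=
  Finset.sum_nonneg fun _ _ => norm_nonneg _

/-- If `G` varies little near `p` then so does the coned function. -/
theorem norm_cone_sub_const_le {m : ℕ} {s r : ℝ} {p : V} (hp : p ∈ N) (hs : 0 ≤ s) (hs1 : s ≤ 1)
    {G : V → K} {y : K}
    (h : ∀ q ∈ N, ‖q - p‖ ≤ 2 * (s * S.tau m p) * S.vertexBound → ‖G q - y‖ ≤ r) :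
    ‖S.cone m s G p - y‖ ≤ r := by
  obtain ⟨w, w0, w1, μ₀, μ₁, ⟨a1, a2, a3, a4⟩, ⟨b1, b2, b3, b4⟩, -, hG⟩ :=
    exists_cone_eq (K := K) (S := S) (m := m) hp hs hs1
  rw [hG, show ∀ x z : K, (1 - w) • x + w • z - y = (1 - w) • (x - y) + w • (z - y) by
    intros; simp only [smul_sub, sub_smul, one_smul]; abel]
  exact norm_combo_le w0 w1 (h _ (S.face p hp μ₀ a1 a2 a3).1 (norm_sum_sub_le hp a4))
    (h _ (S.face p hp μ₁ b1 b2 b3).1 (norm_sum_sub_le hp b4))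

/-- The two points whose values are combined lie in the simplex of `p` and have `p` as the same
convex combination, so affine functions are reproduced. -/
theorem cone_eq_of_affineOnSimplices {N₀ : Set V} {g : V → K} (hS : S.AffineOnSimplices N₀ g)
    (hN₀ : N₀ ⊆ N) {m : ℕ} {s : ℝ} (hs : 0 ≤ s) (hs1 : s ≤ 1) {G : V → K} (hG : EqOn G g N₀) :
    EqOn (S.cone m s G) g N₀ := by
  intro p hp
  obtain ⟨w, w0, w1, μ₀, μ₁, ⟨a1, a2, a3, -⟩, ⟨b1, b2, b3, -⟩, hw, hcone⟩ :=
    exists_cone_eq (K := K) (S := S) (m := m) (hN₀ hp) hs hs1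
  obtain ⟨m1, e1⟩ := hS p hp μ₀ a1 a2 a3
  obtain ⟨m2, e2⟩ := hS p hp μ₁ b1 b2 b3
  obtain ⟨-, e3⟩ := hS p hp (fun a => S.lam a p) (S.nonneg p (hN₀ hp)) (S.sum_one p (hN₀ hp))
    fun _ => id
  rw [S.sum_smul p (hN₀ hp)] at e3
  rw [hcone, hG m1, hG m2, e1, e2, e3]
  simp only [← hw, add_smul, mul_smul, Finset.sum_add_distrib, Finset.smul_sum]

/-- Effect of coning on a pair of points with the same image which share their vertices of colours
`≤ m`. -/
theorem FirstDiff.exists_cone_sub {i m : ℕ} (him : m < i) {p q : V} (h : S.FirstDiff i p q) {s : ℝ}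
    (hs : 0 ≤ s) (hs1 : s ≤ 1) : ∃ w : ℝ, 0 < w ∧ ∃ p' q', S.FirstDiff i p' q' ∧
      (∀ l ≤ m, S.tau l p' = S.tau l p) ∧ s * S.tau m p' ≤ S.tau (m + 1) p' ∧
      ∀ G : V → K, S.cone m s G p - S.cone m s G q = w • (G p' - G q') := by
  have hp := h.left_mem
  have hq := h.right_mem
  have hτ := fun l => tau_eq_of_image_eq (S := S) hp hq h.image_eq l
  have hlv := fun l => lvl_eq_of_image_eq (S := S) hp hq h.image_eq l
  by_cases hle : s * S.tau m p ≤ S.tau (m + 1) p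
  · refine ⟨1, one_pos, p, q, h, fun _ _ => rfl, hle, fun G => ?_⟩
    rw [cone_of_le hle, cone_of_le (by rw [← hτ, ← hτ]; exact hle), one_smul]
  · push Not at hle
    have h0 : 0 < S.tau (m + 1) p := h.tau_pos.trans_le (tau_anti hp him)
    obtain ⟨hs0, hτ0⟩ := tau_pos_of_lt hp hs hle
    have hl := lvl_pos_of_lt hp hs hs1 hle
    have hsτ : 0 < s * S.tau m p := mul_pos hs0 hτ0
    obtain ⟨e1, e2, -⟩ := expand_weights hp hs1 hl h0
    have hβ1 := one_le_expandFactor S m s p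
    have hβmul := expandFactor_mul (S := S) (m := m) (s := s) h0
    rw [max_eq_right hle.le] at hβmul
    set β := S.expandFactor m s p with hβ
    set α := (S.tau m p - β * S.tau (m + 1) p) / S.lvl m p with hα
    have hqexp : S.expand m s q = S.rescale (threeMul m α β) q := by
      rw [expand, hα, hβ, expandFactor, expandFactor, hτ, hτ, hlv]
    -- As `m < i`, the points differ only in colours `> m`, which collapsing multiplies by zero. The
    -- collapsed terms therefore cancel in the difference.
    have hcol : S.collapse m p = S.collapse m q := by
      rw [collapse, collapse, ← hτ, ← hlv]
      refine Finset.sum_congr rfl fun a _ => ?_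
      by_cases ha : S.c a < i
      · rw [h.below a ha]
      · have h1 : ¬ S.c a < m := by omega
        have h2 : S.c a ≠ m := by omega
        simp [threeMul, h1, h2]
    have hex : ∃ a, i ≤ S.c a ∧ 0 < threeMul m α β (S.c a) * S.lam a p := by
      obtain ⟨a, ha, ha0⟩ := Finset.exists_lt_of_sum_lt (s := Finset.univ.filter fun a => i ≤ S.c a)
        (f := fun _ => (0 : ℝ)) (g := fun a => S.lam a p) (by rw [Finset.sum_const_zero]; exact h.tau_pos)
      have hia := (Finset.mem_filter.1 ha).2
      refine ⟨a, hia, mul_pos ?_ ha0⟩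
      have h1 : ¬ S.c a < m := by omega
      have h2 : S.c a ≠ m := by omega
      simp only [threeMul, h1, h2, if_false]
      linarith
    have hfd := h.rescale (κ := threeMul m α β) (fun a _ => e1 _) e2 hex
    have hlam := (rescale_mem hp (κ := threeMul m α β) (fun a _ => e1 _) e2).2.1
    have htail : S.tau (m + 1) (S.rescale (threeMul m α β) p) = β * S.tau (m + 1) p := by
      rw [tau, tau, Finset.mul_sum]
      refine Finset.sum_congr rfl fun a ha => ?_
      have hma := (Finset.mem_filter.1 ha).2
      have h1 : ¬ S.c a < m := by omega
      have h2 : S.c a ≠ m := by omega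
      simp [hlam, threeMul, h1, h2]
    -- For `l ≤ m` the tail weight is one minus the weight of colours `< l`, which the expansion
    -- does not touch.
    have hlow : ∀ l ≤ m, S.tau l (S.rescale (threeMul m α β) p) = S.tau l p := by
      intro l hlm
      have hcompl : ∀ r ∈ N, S.tau l r = 1 - ∑ a with S.c a < l, S.lam a r := by
        intro r hr
        rw [eq_sub_iff_add_eq, ← S.sum_one r hr, tau, add_comm,
          ← Finset.sum_filter_add_sum_filter_not Finset.univ (fun a => S.c a < l)]
        simp only [not_lt]
      rw [hcompl _ hfd.left_mem, hcompl _ hp]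
      congr 1
      refine Finset.sum_congr rfl fun a ha => ?_
      have hla := (Finset.mem_filter.1 ha).2
      simp [hlam, threeMul, show S.c a < m by omega]
    refine ⟨S.tau (m + 1) p / (s * S.tau m p), div_pos h0 hsτ, _, _, hfd, hlow, ?_, fun G => ?_⟩
    · rw [hlow m le_rfl, htail, hβmul]
    · rw [cone, cone, if_neg (not_le.2 hle), if_neg (by rw [← hτ, ← hτ]; exact not_le.2 hle), ← hτ, ← hτ,
        ← hcol, hqexp, smul_sub]
      simp only [expand, ← hβ, ← hα]
      abel

end ColoredTriangulation

end ConeOperator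

/-! ### Piecewise linearity on simplices; continuity of coning. -/

section ConeContinuity

/-- Tube lemma: over a compact set a jointly continuous family depends on its parameter uniformly.
-/
theorem eventually_forall_norm_sub_lt {V K Z : Type*} [TopologicalSpace V]
    [SeminormedAddCommGroup K] [TopologicalSpace Z] {N : Set V} (hN : IsCompact N)
    {G : Z → V → K} (hG : ContinuousOn (fun z : Z × V => G z.1 z.2) (univ ×ˢ N)) (z0 : Z) {ε : ℝ}
    (hε : 0 < ε) : ∀ᶠ z in 𝓝 z0, ∀ p ∈ N, ‖G z p - G z0 p‖ < ε := by
  refine (hN.eventually_forall_of_forall_eventually (P := fun z p => p ∈ N → ‖G z p - G z0 p‖ < ε)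
    fun p hp => ?_).mono fun z hz p hp => hz p hp hp
  have h1 := hG (z0, p) ⟨mem_univ _, hp⟩
  have h2 : Filter.Tendsto (fun z : Z × V => G z0 z.2) (𝓝[univ ×ˢ N] (z0, p)) (𝓝 (G z0 p)) := by
    have : Filter.Tendsto (fun z : Z × V => (z0, z.2)) (𝓝[univ ×ˢ N] (z0, p)) (𝓝[univ ×ˢ N] (z0, p)) :=
      tendsto_nhdsWithin_iff.2 ⟨((continuous_const.prodMk continuous_snd).tendsto (z0, p)).mono_left
        nhdsWithin_le_nhds, eventually_mem_nhdsWithin.mono fun z hz => ⟨mem_univ _, hz.2⟩⟩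
    exact h1.tendsto.comp this
  have h3 := (h1.tendsto.sub h2).norm
  simp only [sub_self, norm_zero] at h3
  have h4 := h3.eventually (gt_mem_nhds hε)
  rw [eventually_nhdsWithin_iff] at h4
  exact h4.mono fun z hz hzN => hz ⟨mem_univ _, hzN⟩

namespace ColoredTriangulation

variable {V W K : Type} [NormedAddCommGroup V] [NormedSpace ℝ V]
  [NormedAddCommGroup W] [NormedSpace ℝ W] [NormedAddCommGroup K] [NormedSpace ℝ K]
  {f : V → W} {N : Set V} {S : ColoredTriangulation f N}

/-- The set of vertices of the simplex of `p`. -/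
noncomputable def support (S : ColoredTriangulation f N) (p : V) : Finset S.ι :=
  Finset.univ.filter fun a => 0 < S.lam a p

open Classical in
/-- The simplex of `p`. -/
def simplex (S : ColoredTriangulation f N) (p : V) : Set V :=
  convexHull ℝ (((S.support p).image S.v : Finset V) : Set V)

theorem exists_of_mem_simplex {p : V} {x : V} (hx : x ∈ S.simplex p) : ∃ μ : S.ι → ℝ, (∀ a, 0 ≤ μ a) ∧
    ∑ a, μ a = 1 ∧ (∀ a, 0 < μ a → 0 < S.lam a p) ∧ ∑ a, μ a • S.v a = x := by
  classical
  obtain ⟨μ, h0, h1, rfl⟩ := (mem_convexHull_image_iff _ _ _).1 hx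
  refine ⟨fun a => if a ∈ S.support p then μ a else 0, fun a => ?_, ?_, fun a ha => ?_, ?_⟩
  · dsimp only
    split_ifs with h
    exacts [h0 a h, le_rfl]
  · simpa [← Finset.sum_filter] using h1
  · by_contra h
    simp [support, h] at ha
  · simp [ite_smul]

theorem of_mem_simplex {p : V} (hp : p ∈ N) {x : V} (hx : x ∈ S.simplex p) :
    x ∈ N ∧ ∀ a, 0 < S.lam a x → 0 < S.lam a p := by
  obtain ⟨μ, h0, h1, h2, rfl⟩ := exists_of_mem_simplex hx
  obtain ⟨e1, e2, -⟩ := S.face p hp μ h0 h1 h2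
  exact ⟨e1, fun a ha => h2 a (by rwa [e2] at ha)⟩

theorem eq_biUnion_simplex (S : ColoredTriangulation f N) : N = ⋃ s ∈ S.simplex '' N, s := by
  classical
  rw [biUnion_image]
  refine subset_antisymm (fun p hp => mem_biUnion hp ?_) (iUnion₂_subset fun p hp x hx => (of_mem_simplex hp hx).1)
  refine (mem_convexHull_image_iff _ _ _).2 ⟨fun a => S.lam a p, fun a _ => S.nonneg p hp a, ?_, ?_⟩
  · rw [← S.sum_one p hp]
    exact Finset.sum_filter_of_ne fun a _ h => lt_of_le_of_ne (S.nonneg p hp a) h.symm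
  · conv_rhs => rw [← S.sum_smul p hp]
    exact Finset.sum_filter_of_ne fun a _ h => lt_of_le_of_ne (S.nonneg p hp a) fun h0 => h (by
      dsimp only
      rw [← h0, zero_smul])

/-- Piecewise linearity can be checked on simplices. -/
theorem isCompactPL_of_simplex {W' : Type} [NormedAddCommGroup W'] [NormedSpace ℝ W']
    (S : ColoredTriangulation f N) {F : V → W'} (hF : ∀ p ∈ N, IsCompactPL F (S.simplex p)) :
    IsCompactPL F N := by
  classical
  have hfin : (S.simplex '' N).Finite := by
    refine (toFinite ((fun t : Finset S.ι => convexHull ℝ ((t.image S.v : Finset V) : Set V)) ''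
      univ)).subset ?_
    rintro _ ⟨p, -, rfl⟩
    exact ⟨S.support p, mem_univ _, by unfold simplex; congr!⟩
  rw [S.eq_biUnion_simplex]
  refine isCompactPL_biUnion hfin ?_
  rintro _ ⟨p, hp, rfl⟩
  exact hF p hp

theorem isCompactPolyhedron_simplex (S : ColoredTriangulation f N) (p : V) :
    IsCompactPolyhedron (S.simplex p) := isCompactPolyhedron_convexHull _

/-- A map that is affine on each simplex is piecewise linear. -/
theorem isCompactPL_of_simplexwise {W' : Type} [NormedAddCommGroup W'] [NormedSpace ℝ W']
    (S : ColoredTriangulation f N) {F : V → W'}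
    (hF : ∀ p ∈ N, ∃ φ : S.ι → W', ∀ μ : S.ι → ℝ, (∀ a, 0 ≤ μ a) → ∑ a, μ a = 1 →
      (∀ a, 0 < μ a → 0 < S.lam a p) → F (∑ a, μ a • S.v a) = ∑ a, μ a • φ a) :
    IsCompactPL F N := by
  classical
  refine S.isCompactPL_of_simplex fun p hp => ?_
  obtain ⟨φ, hφ⟩ := hF p hp
  obtain ⟨A, hA⟩ := exists_affineMap_of_convexCombination (S.support p) S.v φ F fun μ h0 h1 => by
    have := hφ (fun a => if a ∈ S.support p then μ a else 0) (fun a => ?_) ?_ fun a ha => ?_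
    · simpa [ite_smul, ← Finset.sum_filter] using this
    · split_ifs with h
      exacts [h0 a h, le_rfl]
    · simpa [← Finset.sum_filter] using h1
    · by_contra h
      simp [support, h] at ha
  refine ⟨{(S.support p).image S.v}, by simp [simplex], fun F' hF' => ⟨A, fun x hx => ?_⟩⟩
  rw [Finset.mem_singleton.1 hF'] at hx
  obtain ⟨μ, h0, h1, rfl⟩ := (mem_convexHull_image_iff _ _ _).1 hx
  exact hA μ h0 h1

theorem isCompactPL_lam (S : ColoredTriangulation f N) (a : S.ι) : IsCompactPL (S.lam a) N := by
  classical
  refine S.isCompactPL_of_simplexwise fun p hp => ⟨fun b => if b = a then 1 else 0, fun μ h0 h1 hμ => ?_⟩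
  rw [(S.face p hp μ h0 h1 hμ).2.1 a]
  simp

variable [FiniteDimensional ℝ V]

theorem continuousOn_lam (S : ColoredTriangulation f N) (a : S.ι) : ContinuousOn (S.lam a) N :=
  (S.isCompactPL_lam a).continuousOn

theorem continuousOn_tau (S : ColoredTriangulation f N) (m : ℕ) : ContinuousOn (S.tau m) N :=
  continuousOn_finsetSum _ fun a _ => S.continuousOn_lam a

theorem continuousOn_lvl (S : ColoredTriangulation f N) (m : ℕ) : ContinuousOn (S.lvl m) N :=
  continuousOn_finsetSum _ fun a _ => S.continuousOn_lam a

theorem tendsto_threeMul {α : Type*} {l : Filter α} {A B : α → ℝ} {a b : ℝ} (hA : Filter.Tendsto A l (𝓝 a))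
    (hB : Filter.Tendsto B l (𝓝 b)) (m j : ℕ) :
    Filter.Tendsto (fun x => threeMul m (A x) (B x) j) l (𝓝 (threeMul m a b j)) := by
  unfold threeMul
  split_ifs
  exacts [tendsto_const_nhds, hA, hB]

/-- The formula degenerates where `s * tau m` vanishes and where `tau (m + 1)` vanishes; these
places are treated separately. The bound `s ≤ 1 / 2` keeps `lvl m` positive elsewhere in the coned
region and on its boundary. -/
theorem continuousOn_cone (hN : IsCompact N) (m : ℕ) {G : V → K} (hG : ContinuousOn G N) :
    ContinuousOn (fun z : ℝ × V => S.cone m z.1 G z.2) (Icc 0 (1 / 2) ×ˢ N) := by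
  rintro ⟨s0, p0⟩ ⟨hs0, hp0⟩
  have hs0 : s0 ∈ Icc (0 : ℝ) (1 / 2) := hs0
  have hp0 : p0 ∈ N := hp0
  set l := 𝓝[Icc (0 : ℝ) (1 / 2) ×ˢ N] (s0, p0) with hl
  have hmem : ∀ᶠ z : ℝ × V in l, z ∈ Icc (0 : ℝ) (1 / 2) ×ˢ N := self_mem_nhdsWithin
  have hs : Filter.Tendsto (fun z : ℝ × V => z.1) l (𝓝 s0) :=
    (continuous_fst.tendsto _).mono_left nhdsWithin_le_nhds
  have hp : Filter.Tendsto (fun z : ℝ × V => z.2) l (𝓝[N] p0) :=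
    tendsto_nhdsWithin_iff.2 ⟨(continuous_snd.tendsto (s0, p0)).mono_left nhdsWithin_le_nhds,
      hmem.mono fun z hz => hz.2⟩
  have hlam : ∀ a, Filter.Tendsto (fun z : ℝ × V => S.lam a z.2) l (𝓝 (S.lam a p0)) := fun a =>
    (S.continuousOn_lam a p0 hp0).tendsto.comp hp
  have hτ : ∀ m, Filter.Tendsto (fun z : ℝ × V => S.tau m z.2) l (𝓝 (S.tau m p0)) := fun m =>
    (S.continuousOn_tau m p0 hp0).tendsto.comp hp
  have hlv : ∀ m, Filter.Tendsto (fun z : ℝ × V => S.lvl m z.2) l (𝓝 (S.lvl m p0)) := fun m =>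
    (S.continuousOn_lvl m p0 hp0).tendsto.comp hp
  have hsτ : Filter.Tendsto (fun z : ℝ × V => z.1 * S.tau m z.2) l (𝓝 (s0 * S.tau m p0)) :=
    hs.mul (hτ m)
  have hGp : Filter.Tendsto (fun z : ℝ × V => G z.2) l (𝓝 (G p0)) := Filter.Tendsto.comp (hG p0 hp0) hp
  have hresc : ∀ (A B : ℝ × V → ℝ) (a b : ℝ), Filter.Tendsto A l (𝓝 a) → Filter.Tendsto B l (𝓝 b) →
      Filter.Tendsto (fun z : ℝ × V => S.rescale (threeMul m (A z) (B z)) z.2) l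
        (𝓝 (S.rescale (threeMul m a b) p0)) := fun A B a b hA hB =>
    tendsto_finsetSum _ fun c _ => ((tendsto_threeMul hA hB m _).mul (hlam c)).smul tendsto_const_nhds
  change Filter.Tendsto _ l (𝓝 (S.cone m s0 G p0))
  have hτ0 := tau_nonneg (S := S) hp0
  -- Here the coned value combines values of `G` at points within `2 * (s * tau m) * vertexBound` of
  -- `p`, and this radius tends to zero.
  rcases (mul_nonneg hs0.1 (hτ0 m)).eq_or_lt with h0 | h0
  · rw [cone_of_le (by rw [← h0]; exact hτ0 _), Metric.tendsto_nhds]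
    intro ε hε
    obtain ⟨d, hd, hGd⟩ := Metric.continuousOn_iff.1 hG p0 hp0 (ε / 2) (half_pos hε)
    have hlim : Filter.Tendsto (fun z : ℝ × V =>
        2 * (z.1 * S.tau m z.2) * S.vertexBound + dist z.2 p0) l (𝓝 0) := by
      have := ((hsτ.const_mul 2).mul_const S.vertexBound).add
        ((hp.mono_right nhdsWithin_le_nhds).dist (tendsto_const_nhds (x := p0)))
      rw [← h0] at this
      simpa using this
    filter_upwards [hlim.eventually (gt_mem_nhds hd), hmem] with z hz hzm
    refine lt_of_le_of_lt ?_ (half_lt_self hε)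
    rw [dist_eq_norm]
    refine norm_cone_sub_const_le hzm.2 hzm.1.1 (by linarith [hzm.1.2]) fun q hq hqz => ?_
    rw [← dist_eq_norm]
    refine (hGd q hq ?_).le
    rw [← dist_eq_norm] at hqz
    linarith [dist_triangle q z.2 p0]
  rcases lt_or_ge (s0 * S.tau m p0) (S.tau (m + 1) p0) with h1 | h1
  · rw [cone_of_le h1.le]
    refine hGp.congr' ?_
    filter_upwards [hsτ.eventually_lt (hτ (m + 1)) h1] with z hz
    rw [cone_of_le hz.le]
  · have hlv0 : 0 < S.lvl m p0 := by
      have := tau_succ (S := S) m p0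
      have h2 : 0 < S.tau m p0 := by
        by_contra hc
        rw [le_antisymm (not_lt.1 hc) (hτ0 m), mul_zero] at h0
        exact lt_irrefl _ h0
      nlinarith [hs0.2]
    have hw : Filter.Tendsto (fun z : ℝ × V => S.tau (m + 1) z.2 / (z.1 * S.tau m z.2)) l
        (𝓝 (S.tau (m + 1) p0 / (s0 * S.tau m p0))) := (hτ (m + 1)).div hsτ h0.ne'
    have hcolN : ∀ p ∈ N, 0 < S.lvl m p → S.collapse m p ∈ N := fun p hp hl =>
      (rescale_mem hp (fun a _ => (collapse_weights hp hl).1 _) (collapse_weights hp hl).2.1).1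
    have hexpN : ∀ p ∈ N, ∀ s ≤ (1 : ℝ) / 2, 0 < S.lvl m p → 0 < S.tau (m + 1) p → S.expand m s p ∈ N :=
      fun p hp s hs hl h =>
      (rescale_mem hp (fun a _ => (expand_weights hp (by linarith) hl h).1 _)
        (expand_weights hp (by linarith) hl h).2.1).1
    have hlvev : ∀ᶠ z : ℝ × V in l, 0 < S.lvl m z.2 := (hlv m).eventually (lt_mem_nhds hlv0)
    have hcol : Filter.Tendsto (fun z : ℝ × V => G (S.collapse m z.2)) l (𝓝 (G (S.collapse m p0))) := by
      refine Filter.Tendsto.comp (hG _ (hcolN p0 hp0 hlv0)) (tendsto_nhdsWithin_iff.2 ⟨?_, ?_⟩)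
      · exact hresc _ _ _ _ ((hτ m).div (hlv m) hlv0.ne') tendsto_const_nhds
      · filter_upwards [hmem, hlvev] with z hz hz'
        exact hcolN z.2 hz.2 hz'
    rcases (hτ0 (m + 1)).eq_or_lt with h2 | h2
    -- The expanded point need not converge as `tau (m + 1)` tends to zero, but its coefficient does
    -- tend to zero and `G` is bounded on `N`.
    · have hval : S.cone m s0 G p0 = G (S.collapse m p0) := by
        rw [cone, if_neg (by rw [← h2]; exact not_le.2 h0), ← h2]
        simp
      rw [hval]
      obtain ⟨M, hM⟩ := hN.exists_bound_of_continuousOn hG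
      have hlim : Filter.Tendsto (fun z : ℝ × V => S.cone m z.1 G z.2 - G (S.collapse m z.2)) l (𝓝 0) := by
        refine squeeze_zero_norm' (a := fun z : ℝ × V =>
          S.tau (m + 1) z.2 / (z.1 * S.tau m z.2) * (M + M)) ?_ ?_
        · filter_upwards [hmem, hlvev, (hτ (m + 1)).eventually_lt hsτ (by rw [← h2]; exact h0)] with z hz hz' hz2
          rw [cone, if_neg (not_le.2 hz2)]
          have hw0 : 0 ≤ S.tau (m + 1) z.2 / (z.1 * S.tau m z.2) :=
            div_nonneg (tau_nonneg hz.2 _) (mul_nonneg hz.1.1 (tau_nonneg hz.2 _))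
          rw [show ∀ (w : ℝ) (x y : K), (1 - w) • x + w • y - x = w • (y - x) by
            intros; simp only [smul_sub, sub_smul, one_smul]; abel, norm_smul, Real.norm_of_nonneg hw0]
          rcases (tau_nonneg (S := S) hz.2 (m + 1)).eq_or_lt with h3 | h3
          · rw [← h3]; simp
          · exact mul_le_mul_of_nonneg_left ((norm_sub_le _ _).trans (add_le_add
              (hM _ (hexpN _ hz.2 _ hz.1.2 hz' h3)) (hM _ (hcolN _ hz.2 hz')))) hw0
        · have := hw.mul_const (M + M)
          rwa [← h2, zero_div, zero_mul] at this
      have := hlim.add hcol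
      simpa using this
    · have hfactor : Filter.Tendsto (fun z : ℝ × V => S.expandFactor m z.1 z.2) l
          (𝓝 (S.expandFactor m s0 p0)) :=
        tendsto_const_nhds.max (hsτ.div (hτ (m + 1)) h2.ne')
      have hexp : Filter.Tendsto (fun z : ℝ × V => G (S.expand m z.1 z.2)) l (𝓝 (G (S.expand m s0 p0))) := by
        refine Filter.Tendsto.comp (hG _ (hexpN p0 hp0 s0 hs0.2 hlv0 h2)) (tendsto_nhdsWithin_iff.2 ⟨?_, ?_⟩)
        · exact hresc _ _ _ _ (((hτ m).sub (hfactor.mul (hτ (m + 1)))).div (hlv m) hlv0.ne') hfactor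
        · filter_upwards [hmem, hlvev, (hτ (m + 1)).eventually (lt_mem_nhds h2)] with z hz hz' hz2
          exact hexpN z.2 hz.2 z.1 hz.1.2 hz' hz2
      -- Truncating the coefficient at `1` gives one formula for both branches: outside the coned
      -- region the expansion is the identity.
      have hform : ∀ z : ℝ × V, z ∈ Icc (0 : ℝ) (1 / 2) ×ˢ N → 0 < S.lvl m z.2 → 0 < S.tau (m + 1) z.2 →
          0 < z.1 * S.tau m z.2 → S.cone m z.1 G z.2 =
          (1 - min 1 (S.tau (m + 1) z.2 / (z.1 * S.tau m z.2))) • G (S.collapse m z.2) +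
            min 1 (S.tau (m + 1) z.2 / (z.1 * S.tau m z.2)) • G (S.expand m z.1 z.2) := by
        intro z hz hz1 hz2 hz3
        by_cases hle : z.1 * S.tau m z.2 ≤ S.tau (m + 1) z.2
        · have hβ : S.expandFactor m z.1 z.2 = 1 := by
            rw [expandFactor, max_eq_left]
            rwa [div_le_one hz2]
          have hexp1 : S.expand m z.1 z.2 = z.2 := by
            refine rescale_one hz.2 fun a _ => ?_
            have := tau_succ (S := S) m z.2
            rw [hβ, one_mul, show S.tau m z.2 - S.tau (m + 1) z.2 = S.lvl m z.2 by linarith,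
              div_self hz1.ne', threeMul]
            split_ifs <;> rfl
          rw [cone_of_le hle, min_eq_left (by rwa [one_le_div hz3]), hexp1]
          simp
        · rw [cone, if_neg hle, min_eq_right (by rw [div_le_one hz3]; exact (not_le.1 hle).le)]
      rw [hform (s0, p0) ⟨hs0, hp0⟩ hlv0 h2 h0]
      have hmin := (tendsto_const_nhds (x := (1 : ℝ))).min hw
      refine Filter.Tendsto.congr' ?_ (((tendsto_const_nhds.sub hmin).smul hcol).add (hmin.smul hexp))
      filter_upwards [hmem, hlvev, (hτ (m + 1)).eventually (lt_mem_nhds h2),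
        hsτ.eventually (lt_mem_nhds h0)] with z hz hz1 hz2 hz3
      exact (hform z hz hz1 hz2 hz3).symm

/-- Coning does not increase the uniform distance of functions, so a variation of `G z` can be
separated from that of the scale and the point. -/
theorem continuousOn_cone_family {Z : Type*} [TopologicalSpace Z] (hN : IsCompact N) (m : ℕ)
    {η : Z → ℝ} (hη : Continuous η) (hη0 : ∀ z, η z ∈ Icc (0 : ℝ) (1 / 2)) {G : Z → V → K}
    (hG : ContinuousOn (fun z : Z × V => G z.1 z.2) (univ ×ˢ N)) :
    ContinuousOn (fun z : Z × V => S.cone m (η z.1) (G z.1) z.2) (univ ×ˢ N) := by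
  rintro ⟨z0, p0⟩ ⟨-, hp0⟩
  have hp0 : p0 ∈ N := hp0
  have hG0 : ContinuousOn (G z0) N :=
    hG.comp (continuousOn_const.prodMk continuousOn_id) fun p hp => ⟨mem_univ z0, hp⟩
  have h1 : ContinuousWithinAt (fun z : Z × V => S.cone m (η z.1) (G z0) z.2) (univ ×ˢ N) (z0, p0) :=
    ((continuousOn_cone (S := S) hN m hG0) (η z0, p0) ⟨hη0 z0, hp0⟩).tendsto.comp
      (tendsto_nhdsWithin_iff.2 ⟨(((hη.comp continuous_fst).prodMk continuous_snd).tendsto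
        (z0, p0)).mono_left nhdsWithin_le_nhds,
        eventually_mem_nhdsWithin.mono fun z hz => ⟨hη0 z.1, hz.2⟩⟩)
  change Filter.Tendsto _ _ _
  rw [Metric.tendsto_nhds]
  intro ε hε
  have h2 : ∀ᶠ z : Z × V in 𝓝[univ ×ˢ N] (z0, p0), ∀ p ∈ N, ‖G z.1 p - G z0 p‖ < ε / 2 :=
    nhdsWithin_le_nhds ((continuous_fst.tendsto (z0, p0)).eventually
      (eventually_forall_norm_sub_lt hN hG z0 (half_pos hε)))
  filter_upwards [h2, Metric.tendsto_nhds.1 h1.tendsto (ε / 2) (half_pos hε),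
    eventually_mem_nhdsWithin] with z hz1 hz2 hz3
  have h3 := norm_cone_sub_le (S := S) (m := m) (hη0 z.1).1 (by linarith [(hη0 z.1).2])
    (fun p hp => (hz1 p hp).le) z.2 hz3.2
  rw [← dist_eq_norm] at h3
  linarith [dist_triangle (S.cone m (η z.1) (G z.1) z.2) (S.cone m (η z.1) (G z0) z.2)
    (S.cone m (η z0) (G z0) p0)]

end ColoredTriangulation

end ConeContinuity

/-! ### Iterated coning preserves fibrewise injectivity. -/

section ConeIsotopy

/-- `g` separates the points of each fibre of `f` on `N`: this means that `(f, g)` is injective. -/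
def FiberInjOn {V W K : Type*} (f : V → W) (N : Set V) (g : V → K) : Prop :=
  ∀ p ∈ N, ∀ q ∈ N, f p = f q → g p = g q → p = q

namespace ColoredTriangulation

variable {V W K : Type} [NormedAddCommGroup V] [NormedSpace ℝ V]
  [NormedAddCommGroup W] [NormedSpace ℝ W] [NormedAddCommGroup K] [NormedSpace ℝ K]
  {f : V → W} {N : Set V} {S : ColoredTriangulation f N}

/-- Iterated coning along colours `i, …, i + k - 1`. -/
noncomputable def coneIter (S : ColoredTriangulation f N) (η : ℕ → ℝ) : ℕ → ℕ → (V → K) → V → K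
  | _, 0, G => G
  | i, k + 1, G => S.cone i (η i) (coneIter S η (i + 1) k G)

theorem norm_coneIter_sub_le {η : ℕ → ℝ} (hη : ∀ i, η i ∈ Icc (0 : ℝ) (1 / 2)) {r : ℝ} {G G' : V → K}
    (h : ∀ p ∈ N, ‖G p - G' p‖ ≤ r) (i k : ℕ) :
    ∀ p ∈ N, ‖S.coneIter η i k G p - S.coneIter η i k G' p‖ ≤ r := by
  induction k generalizing i with
  | zero => exact h
  | succ k ih => exact norm_cone_sub_le (hη i).1 (by linarith [(hη i).2]) (ih (i + 1))

theorem norm_coneIter_sub_self_le {η : ℕ → ℝ} (hη : ∀ i, η i ∈ Icc (0 : ℝ) (1 / 2)) {r : ℝ} {G : V → K}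
    (i k : ℕ) (h : ∀ j, i ≤ j → ∀ p ∈ N, ‖S.cone j (η j) G p - G p‖ ≤ r) :
    ∀ p ∈ N, ‖S.coneIter η i k G p - G p‖ ≤ k * r := by
  induction k generalizing i with
  | zero => intro p _; simp [coneIter]
  | succ k ih =>
    intro p hp
    have h1 := norm_cone_sub_le (S := S) (m := i) (hη i).1 (by linarith [(hη i).2])
      (ih (i + 1) fun j hj => h j (by omega)) p hp
    have h2 := h i le_rfl p hp
    calc ‖S.coneIter η i (k + 1) G p - G p‖ = ‖(S.cone i (η i) (S.coneIter η (i + 1) k G) p -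
          S.cone i (η i) G p) + (S.cone i (η i) G p - G p)‖ := by rw [sub_add_sub_cancel]; rfl
      _ ≤ k * r + r := (norm_add_le _ _).trans (add_le_add h1 h2)
      _ = (k + 1 : ℕ) * r := by push_cast; ring

theorem coneIter_eqOn_of_zero {η : ℕ → ℝ} (hη : ∀ i, η i ∈ Icc (0 : ℝ) (1 / 2)) (i k : ℕ)
    (h : ∀ j, i ≤ j → η j = 0) (G : V → K) : EqOn (S.coneIter η i k G) G N := by
  intro p hp
  have := norm_coneIter_sub_self_le (S := S) hη (r := 0) (G := G) i k (fun j hj p hp => by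
    rw [h j hj, cone_zero hp]; simp) p hp
  rw [mul_zero] at this
  exact sub_eq_zero.1 (norm_le_zero_iff.1 this)

theorem coneIter_eq_of_affineOnSimplices {N₀ : Set V} {g : V → K} (hS : S.AffineOnSimplices N₀ g)
    (hN₀ : N₀ ⊆ N) {η : ℕ → ℝ} (hη : ∀ i, η i ∈ Icc (0 : ℝ) (1 / 2)) {G : V → K} (hG : EqOn G g N₀)
    (i k : ℕ) : EqOn (S.coneIter η i k G) g N₀ := by
  induction k generalizing i with
  | zero => exact hG
  | succ k ih =>
    exact cone_eq_of_affineOnSimplices hS hN₀ (hη i).1 (by linarith [(hη i).2]) (ih (i + 1))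

theorem continuousOn_coneIter [FiniteDimensional ℝ V] {Z : Type*} [TopologicalSpace Z] (hN : IsCompact N)
    {η : Z → ℕ → ℝ} (hηc : ∀ i, Continuous fun z => η z i)
    (hη : ∀ z i, η z i ∈ Icc (0 : ℝ) (1 / 2)) {G : Z → V → K}
    (hG : ContinuousOn (fun z : Z × V => G z.1 z.2) (univ ×ˢ N)) (i k : ℕ) :
    ContinuousOn (fun z : Z × V => S.coneIter (η z.1) i k (G z.1) z.2) (univ ×ˢ N) := by
  induction k generalizing i with
  | zero => exact hG
  | succ k ih =>
    exact continuousOn_cone_family (S := S) (G := fun z => S.coneIter (η z) (i + 1) k (G z)) hN i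
      (hηc i) (fun z => hη z i) (ih (i + 1))

/-- Coning along colours `< i` keeps pairs of first difference `i` apart. -/
theorem coneIter_ne_of_firstDiff {η : ℕ → ℝ} (hη : ∀ i, η i ∈ Icc (0 : ℝ) (1 / 2)) {G : V → K} (i n : ℕ)
    (hin : i ≤ n) (hbase : ∀ p q, S.FirstDiff i p q → (∀ l < i, η l * S.tau l p ≤ S.tau (l + 1) p) →
      S.coneIter η i (n - i) G p ≠ S.coneIter η i (n - i) G q) (d : ℕ) : ∀ m, m + d = i →
    ∀ p q, S.FirstDiff i p q → (∀ l < m, η l * S.tau l p ≤ S.tau (l + 1) p) →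
      S.coneIter η m (n - m) G p ≠ S.coneIter η m (n - m) G q := by
  induction d with
  | zero =>
    rintro m rfl
    exact hbase
  | succ d ih =>
    intro m hm p q hpq hl
    -- The outermost cone, of colour `m`, is traded for a pair with the same first difference that
    -- satisfies one more share inequality, the one at `m`; the earlier ones survive.
    obtain ⟨w, hw, p', q', hpq', h1, h2, h3⟩ := hpq.exists_cone_sub (K := K) (m := m) (by omega)
      (hη m).1 (by linarith [(hη m).2])
    have hne := ih (m + 1) (by omega) p' q' hpq' fun l hlm => by
      rcases Nat.lt_succ_iff_lt_or_eq.1 hlm with h | rfl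
      · rw [h1 l h.le, h1 (l + 1) h]; exact hl l h
      · exact h2
    rw [show n - m = (n - (m + 1)) + 1 by omega]
    intro heq
    have h4 := h3 (S.coneIter η (m + 1) (n - (m + 1)) G)
    change S.cone m (η m) _ p = S.cone m (η m) _ q at heq
    rw [heq, sub_self, eq_comm, smul_eq_zero] at h4
    exact hne (sub_eq_zero.1 (h4.resolve_left hw.ne'))

/-- The pairs in question form a compact set disjoint from the diagonal, on which `‖g p - g q‖`
attains a positive minimum; if there are none, any bound will do. -/
theorem exists_fiber_lower_bound {L : Type} [NormedAddCommGroup L] [FiniteDimensional ℝ V]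
    (S : ColoredTriangulation f N) (hN : IsCompact N) (hf : ContinuousOn f N) {g : V → L} (hg : ContinuousOn g N)
    (hinj : FiberInjOn f N g) {κ : ℝ} (hκ : 0 < κ) : ∃ b : ℝ, 0 < b ∧ ∀ p ∈ N, ∀ q ∈ N, f p = f q →
      κ ≤ ∑ a, |S.lam a p - S.lam a q| → b ≤ ‖g p - g q‖ := by
  set C : Set (V × V) := {z ∈ N ×ˢ N | f z.1 = f z.2 ∧ κ ≤ ∑ a, |S.lam a z.1 - S.lam a z.2|} with hC
  have h1 : ∀ {X : Type} [TopologicalSpace X] {F : V → X}, ContinuousOn F N →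
      ContinuousOn (fun z : V × V => F z.1) (N ×ˢ N) ∧ ContinuousOn (fun z : V × V => F z.2) (N ×ˢ N) :=
    fun hF => ⟨hF.comp continuousOn_fst fun z hz => hz.1, hF.comp continuousOn_snd fun z hz => hz.2⟩
  have hcl1 : IsClosed ((N ×ˢ N) ∩ (fun z : V × V => f z.1 - f z.2) ⁻¹' {0}) :=
    ((h1 hf).1.sub (h1 hf).2).preimage_isClosed_of_isClosed (hN.prod hN).isClosed isClosed_singleton
  have hcl2 : IsClosed ((N ×ˢ N) ∩ (fun z : V × V => ∑ a, |S.lam a z.1 - S.lam a z.2|) ⁻¹' Ici κ) := by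
    refine ContinuousOn.preimage_isClosed_of_isClosed ?_ (hN.prod hN).isClosed isClosed_Ici
    exact continuousOn_finsetSum _ fun a _ =>
      ((h1 (S.continuousOn_lam a)).1.sub (h1 (S.continuousOn_lam a)).2).abs
  have hCc : IsCompact C := by
    refine (hN.prod hN).of_isClosed_subset ?_ (sep_subset _ _)
    convert hcl1.inter hcl2 using 1
    ext z
    simp only [hC, mem_ofPred_eq, mem_inter_iff, mem_preimage, mem_singleton_iff, sub_eq_zero, mem_Ici]
    tauto
  have hcont : ContinuousOn (fun z : V × V => ‖g z.1 - g z.2‖) C :=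
    (((h1 hg).1.sub (h1 hg).2).norm).mono (sep_subset _ _)
  rcases C.eq_empty_or_nonempty with h0 | hne
  · refine ⟨1, one_pos, fun p hp q hq hpq hk => ?_⟩
    have : (p, q) ∈ C := ⟨⟨hp, hq⟩, hpq, hk⟩
    rw [h0] at this
    exact this.elim
  · obtain ⟨⟨p0, q0⟩, ⟨⟨hp0, hq0⟩, hfpq, hk⟩, hmin⟩ := hCc.exists_isMinOn hne hcont
    refine ⟨‖g p0 - g q0‖, norm_pos_iff.2 (sub_ne_zero.2 fun h => ?_), fun p hp q hq hpq hk' =>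
      hmin (a := (p, q)) ⟨⟨hp, hq⟩, hpq, hk'⟩⟩
    have := hinj p0 hp0 q0 hq0 hfpq h
    dsimp only at hk
    rw [this] at hk
    simp at hk
    linarith

/-- The coned value averages values of `g` within distance `2 s * vertexBound`, so uniform
continuity suffices. -/
theorem exists_cone_small (S : ColoredTriangulation f N) (hN : IsCompact N) {g : V → K}
    (hg : ContinuousOn g N) (m : ℕ) {r : ℝ} (hr : 0 < r) : ∃ η : ℝ, 0 < η ∧ η ≤ 1 / 2 ∧
      ∀ s, 0 ≤ s → s ≤ η → ∀ p ∈ N, ‖S.cone m s g p - g p‖ ≤ r := by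
  have huc := hN.uniformContinuousOn_of_continuous hg
  obtain ⟨d, hd, h⟩ := Metric.uniformContinuousOn_iff.1 huc r hr
  have hB := S.vertexBound_nonneg
  refine ⟨min (1 / 2) (d / (2 * (S.vertexBound + 1))), by positivity, min_le_left _ _,
    fun s hs0 hs p hp => ?_⟩
  have hs1 := hs.trans (min_le_left _ _)
  have hs2 := hs.trans (min_le_right _ _)
  refine norm_cone_sub_const_le hp hs0 (by linarith) fun q hq hqp => ?_
  rw [← dist_eq_norm] at hqp ⊢
  refine (h q hq p hp (hqp.trans_lt ?_)).le
  rw [le_div_iff₀ (by positivity)] at hs2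
  have hτ := tau_le_one (S := S) hp m
  have hτ0 := tau_nonneg (S := S) hp m
  rcases hs0.eq_or_lt with h0 | h0
  · rw [← h0]; simpa using hd
  · have : s * S.tau m p ≤ s := by nlinarith
    nlinarith

/-- Scales `η` for which coning is harmless. -/
structure GoodScales (S : ColoredTriangulation f N) (n : ℕ) (g : V → K) (ε δ : ℝ) (η : ℕ → ℝ) : Prop where
  mem : ∀ i, η i ∈ Icc (0 : ℝ) (1 / 2)
  eps : ∀ i s, 0 ≤ s → s ≤ η i → ∀ p ∈ N, n * ‖S.cone i s g p - g p‖ ≤ ε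
  sep : ∀ i ≤ n, ∃ b : ℝ, 4 * δ < b ∧
    (∀ j, i ≤ j → ∀ s, 0 ≤ s → s ≤ η j → ∀ p ∈ N, 8 * (n * ‖S.cone j s g p - g p‖) ≤ b) ∧
    ∀ p q, S.FirstDiff i p q → (∀ l < i, η l * S.tau l p ≤ S.tau (l + 1) p) → b ≤ ‖g p - g q‖

/-- The order of choices matters. The scales of colours `< i` bound `tau i` from below by their
product for the pairs of first difference `i` under consideration, which gives a gap for `g`. Only
then is the scale of colour `i` chosen, small against all gaps so far; `δ` comes last. -/
theorem exists_goodScales [FiniteDimensional ℝ V] (S : ColoredTriangulation f N)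
    (hN : IsCompact N) (hf : ContinuousOn f N) {g : V → K} (hg : ContinuousOn g N)
    (hinj : FiberInjOn f N g) (n : ℕ) {ε : ℝ} (hε : 0 < ε) :
    ∃ δ > 0, ∃ η : ℕ → ℝ, S.GoodScales n g ε δ η := by
  have hLB := fun (κ : ℝ) (hκ : 0 < κ) => S.exists_fiber_lower_bound hN hf hg hinj hκ
  choose! B hB0 hB using hLB
  have hsm := fun (m : ℕ) (r : ℝ) (hr : 0 < r) => S.exists_cone_small hN hg m hr
  choose! e he0 he1 he using hsm
  -- state: a lower bound for `tau i` and the current bound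
  let st : ℕ → ℝ × ℝ := fun i => Nat.rec (1, min ε (B 1)) (fun i z =>
    (z.1 * e i (z.2 / (8 * (n + 1))), min z.2 (B (z.1 * e i (z.2 / (8 * (n + 1))))))) i
  have st0 : st 0 = (1, min ε (B 1)) := rfl
  have sts : ∀ i, st (i + 1) = ((st i).1 * e i ((st i).2 / (8 * (n + 1))),
    min (st i).2 (B ((st i).1 * e i ((st i).2 / (8 * (n + 1)))))) := fun i => rfl
  have hn0 : (0 : ℝ) < 8 * (n + 1) := by positivity
  have hpos : ∀ i, 0 < (st i).1 ∧ 0 < (st i).2 ∧ (st i).2 ≤ B (st i).1 := by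
    intro i
    induction i with
    | zero => rw [st0]; exact ⟨one_pos, lt_min hε (hB0 1 one_pos), min_le_right _ _⟩
    | succ i ih =>
      rw [sts]
      have h1 : 0 < (st i).1 * e i ((st i).2 / (8 * (n + 1))) :=
        mul_pos ih.1 (he0 i _ (div_pos ih.2.1 hn0))
      exact ⟨h1, lt_min ih.2.1 (hB0 _ h1), min_le_right _ _⟩
  have hanti : ∀ i j, i ≤ j → (st j).2 ≤ (st i).2 := by
    intro i j hij
    induction j, hij using Nat.le_induction with
    | base => exact le_rfl
    | succ j _ ih => exact (by rw [sts]; exact min_le_left _ _ : (st (j + 1)).2 ≤ (st j).2).trans ih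
  have hle : ∀ i, (st i).2 ≤ ε := fun i => (hanti 0 i (Nat.zero_le i)).trans (min_le_left _ _)
  set η : ℕ → ℝ := fun i => e i ((st i).2 / (8 * (n + 1))) with hη
  have hη0 : ∀ i, 0 < η i := fun i => he0 i _ (div_pos (hpos i).2.1 hn0)
  have hcone : ∀ i s, 0 ≤ s → s ≤ η i → ∀ p ∈ N, 8 * (n * ‖S.cone i s g p - g p‖) ≤ (st i).2 := by
    intro i s h0 h1 p hp
    -- The tolerance `(st i).2 / (8 * (n + 1))` is such that `n` cones together move `g` by at most
    -- an eighth of the gap.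
    have := he i _ (div_pos (hpos i).2.1 hn0) s h0 h1 p hp
    rw [le_div_iff₀ hn0] at this
    nlinarith [norm_nonneg (S.cone i s g p - g p)]
  refine ⟨(st n).2 / 8, by linarith [(hpos n).2.1], η, fun i => ⟨(hη0 i).le, he1 i _ (div_pos (hpos i).2.1 hn0)⟩,
    fun i s h0 h1 p hp => ?_, fun i hi => ⟨(st i).2, ?_, ?_, ?_⟩⟩
  · have := hcone i s h0 h1 p hp
    have h2 := hle i
    have h3 : 0 ≤ n * ‖S.cone i s g p - g p‖ := by positivity
    linarith
  · have := hanti i n hi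
    have := (hpos n).2.1
    linarith
  · exact fun j hij s h0 h1 p hp => (hcone j s h0 h1 p hp).trans (hanti i j hij)
  · intro p q hpq hl
    have hκ : ∀ l ≤ i, (st l).1 ≤ S.tau l p := by
      intro l
      induction l with
      | zero => intro _; rw [st0, tau_zero hpq.left_mem]
      | succ l ih =>
        intro hli
        refine le_trans ?_ (hl l hli)
        rw [sts, mul_comm]
        exact mul_le_mul_of_nonneg_left (ih (by omega)) (hη0 l).le
    exact (hpos i).2.2.trans (hB _ (hpos i).1 p hpq.left_mem q hpq.right_mem hpq.image_eq
      ((hκ i le_rfl).trans hpq.tau_le_sum))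

/-- Coning with good scales, fully used for colours `< j`, partially for `j` and not at all for
colours `> j`, preserves fibrewise injectivity. -/
theorem GoodScales.fiberInjOn {n : ℕ} {g : V → K} {ε δ : ℝ} {η η' : ℕ → ℝ}
    (h : S.GoodScales n g ε δ η) (hn : ∀ a, S.c a ≤ n) (j : ℕ) (hlt : ∀ l < j, η' l = η l)
    (hle : ∀ l, 0 ≤ η' l ∧ η' l ≤ η l) (hgt : ∀ l, j < l → η' l = 0) {G : V → K}
    (hG : ∀ p ∈ N, ‖G p - g p‖ ≤ δ) (hj : n ≤ j ∨ FiberInjOn f N G) :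
    FiberInjOn f N (S.coneIter η' 0 n G) := by
  intro p hp q hq hpq heq
  by_contra hne
  obtain ⟨i, hi, a, ha⟩ := S.exists_firstDiff hp hq hpq hne
  have hin : i ≤ n := ha ▸ hn a
  have hη' : ∀ i, η' i ∈ Icc (0 : ℝ) (1 / 2) := fun i => ⟨(hle i).1, (hle i).2.trans (h.mem i).2⟩
  refine coneIter_ne_of_firstDiff (S := S) (G := G) hη' i n hin ?_ i 0 (by omega) p q hi
    (fun l hl => absurd hl (Nat.not_lt_zero l)) heq
  intro p q hpq' hl
  rcases le_or_gt i j with hij | hij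
  -- All scales below `i` are fully on, so the pair has gap `b` for `g`. The remaining cones and the
  -- passage from `g` to `G` move each value by at most `δ + b / 8`, and `2 (δ + b / 8) < b`.
  · obtain ⟨b, hb, hsm, hsep⟩ := h.sep i hin
    have h1 := hsep p q hpq' fun l hli => by
      rw [← hlt l (by omega)]; exact hl l hli
    have hδ : 0 ≤ δ := (norm_nonneg _).trans (hG p hpq'.left_mem)
    have hnear : ∀ r ∈ N, ‖S.coneIter η' i (n - i) G r - g r‖ ≤ δ + b / 8 := by
      intro r hr
      have h2 := norm_coneIter_sub_le (S := S) hη' hG i (n - i) r hr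
      have h3 : ‖S.coneIter η' i (n - i) g r - g r‖ ≤ b / 8 := by
        -- The tolerance `b / (8 * n)` used below needs `n ≠ 0`; for `n = 0` no cone is applied.
        rcases Nat.eq_zero_or_pos n with hn0 | hn0
        · have : n - i = 0 := by omega
          rw [this]
          simp only [coneIter, sub_self, norm_zero]
          linarith
        have hn' : (0 : ℝ) < n := by exact_mod_cast hn0
        have h4 := norm_coneIter_sub_self_le (S := S) hη' (r := b / (8 * n)) (G := g) i (n - i)
          (fun l hl r hr => by
            rw [le_div_iff₀ (by positivity)]
            have := hsm l hl (η' l) (hle l).1 (hle l).2 r hr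
            linarith) r hr
        refine h4.trans ?_
        rw [mul_div_assoc', div_le_div_iff₀ (by positivity) (by norm_num)]
        have h5 : ((n - i : ℕ) : ℝ) ≤ n := by exact_mod_cast Nat.sub_le n i
        have hb0 : 0 < b := by linarith
        nlinarith [mul_le_mul_of_nonneg_right h5 hb0.le]
      calc ‖S.coneIter η' i (n - i) G r - g r‖ = ‖(S.coneIter η' i (n - i) G r - S.coneIter η' i (n - i) g r) +
            (S.coneIter η' i (n - i) g r - g r)‖ := by rw [sub_add_sub_cancel]
        _ ≤ δ + b / 8 := (norm_add_le _ _).trans (add_le_add h2 h3)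
    intro heq'
    have e1 := hnear p hpq'.left_mem
    have e2 := hnear q hpq'.right_mem
    rw [heq'] at e1
    have : ‖g p - g q‖ ≤ (δ + b / 8) + (δ + b / 8) := by
      rw [← dist_eq_norm] at e1 e2 ⊢
      calc dist (g p) (g q) ≤ dist (g p) _ + dist _ (g q) := dist_triangle _ _ _
        _ ≤ _ := add_le_add (by rwa [dist_comm]) e2
    linarith
  -- No cone of colour `≥ i` is active, so what remains is `G` itself, which is injective on fibres.
  · have hGinj := hj.resolve_left (by omega)
    have hz := coneIter_eqOn_of_zero (S := S) hη' i (n - i) (fun l hl => hgt l (by omega)) G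
    rw [hz hpq'.left_mem, hz hpq'.right_mem]
    intro heq'
    have := hGinj p hpq'.left_mem q hpq'.right_mem hpq'.image_eq heq'
    have h3 := hpq'.tau_le_sum
    rw [this] at h3
    simp only [sub_self, abs_zero, Finset.sum_const_zero] at h3
    have h4 := hpq'.tau_pos
    rw [this] at h4
    linarith

/-- The scales used at time `t`: they are switched on one after the other. -/
noncomputable def scalesAt (η : ℕ → ℝ) (n : ℕ) (t : ℝ) (i : ℕ) : ℝ := η i * max 0 (min 1 (n * t - i))

theorem GoodScales.fiberInjOn_scalesAt {n : ℕ} {g : V → K} {ε δ : ℝ} {η : ℕ → ℝ}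
    (h : S.GoodScales n g ε δ η) (hn : ∀ a, S.c a ≤ n) {t : ℝ} (ht : t ∈ Icc (0 : ℝ) 1) {G : V → K}
    (hG : ∀ p ∈ N, ‖G p - g p‖ ≤ δ) (hj : t = 1 ∨ FiberInjOn f N G) :
    FiberInjOn f N (S.coneIter (scalesAt η n t) 0 n G) := by
  have hnt : (0 : ℝ) ≤ n * t := mul_nonneg (Nat.cast_nonneg n) ht.1
  -- At time `t` the colours below `⌊n t⌋` are fully switched on and those above it are off.
  refine h.fiberInjOn hn ⌊n * t⌋₊ (fun l hl => ?_) (fun l => ?_) (fun l hl => ?_) hG ?_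
  · have : (l : ℝ) + 1 ≤ n * t := by
      have := Nat.floor_le hnt
      have h2 : ((l + 1 : ℕ) : ℝ) ≤ (⌊n * t⌋₊ : ℕ) := by exact_mod_cast hl
      push_cast at h2
      linarith
    rw [scalesAt, min_eq_left (by linarith), max_eq_right zero_le_one, mul_one]
  · exact ⟨mul_nonneg (h.mem l).1 (le_max_left _ _),
      mul_le_of_le_one_right (h.mem l).1 (max_le zero_le_one (min_le_left _ _))⟩
  · have := Nat.lt_floor_add_one (n * t)
    have h2 : ((⌊n * t⌋₊ + 1 : ℕ) : ℝ) ≤ l := by exact_mod_cast hl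
    push_cast at h2
    rw [scalesAt, max_eq_left ((min_le_right _ _).trans (by linarith)), mul_zero]
  · exact hj.imp (fun h1 => by rw [h1, mul_one, Nat.floor_natCast]) id

theorem scalesAt_mem {η : ℕ → ℝ} (hη : ∀ i, η i ∈ Icc (0 : ℝ) (1 / 2)) (n : ℕ) (t : ℝ) (i : ℕ) :
    scalesAt η n t i ∈ Icc (0 : ℝ) (1 / 2) :=
  ⟨mul_nonneg (hη i).1 (le_max_left _ _),
    (mul_le_of_le_one_right (hη i).1 (max_le zero_le_one (min_le_left _ _))).trans (hη i).2⟩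

theorem continuous_scalesAt (η : ℕ → ℝ) (n i : ℕ) : Continuous fun t => scalesAt η n t i := by
  unfold scalesAt
  fun_prop

theorem GoodScales.norm_coneIter_scalesAt_le {n : ℕ} {g : V → K} {ε δ : ℝ} {η : ℕ → ℝ}
    (h : S.GoodScales n g ε δ η) (hε : 0 ≤ ε) (t : ℝ) {G : V → K} (hG : ∀ p ∈ N, ‖G p - g p‖ ≤ δ) :
    ∀ p ∈ N, ‖S.coneIter (scalesAt η n t) 0 n G p - g p‖ ≤ δ + ε := by
  intro p hp
  have hη' := scalesAt_mem h.mem n t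
  have h2 := norm_coneIter_sub_le (S := S) hη' hG 0 n p hp
  have h3 : ‖S.coneIter (scalesAt η n t) 0 n g p - g p‖ ≤ ε := by
    rcases Nat.eq_zero_or_pos n with hn0 | hn0
    · rw [hn0]
      simpa [coneIter] using hε
    have hn' : (0 : ℝ) < n := by exact_mod_cast hn0
    have h4 := norm_coneIter_sub_self_le (S := S) hη' (r := ε / n) (G := g) 0 n
      (fun l hl r hr => by
        rw [le_div_iff₀ hn']
        have := h.eps l (scalesAt η n t l) (hη' l).1 (mul_le_of_le_one_right (h.mem l).1
          (max_le zero_le_one (min_le_left _ _))) r hr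
        linarith) p hp
    rwa [mul_div_cancel₀ _ hn'.ne'] at h4
  calc ‖S.coneIter (scalesAt η n t) 0 n G p - g p‖ = ‖(S.coneIter (scalesAt η n t) 0 n G p -
        S.coneIter (scalesAt η n t) 0 n g p) + (S.coneIter (scalesAt η n t) 0 n g p - g p)‖ := by
          rw [sub_add_sub_cancel]
    _ ≤ δ + ε := (norm_add_le _ _).trans (add_le_add h2 h3)

end ColoredTriangulation

end ConeIsotopy

/-! ### Mean-preserving rounding of decreasing sequences. -/

section Rounding

/-- Heights for the graded rounding of a decreasing sequence `x`. -/
noncomputable def roundHeight (κ x : ℕ → ℝ) : ℕ → ℝ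
  | 0 => 1
  | i + 1 => min (roundHeight κ x i) (x (i + 1) / κ (i + 1))

/-- The thresholds below which the parameter has to be for the `k`-th unit to be counted. -/
noncomputable def roundThreshold (κ x : ℕ → ℝ) (R : ℕ) (z : ℕ × ℕ) : ℝ :=
  max 0 (min (roundHeight κ x z.1) (R * x z.1 - z.2 * roundHeight κ x z.1))

/-- The summands are the slices into which the multiples of `h` cut `min X (R * h)`. -/
theorem sum_clamp {h X : ℝ} (hh : 0 ≤ h) (hX : 0 ≤ X) (R : ℕ) :
    ∑ k ∈ Finset.range R, max 0 (min h (X - k * h)) = min X (R * h) := by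
  induction R with
  | zero => simp [hX]
  | succ R ih =>
    rw [Finset.sum_range_succ, ih]
    push_cast
    rcases le_total X (R * h) with h1 | h1
    · rw [min_eq_left h1, min_eq_right (by linarith), max_eq_left (by linarith), min_eq_left (by linarith)]
      ring
    · rw [min_eq_right h1]
      rcases le_total h (X - R * h) with h2 | h2
      · rw [min_eq_left h2, max_eq_right hh, min_eq_right (by linarith)]; ring
      · rw [min_eq_right h2, max_eq_right (by linarith), min_eq_left (by linarith)]; ring

theorem abs_card_clamp_sub_le {h X s : ℝ} (hs : 0 ≤ s) (hsh : s < h) {R : ℕ} (hX : 0 ≤ X) (hXR : X ≤ R * h) :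
    |(((Finset.range R).filter fun k : ℕ => s < max 0 (min h (X - k * h))).card : ℝ) - X / h| ≤ 1 := by
  have hh : 0 < h := hs.trans_lt hsh
  -- Because `0 ≤ s < h`, the condition says `k < (X - s) / h`, so the counted indices are an
  -- initial segment.
  have h1 : ((Finset.range R).filter fun k : ℕ => s < max 0 (min h (X - k * h))) =
      Finset.range (min R ⌈(X - s) / h⌉₊) := by
    ext k
    simp only [Finset.mem_filter, Finset.mem_range, lt_max_iff, hs.not_gt, false_or, lt_min_iff, hsh,
      true_and, Nat.lt_ceil, lt_div_iff₀ hh]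
    constructor <;> rintro ⟨a, b⟩ <;> exact ⟨a, by linarith⟩
  rw [h1, Finset.card_range, abs_le]
  have h2 : X / h ≤ R := by rwa [div_le_iff₀ hh]
  have h3 : (X - s) / h ≤ ⌈(X - s) / h⌉₊ := Nat.le_ceil _
  have h4 : X / h - 1 ≤ (X - s) / h := by
    rw [sub_div]
    have : s / h ≤ 1 := by rw [div_le_one hh]; exact hsh.le
    linarith
  have h5 : (X - s) / h ≤ X / h := by gcongr; linarith
  have h6 : 0 ≤ X / h := by positivity
  rw [Nat.cast_min]
  constructor
  · have : X / h - 1 ≤ min (R : ℝ) (⌈(X - s) / h⌉₊ : ℕ) := le_min (by linarith) (by linarith)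
    linarith
  · have : ((⌈(X - s) / h⌉₊ : ℕ) : ℝ) ≤ X / h + 1 := by
      rcases le_or_gt 0 ((X - s) / h) with h7 | h7
      · linarith [Nat.ceil_lt_add_one h7]
      · rw [Nat.ceil_eq_zero.2 h7.le]; push_cast; linarith
    linarith [min_le_right (R : ℝ) (⌈(X - s) / h⌉₊ : ℕ)]

/-- The rounded value of `x j` at the parameter `s`. -/
noncomputable def roundValue (κ x : ℕ → ℝ) (R : ℕ) (s : ℝ) (j : ℕ) : ℝ :=
  ((Finset.range R).filter fun k : ℕ => s < roundThreshold κ x R (j, k)).card / R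

/-- The hypotheses under which rounding is well behaved. -/
structure RoundData (κ x : ℕ → ℝ) (n R : ℕ) : Prop where
  zero : x 0 = 1
  anti : Antitone x
  nonneg : ∀ j, 0 ≤ x j
  eq_zero : ∀ j, n < j → x j = 0
  κ_zero : κ 0 = 1
  κ_pos : ∀ j, 0 < κ j
  κ_half : ∀ j, κ (j + 1) ≤ κ j / 2
  R_pos : 0 < R
  R_large : ∀ j ≤ n, 4 / (R : ℝ) ≤ κ j

theorem roundHeight_antitone (κ x : ℕ → ℝ) : Antitone (roundHeight κ x) :=
  antitone_nat_of_succ_le fun _ => min_le_left _ _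

theorem roundThreshold_nonneg (κ x : ℕ → ℝ) (R : ℕ) (z : ℕ × ℕ) : 0 ≤ roundThreshold κ x R z :=
  le_max_left _ _

namespace RoundData

variable {κ x : ℕ → ℝ} {n R : ℕ} {s : ℝ}

theorem height_nonneg (h : RoundData κ x n R) (j : ℕ) : 0 ≤ roundHeight κ x j := by
  induction j with
  | zero => exact zero_le_one
  | succ j ih => exact le_min ih (div_nonneg (h.nonneg _) (h.κ_pos _).le)

theorem κ_anti (h : RoundData κ x n R) : Antitone κ :=
  antitone_nat_of_succ_le fun j => (h.κ_half j).trans (by linarith [h.κ_pos j])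

theorem κ_le_one (h : RoundData κ x n R) (j : ℕ) : κ j ≤ 1 := h.κ_zero ▸ h.κ_anti (Nat.zero_le j)

theorem le_height (h : RoundData κ x n R) (j : ℕ) : x j ≤ roundHeight κ x j := by
  induction j with
  | zero => exact h.zero.le
  | succ j ih =>
    refine le_min ((h.anti j.le_succ).trans ih) ?_
    rw [le_div_iff₀ (h.κ_pos _)]
    exact mul_le_of_le_one_right (h.nonneg _) (h.κ_le_one _)

theorem mul_height_le (h : RoundData κ x n R) (j : ℕ) : κ j * roundHeight κ x j ≤ x j := by
  cases j with
  | zero => rw [h.κ_zero, h.zero, one_mul]; exact le_rfl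
  | succ j =>
    have : roundHeight κ x (j + 1) ≤ x (j + 1) / κ (j + 1) := min_le_right _ _
    rwa [le_div_iff₀ (h.κ_pos _), mul_comm] at this

theorem threshold_le_height (h : RoundData κ x n R) (j k : ℕ) :
    roundThreshold κ x R (j, k) ≤ roundHeight κ x j :=
  max_le (h.height_nonneg j) (min_le_left _ _)

theorem threshold_le_one (h : RoundData κ x n R) (z : ℕ × ℕ) : roundThreshold κ x R z ≤ 1 :=
  (h.threshold_le_height z.1 z.2).trans (roundHeight_antitone κ x (Nat.zero_le _))

/-- For `s` uniform in `[0, 1)` the unit `k` is counted with probability equal to its threshold;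
this identity therefore says that rounding preserves the mean. -/
theorem sum_threshold (h : RoundData κ x n R) (j : ℕ) :
    ∑ k ∈ Finset.range R, roundThreshold κ x R (j, k) = R * x j := by
  refine (sum_clamp (h.height_nonneg j) (mul_nonneg R.cast_nonneg (h.nonneg j)) R).trans ?_
  exact min_eq_left (mul_le_mul_of_nonneg_left (h.le_height j) R.cast_nonneg)

theorem roundValue_eq_zero (h : RoundData κ x n R) {j : ℕ} (hs : roundHeight κ x j ≤ s) :
    roundValue κ x R s j = 0 := by
  rw [roundValue, Finset.filter_false_of_mem, Finset.card_empty, Nat.cast_zero, zero_div]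
  exact fun k _ => not_lt.2 ((h.threshold_le_height j k).trans hs)

theorem roundValue_nonneg (κ x : ℕ → ℝ) (R : ℕ) (s : ℝ) (j : ℕ) : 0 ≤ roundValue κ x R s j := by
  unfold roundValue; positivity

/-- The meaning of the height: below it `x j` is magnified by the inverse of the height and rounded
to a multiple of `1 / R`, above it `x j` is replaced by zero. A tiny value becomes, with small
probability, a value of size about `κ j`, and is otherwise zero. -/
theorem abs_roundValue_sub_le (h : RoundData κ x n R) (hs : 0 ≤ s) {j : ℕ} (hsj : s < roundHeight κ x j) :
    |roundValue κ x R s j - x j / roundHeight κ x j| ≤ 1 / R := by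
  have hR : (0 : ℝ) < R := by exact_mod_cast h.R_pos
  have := abs_card_clamp_sub_le hs hsj (R := R) (mul_nonneg hR.le (h.nonneg j))
    (mul_le_mul_of_nonneg_left (h.le_height j) hR.le)
  rw [roundValue, show x j / roundHeight κ x j = (R * x j / roundHeight κ x j) / R by field_simp,
    ← sub_div, abs_div, abs_of_pos hR]
  exact div_le_div_of_nonneg_right this hR.le

theorem height_succ_eq_or (h : RoundData κ x n R) (j : ℕ) : roundHeight κ x (j + 1) = roundHeight κ x j ∨
    x (j + 1) = κ (j + 1) * roundHeight κ x (j + 1) := by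
  rcases min_choice (roundHeight κ x j) (x (j + 1) / κ (j + 1)) with h1 | h1
  · exact Or.inl h1
  · right
    rw [show roundHeight κ x (j + 1) = _ from h1, mul_div_cancel₀ _ (h.κ_pos _).ne']

theorem roundValue_zero (h : RoundData κ x n R) (hs : s < 1) : roundValue κ x R s 0 = 1 := by
  have hR : (0 : ℝ) < R := by exact_mod_cast h.R_pos
  rw [roundValue, Finset.filter_true_of_mem, Finset.card_range, div_self hR.ne']
  intro k hk
  have : (k : ℝ) + 1 ≤ R := by exact_mod_cast Finset.mem_range.1 hk
  refine lt_max_of_lt_right (lt_min hs ?_)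
  simp only [h.zero, roundHeight]
  linarith

theorem roundValue_of_lt (h : RoundData κ x n R) (hs : 0 ≤ s) {j : ℕ} (hj : n < j) :
    roundValue κ x R s j = 0 := by
  rw [roundValue, Finset.filter_false_of_mem, Finset.card_empty, Nat.cast_zero, zero_div]
  intro k _
  refine not_lt.2 ((max_le le_rfl ((min_le_right _ _).trans ?_)).trans hs)
  rw [h.eq_zero j hj]
  have := mul_nonneg (k.cast_nonneg (α := ℝ)) (h.height_nonneg j)
  simp only
  linarith

/-- This guarantees that colours absent from a point receive no weight from rounding, so that the
rounded point stays in the same simplex. -/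
theorem roundValue_succ_eq (h : RoundData κ x n R) {j : ℕ} (hj : x (j + 1) = x j) :
    roundValue κ x R s (j + 1) = roundValue κ x R s j := by
  have : roundHeight κ x (j + 1) = roundHeight κ x j := by
    refine min_eq_left ?_
    rw [le_div_iff₀ (h.κ_pos _), hj, mul_comm]
    exact (mul_le_mul_of_nonneg_right (h.κ_anti j.le_succ) (h.height_nonneg j)).trans (h.mul_height_le j)
  have h2 : ∀ k, roundThreshold κ x R (j + 1, k) = roundThreshold κ x R (j, k) := fun k => by
    simp only [roundThreshold, this, hj]
  unfold roundValue
  rw [Finset.filter_congr fun k _ => by rw [h2 k]]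

/-- If the heights agree, the thresholds compare directly. If not, the magnified `x (j + 1)` equals
`κ (j + 1) ≤ κ j / 2` while the magnified `x j` is at least `κ j`, and the rounding errors `2 / R ≤
κ j / 2` do not close the gap. -/
theorem roundValue_succ_le (h : RoundData κ x n R) (hs : 0 ≤ s) (j : ℕ) :
    roundValue κ x R s (j + 1) ≤ roundValue κ x R s j := by
  have hR : (0 : ℝ) < R := by exact_mod_cast h.R_pos
  rcases le_or_gt j n with hjn | hjn
  swap
  · rw [h.roundValue_of_lt hs (hjn.trans j.lt_succ_self)]
    exact roundValue_nonneg _ _ _ _ _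
  rcases h.height_succ_eq_or j with h1 | h1
  · refine div_le_div_of_nonneg_right ?_ hR.le
    norm_cast
    refine Finset.card_le_card fun k hk => ?_
    rw [Finset.mem_filter] at hk ⊢
    refine ⟨hk.1, hk.2.trans_le ?_⟩
    simp only [roundThreshold, h1]
    refine max_le_max le_rfl (min_le_min le_rfl (sub_le_sub_right ?_ _))
    exact mul_le_mul_of_nonneg_left (h.anti j.le_succ) hR.le
  · rcases le_or_gt (roundHeight κ x (j + 1)) s with h2 | h2
    · rw [h.roundValue_eq_zero h2]
      exact roundValue_nonneg _ _ _ _ _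
    · have h3 := h2.trans_le (roundHeight_antitone κ x j.le_succ)
      have a1 := (abs_le.1 (h.abs_roundValue_sub_le hs h2)).2
      have a2 := (abs_le.1 (h.abs_roundValue_sub_le hs h3)).1
      have a3 : x (j + 1) / roundHeight κ x (j + 1) = κ (j + 1) := by
        rw [h1, mul_div_cancel_right₀ _ (hs.trans_lt h2).ne']
      have a4 : κ j ≤ x j / roundHeight κ x j := by
        rw [le_div_iff₀ (hs.trans_lt h3)]
        exact h.mul_height_le j
      have a5 := h.R_large j hjn
      have a6 := h.κ_half j
      have a7 : 4 / (R : ℝ) = 4 * (1 / R) := by ring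
      have a8 : (0 : ℝ) < 1 / R := by positivity
      linarith

theorem lt_height_of_roundValue_pos (h : RoundData κ x n R) {i : ℕ} (hi : 0 < roundValue κ x R s i) :
    s < roundHeight κ x i := by
  by_contra! h1
  rw [h.roundValue_eq_zero h1] at hi
  exact lt_irrefl _ hi

/-- Nonzero rounded values are bounded below. -/
theorem half_le_roundValue (h : RoundData κ x n R) (hs : 0 ≤ s) {i : ℕ} (hin : i ≤ n)
    (hi : 0 < roundValue κ x R s i) : κ i / 2 ≤ roundValue κ x R s i := by
  have hR : (0 : ℝ) < R := by exact_mod_cast h.R_pos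
  have h1 := h.lt_height_of_roundValue_pos hi
  have a1 := (abs_le.1 (h.abs_roundValue_sub_le hs h1)).1
  have a4 : κ i ≤ x i / roundHeight κ x i := by
    rw [le_div_iff₀ (hs.trans_lt h1)]
    exact h.mul_height_le i
  have a5 := h.R_large i hin
  have a7 : 4 / (R : ℝ) = 4 * (1 / R) := by ring
  have a8 : (0 : ℝ) < 1 / R := by positivity
  linarith

/-- The rounded values with nonzero `i`-th entry are close to each other. -/
theorem abs_roundValue_sub_center_le (h : RoundData κ x n R) (hs : 0 ≤ s) {i : ℕ}
    (hi : s < roundHeight κ x i) (j : ℕ) :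
    |roundValue κ x R s j - x j / roundHeight κ x (min i j)| ≤ κ (i + 1) + 1 / R := by
  have hκ := h.κ_pos (i + 1)
  rcases le_total j i with hji | hij
  · rw [min_eq_right hji]
    exact (h.abs_roundValue_sub_le hs (hi.trans_le (roundHeight_antitone κ x hji))).trans (by linarith)
  · rw [min_eq_left hij]
    -- Either the height has not dropped since `i`, and the estimate at `j` itself applies, or it
    -- has, and both quantities compared are small.
    have key : roundHeight κ x j = roundHeight κ x i ∨ x j ≤ κ (i + 1) * roundHeight κ x j := by
      induction j, hij using Nat.le_induction with
      | base => exact Or.inl rfl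
      | succ j hij ih =>
        rcases h.height_succ_eq_or j with h1 | h1
        · rw [h1]
          exact ih.imp_right (h.anti j.le_succ).trans
        · right
          conv_lhs => rw [h1]
          exact mul_le_mul_of_nonneg_right (h.κ_anti (by omega)) (h.height_nonneg _)
    have hi0 := hs.trans_lt hi
    rcases key with h1 | h1
    · rw [← h1]
      exact (h.abs_roundValue_sub_le hs (h1 ▸ hi)).trans (by linarith)
    · have h2 : 0 ≤ x j / roundHeight κ x i := div_nonneg (h.nonneg j) hi0.le
      have h3 : x j / roundHeight κ x i ≤ κ (i + 1) := by
        rw [div_le_iff₀ hi0]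
        exact h1.trans (mul_le_mul_of_nonneg_left (roundHeight_antitone κ x hij) hκ.le)
      have hR : (0 : ℝ) ≤ 1 / R := by positivity
      rcases le_or_gt (roundHeight κ x j) s with h4 | h4
      · rw [h.roundValue_eq_zero h4, abs_le]
        constructor <;> linarith
      · have a1 := (abs_le.1 (h.abs_roundValue_sub_le hs h4)).2
        have a2 : x j / roundHeight κ x j ≤ κ (i + 1) := by
          rwa [div_le_iff₀ (hs.trans_lt h4)]
        have a3 := roundValue_nonneg κ x R s j
        rw [abs_le]
        constructor <;> linarith

end RoundData

end Rounding

/-! ### Probabilities of rounding patterns as PL functions. -/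

section ThresholdKernel

variable {V : Type} [NormedAddCommGroup V] [NormedSpace ℝ V] {ι : Type}

open MeasureTheory

/-- The parameters in `[0,1)` lying below exactly those thresholds that are indexed by `A`. -/
def thresholdSet (β : ι → ℝ) (I A : Finset ι) : Set ℝ := {s ∈ Ico (0 : ℝ) 1 | ∀ i ∈ I, s < β i ↔ i ∈ A}

/-- The weight of the pattern `A`. -/
noncomputable def thresholdWeight (β : ι → ℝ) (I A : Finset ι) : ℝ := volume.real (thresholdSet β I A)

/-- Each condition `s < β i`, or its negation, cuts the interval from one side, so the endpoints are
minima and maxima of PL functions. -/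
theorem thresholdSet_eq_Ico [FiniteDimensional ℝ V] {N : Set V} (hN : IsCompactPolyhedron N) {β : V → ι → ℝ}
    (I A : Finset ι) (hβ : ∀ i ∈ I, IsCompactPL (fun p => β p i) N) : ∃ lo hi : V → ℝ, IsCompactPL lo N ∧
      IsCompactPL hi N ∧ ∀ p, thresholdSet (β p) I A = Ico (lo p) (hi p) := by
  classical
  induction I using Finset.induction_on with
  | empty => exact ⟨fun _ => 0, fun _ => 1, hN.isCompactPL_const 0, hN.isCompactPL_const 1, fun p => by
      ext s; simp [thresholdSet]⟩
  | insert i I _ ih =>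
    obtain ⟨lo, hi, h1, h2, h3⟩ := ih fun j hj => hβ j (Finset.mem_insert_of_mem hj)
    have hi' := hβ i (Finset.mem_insert_self _ _)
    have h4 : ∀ p s, s ∈ thresholdSet (β p) (insert i I) A ↔ (s < β p i ↔ i ∈ A) ∧ s ∈ Ico (lo p) (hi p) := by
      intro p s
      rw [← h3]
      simp only [thresholdSet, Finset.mem_insert, forall_eq_or_imp, mem_ofPred_eq]
      tauto
    by_cases hA : i ∈ A
    · refine ⟨lo, fun p => min (hi p) (β p i), h1, h2.min hi', fun p => ?_⟩
      ext s
      simp only [h4, hA, iff_true, mem_Ico, lt_min_iff]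
      tauto
    · refine ⟨fun p => max (lo p) (β p i), hi, h1.max hi', h2, fun p => ?_⟩
      ext s
      simp only [h4, hA, iff_false, mem_Ico, max_le_iff, not_lt]
      tauto

theorem isCompactPL_thresholdWeight [FiniteDimensional ℝ V] {N : Set V} (hN : IsCompactPolyhedron N)
    {β : V → ι → ℝ} (I A : Finset ι) (hβ : ∀ i ∈ I, IsCompactPL (fun p => β p i) N) :
    IsCompactPL (fun p => thresholdWeight (β p) I A) N := by
  obtain ⟨lo, hi, h1, h2, h3⟩ := thresholdSet_eq_Ico hN I A hβ
  refine ((h2.add h1.neg).posPart).congr fun p _ => ?_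
  simp only [thresholdWeight, h3, Measure.real, Real.volume_Ico]
  rw [ENNReal.toReal_ofReal', sub_eq_add_neg]

theorem thresholdWeight_nonneg (β : ι → ℝ) (I A : Finset ι) : 0 ≤ thresholdWeight β I A := measureReal_nonneg

theorem exists_of_thresholdWeight_ne_zero {β : ι → ℝ} {I A : Finset ι} (h : thresholdWeight β I A ≠ 0) :
    ∃ s ∈ Ico (0 : ℝ) 1, ∀ i ∈ I, s < β i ↔ i ∈ A := by
  by_contra! hcon
  refine h ?_
  rw [thresholdWeight, show thresholdSet β I A = ∅ from ?_, measureReal_empty]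
  refine eq_empty_of_forall_notMem fun s hs => ?_
  obtain ⟨i, hi, h⟩ := hcon s hs.1
  have := hs.2 i hi
  rcases h with ⟨h1, h2⟩ | ⟨h1, h2⟩
  · exact h2 (this.1 h1)
  · exact (this.2 h2).not_ge h1

theorem measurableSet_thresholdSet (β : ι → ℝ) (I A : Finset ι) : MeasurableSet (thresholdSet β I A) := by
  -- A constant family over a one-point polyhedron; only the interval form is used.
  obtain ⟨lo, hi, -, -, h3⟩ := thresholdSet_eq_Ico (V := ℝ) (N := {0})
    (β := fun _ => β) ⟨{{0}}, by simp⟩ I A fun i _ =>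
      IsCompactPolyhedron.isCompactPL_const ⟨{{0}}, by simp⟩ (β i)
  rw [h3 0]
  exact measurableSet_Ico

/-- Every parameter in `[0, 1)` has exactly one pattern, so sums of pattern weights are measures of
events. -/
theorem sum_thresholdWeight_filter [DecidableEq ι] (β : ι → ℝ) (I : Finset ι) (P : Finset ι → Prop) [DecidablePred P]
    {T : Set ℝ} (hT : ∀ s ∈ Ico (0 : ℝ) 1, ∀ A ⊆ I, (∀ i ∈ I, s < β i ↔ i ∈ A) → (P A ↔ s ∈ T)) :
    ∑ A ∈ I.powerset with P A, thresholdWeight β I A = volume.real (Ico (0 : ℝ) 1 ∩ T) := by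
  have hfin : ∀ A, volume (thresholdSet β I A) ≠ ⊤ := fun A =>
    ne_of_lt ((measure_mono fun s hs => hs.1).trans_lt (by simp : volume (Ico (0 : ℝ) 1) < ⊤))
  rw [show Ico (0 : ℝ) 1 ∩ T = ⋃ A ∈ I.powerset.filter P, thresholdSet β I A from ?_,
    measureReal_biUnion_finset ?_ ?_ fun A _ => hfin A]
  · rfl
  · intro A hA B hB hAB
    refine disjoint_left.2 fun s hs hs' => hAB ?_
    simp only [Finset.coe_filter, Finset.mem_powerset, mem_ofPred_eq] at hA hB
    ext i
    by_cases hi : i ∈ I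
    · rw [← hs.2 i hi, ← hs'.2 i hi]
    · exact iff_of_false (fun h => hi (hA.1 h)) fun h => hi (hB.1 h)
  · exact fun A _ => measurableSet_thresholdSet β I A
  · ext s
    simp only [mem_inter_iff, mem_iUnion, Finset.mem_filter, Finset.mem_powerset, exists_prop]
    constructor
    · rintro ⟨h1, h2⟩
      have hA : ∀ i ∈ I, s < β i ↔ i ∈ I.filter fun i => s < β i := fun i hi => by simp [hi]
      exact ⟨I.filter fun i => s < β i, ⟨Finset.filter_subset _ _, (hT s h1 _ (Finset.filter_subset _ _) hA).2 h2⟩,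
        h1, hA⟩
    · rintro ⟨A, ⟨h1, h2⟩, h3⟩
      exact ⟨h3.1, (hT s h3.1 A h1 h3.2).1 h2⟩

theorem sum_thresholdWeight [DecidableEq ι] (β : ι → ℝ) (I : Finset ι) :
    ∑ A ∈ I.powerset, thresholdWeight β I A = 1 := by
  have := sum_thresholdWeight_filter β I (fun _ => True) (T := univ) (by simp)
  simpa using this

theorem sum_thresholdWeight_mem [DecidableEq ι] {β : ι → ℝ} {I : Finset ι} {i : ι} (hi : i ∈ I) (h0 : 0 ≤ β i)
    (h1 : β i ≤ 1) : ∑ A ∈ I.powerset with i ∈ A, thresholdWeight β I A = β i := by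
  rw [sum_thresholdWeight_filter β I (fun A => i ∈ A) (T := Iio (β i)) fun s _ A _ h => (h i hi).symm,
    show Ico (0 : ℝ) 1 ∩ Iio (β i) = Ico 0 (β i) from ?_]
  · simp [Measure.real, h0]
  · ext s
    simp only [mem_inter_iff, mem_Ico, mem_Iio]
    constructor
    · rintro ⟨⟨a, b⟩, c⟩; exact ⟨a, c⟩
    · rintro ⟨a, b⟩; exact ⟨⟨a, b.trans_le h1⟩, b⟩

end ThresholdKernel

/-! ### PL approximation of fibrewise injective maps by averaging over rounded points. -/

section Approximation

namespace ColoredTriangulation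

variable {V W K : Type} [NormedAddCommGroup V] [NormedSpace ℝ V]
  [NormedAddCommGroup W] [NormedSpace ℝ W] [NormedAddCommGroup K] [NormedSpace ℝ K]
  {f : V → W} {N : Set V} {S : ColoredTriangulation f N}

theorem sum_color_mul_lam {n : ℕ} (hn : ∀ a, S.c a ≤ n) (φ : ℕ → ℝ) (m : ℕ) (p : V) :
    ∑ a with m ≤ S.c a, φ (S.c a) * S.lam a p = ∑ j ∈ Finset.Ico m (n + 1), φ j * S.lvl j p := by
  classical
  rw [← Finset.sum_fiberwise_of_maps_to (t := Finset.Ico m (n + 1)) (g := S.c) fun a ha => by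
    have := hn a
    simp only [Finset.mem_filter, Finset.mem_univ, true_and, Finset.mem_Ico] at ha ⊢
    omega]
  refine Finset.sum_congr rfl fun j hj => ?_
  rw [lvl, Finset.mul_sum, Finset.filter_filter]
  refine Finset.sum_congr (Finset.filter_congr fun a _ => ?_) fun a ha => ?_
  · have := (Finset.mem_Ico.1 hj).1
    constructor
    · exact fun h => h.2
    · exact fun h => ⟨by omega, h⟩
  · rw [(Finset.mem_filter.1 ha).2]

theorem tau_eq_zero_of_lt {n : ℕ} (hn : ∀ a, S.c a ≤ n) {j : ℕ} (hj : n < j) (p : V) : S.tau j p = 0 := by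
  rw [tau, Finset.filter_false_of_mem, Finset.sum_empty]
  intro a _
  have := hn a
  omega

/-- The `j`-th cumulative weight prescribed by a rounding pattern. -/
noncomputable def patternValue (R : ℕ) (A : Finset (ℕ × ℕ)) (j : ℕ) : ℝ :=
  ((Finset.range R).filter fun k => (j, k) ∈ A).card / R

/-- The weight at `p` of a rounding pattern. -/
noncomputable def patternWeight (S : ColoredTriangulation f N) (κ : ℕ → ℝ) (n R : ℕ) (p : V)
    (A : Finset (ℕ × ℕ)) : ℝ :=
  thresholdWeight (roundThreshold κ (fun j => S.tau j p) R) (Finset.range (n + 1) ×ˢ Finset.range R) A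

/-- The factors by which the weights at `p` are multiplied to get the pattern `A`. -/
noncomputable def patternFactor (S : ColoredTriangulation f N) (R : ℕ) (A : Finset (ℕ × ℕ)) (p : V)
    (j : ℕ) : ℝ := (patternValue R A j - patternValue R A (j + 1)) / S.lvl j p

/-- The point of the simplex of `p` whose weights are prescribed by the pattern `A`. -/
noncomputable def patternPoint (S : ColoredTriangulation f N) (R : ℕ) (A : Finset (ℕ × ℕ)) (p : V) : V :=
  S.rescale (S.patternFactor R A p) p

/-- The average of the values of `g` at the points prescribed by the rounding patterns. -/
noncomputable def roundAverage (S : ColoredTriangulation f N) (κ : ℕ → ℝ) (n R : ℕ) (g : V → K) (p : V) : K :=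
  ∑ A ∈ (Finset.range (n + 1) ×ˢ Finset.range R).powerset, S.patternWeight κ n R p A • g (S.patternPoint R A p)

/-- Scales for which the rounding of all cumulative weights on `N` is well behaved. -/
def RoundScales (S : ColoredTriangulation f N) (κ : ℕ → ℝ) (n R : ℕ) : Prop :=
  ∀ p ∈ N, RoundData κ (fun j => S.tau j p) n R

section
variable {κ : ℕ → ℝ} {n R : ℕ} {p : V} {A : Finset (ℕ × ℕ)}

theorem exists_patternValue_eq (h : S.RoundScales κ n R) (hp : p ∈ N)
    (hA : A ∈ (Finset.range (n + 1) ×ˢ Finset.range R).powerset) (hw : S.patternWeight κ n R p A ≠ 0) :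
    ∃ s ∈ Ico (0 : ℝ) 1, patternValue R A = roundValue κ (fun j => S.tau j p) R s := by
  obtain ⟨s, hs, h1⟩ := exists_of_thresholdWeight_ne_zero hw
  refine ⟨s, hs, funext fun j => ?_⟩
  rcases le_or_gt j n with hj | hj
  · rw [patternValue, roundValue]
    congr 2
    refine congrArg _ (Finset.filter_congr fun k hk => ?_)
    exact (h1 (j, k) (Finset.mem_product.2 ⟨Finset.mem_range.2 (by dsimp only; omega), hk⟩)).symm
  · rw [(h p hp).roundValue_of_lt hs.1 hj, patternValue, Finset.filter_false_of_mem, Finset.card_empty,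
      Nat.cast_zero, zero_div]
    intro k _ hk
    have := Finset.mem_range.1 (Finset.mem_product.1 (Finset.mem_powerset.1 hA hk)).1
    dsimp only at this
    omega

/-- The division in `patternFactor` is harmless: if colour `j` has no weight, consecutive cumulative
weights agree, and so do their rounded values. -/
theorem patternFactor_mul_lvl (h : S.RoundScales κ n R) (hp : p ∈ N) {s : ℝ}
    (hA : patternValue R A = roundValue κ (fun j => S.tau j p) R s) (j : ℕ) :
    S.patternFactor R A p j * S.lvl j p = patternValue R A j - patternValue R A (j + 1) := by
  rw [patternFactor]
  by_cases h0 : S.lvl j p = 0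
  · rw [h0, mul_zero, hA, (h p hp).roundValue_succ_eq (by
      rw [S.tau_succ j, h0, zero_add]), sub_self]
  · rw [div_mul_cancel₀ _ h0]

theorem patternFactor_mul_lam (h : S.RoundScales κ n R) (hp : p ∈ N) {s : ℝ}
    (hA : patternValue R A = roundValue κ (fun j => S.tau j p) R s) (a : S.ι) :
    S.patternFactor R A p (S.c a) * S.lam a p =
      if 0 < S.lam a p then patternValue R A (S.c a) - patternValue R A (S.c a + 1) else 0 := by
  split_ifs with h0
  · rw [← lvl_eq_lam hp h0, patternFactor_mul_lvl h hp hA]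
  · rw [le_antisymm (not_lt.1 h0) (S.nonneg p hp a), mul_zero]

theorem patternFactor_nonneg (h : S.RoundScales κ n R) (hp : p ∈ N) {s : ℝ} (hs : 0 ≤ s)
    (hA : patternValue R A = roundValue κ (fun j => S.tau j p) R s) (j : ℕ) :
    0 ≤ S.patternFactor R A p j := by
  refine div_nonneg (sub_nonneg.2 ?_) (lvl_nonneg hp j)
  rw [hA]
  exact (h p hp).roundValue_succ_le hs j

theorem sum_patternFactor (h : S.RoundScales κ n R) (hn : ∀ a, S.c a ≤ n) (hp : p ∈ N) {s : ℝ} (hs : 0 ≤ s)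
    (hA : patternValue R A = roundValue κ (fun j => S.tau j p) R s) {m : ℕ} (hm : m ≤ n) :
    ∑ a with m ≤ S.c a, S.patternFactor R A p (S.c a) * S.lam a p = patternValue R A m := by
  rw [sum_color_mul_lam hn, Finset.sum_congr rfl fun j _ => patternFactor_mul_lvl h hp hA j,
    Finset.sum_Ico_eq_sum_range]
  simp only [add_assoc]
  rw [Finset.sum_range_sub' (fun j => patternValue R A (m + j)),
    show m + (n + 1 - m) = n + 1 by omega, hA, (h p hp).roundValue_of_lt hs (Nat.lt_succ_self n),
    sub_zero, add_zero]

theorem sum_patternFactor_eq_one (h : S.RoundScales κ n R) (hn : ∀ a, S.c a ≤ n) (hp : p ∈ N) {s : ℝ}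
    (hs : s ∈ Ico (0 : ℝ) 1) (hA : patternValue R A = roundValue κ (fun j => S.tau j p) R s) :
    ∑ a, S.patternFactor R A p (S.c a) * S.lam a p = 1 := by
  have := sum_patternFactor h hn hp hs.1 hA (Nat.zero_le n)
  rwa [Finset.filter_true_of_mem fun a _ => Nat.zero_le _, hA, (h p hp).roundValue_zero hs.2] at this

theorem sum_patternWeight (S : ColoredTriangulation f N) (κ : ℕ → ℝ) (n R : ℕ) (p : V) :
    ∑ A ∈ (Finset.range (n + 1) ×ˢ Finset.range R).powerset, S.patternWeight κ n R p A = 1 :=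
  sum_thresholdWeight _ _

/-- Rounding preserves the mean. -/
theorem sum_patternWeight_mul (h : S.RoundScales κ n R) (hp : p ∈ N) (j : ℕ) :
    ∑ A ∈ (Finset.range (n + 1) ×ˢ Finset.range R).powerset, S.patternWeight κ n R p A * patternValue R A j =
      S.tau j p := by
  have hR : (R : ℝ) ≠ 0 := by exact_mod_cast (h p hp).R_pos.ne'
  rcases le_or_gt j n with hj | hj
  -- The mean of a count is the sum over `k` of the probabilities that unit `k` is counted, which
  -- are the thresholds.
  · have h1 : ∀ A, S.patternWeight κ n R p A * patternValue R A j =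
        ∑ k ∈ Finset.range R, (if (j, k) ∈ A then S.patternWeight κ n R p A else 0) / R := by
      intro A
      rw [← Finset.sum_div, ← Finset.sum_filter, Finset.sum_const, nsmul_eq_mul, patternValue]
      ring
    simp only [h1]
    rw [Finset.sum_comm]
    have h2 : ∀ k ∈ Finset.range R, ∑ A ∈ (Finset.range (n + 1) ×ˢ Finset.range R).powerset,
        (if (j, k) ∈ A then S.patternWeight κ n R p A else 0) / R =
          roundThreshold κ (fun j => S.tau j p) R (j, k) / R := by
      intro k hk
      rw [← Finset.sum_div, ← Finset.sum_filter]
      congr 1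
      exact sum_thresholdWeight_mem (Finset.mem_product.2 ⟨Finset.mem_range.2 (by dsimp only; omega), hk⟩)
        (roundThreshold_nonneg _ _ _ _) ((h p hp).threshold_le_one _)
    rw [Finset.sum_congr rfl h2, ← Finset.sum_div, (h p hp).sum_threshold, mul_div_cancel_left₀ _ hR]
  · rw [(h p hp).eq_zero j hj]
    refine Finset.sum_eq_zero fun A hA => ?_
    by_cases hw : S.patternWeight κ n R p A = 0
    · rw [hw, zero_mul]
    · obtain ⟨s, hs, h1⟩ := exists_patternValue_eq h hp hA hw
      rw [h1, (h p hp).roundValue_of_lt hs.1 hj, mul_zero]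

theorem norm_sum_smul_vertex_sub_le (S : ColoredTriangulation f N) {μ ν : S.ι → ℝ} {r : ℝ}
    (h : ∀ a, |μ a - ν a| ≤ r) : ‖∑ a, μ a • S.v a - ∑ a, ν a • S.v a‖ ≤ r * S.vertexBound := by
  rw [← Finset.sum_sub_distrib, vertexBound, Finset.mul_sum]
  refine norm_sum_le_of_le _ fun a _ => ?_
  rw [← sub_smul, norm_smul, Real.norm_eq_abs]
  exact mul_le_mul_of_nonneg_right (h a) (norm_nonneg _)

theorem isCompactPL_tau [FiniteDimensional ℝ V] (S : ColoredTriangulation f N) (hN : IsCompactPolyhedron N)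
    (m : ℕ) : IsCompactPL (S.tau m) N :=
  isCompactPL_sum hN _ fun a _ => S.isCompactPL_lam a

theorem isCompactPL_roundHeight [FiniteDimensional ℝ V] (S : ColoredTriangulation f N)
    (hN : IsCompactPolyhedron N) (κ : ℕ → ℝ) (j : ℕ) :
    IsCompactPL (fun p => roundHeight κ (fun j => S.tau j p) j) N := by
  induction j with
  | zero => exact hN.isCompactPL_const 1
  | succ j ih =>
    refine (ih.min ((S.isCompactPL_tau hN (j + 1)).const_mul (κ (j + 1))⁻¹)).congr fun p _ => ?_
    simp only [roundHeight, div_eq_inv_mul]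

theorem isCompactPL_patternWeight [FiniteDimensional ℝ V] (S : ColoredTriangulation f N)
    (hN : IsCompactPolyhedron N) (κ : ℕ → ℝ) (n R : ℕ) (A : Finset (ℕ × ℕ)) :
    IsCompactPL (fun p => S.patternWeight κ n R p A) N := by
  refine isCompactPL_thresholdWeight (β := fun p => roundThreshold κ (fun j => S.tau j p) R) hN _ A
    fun z _ => ?_
  have h1 := S.isCompactPL_roundHeight hN κ z.1
  refine ((hN.isCompactPL_const 0).max (h1.min (((S.isCompactPL_tau hN z.1).const_mul R).add
    (h1.const_mul z.2).neg))).congr fun p _ => ?_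
  simp only [roundThreshold, sub_eq_add_neg]

/-- On a fixed simplex the rounded point depends on the pattern only. The average is thus a
combination of finitely many constant vectors with PL coefficients, which makes it PL even though
`g` is not. -/
theorem patternPoint_eq (h : S.RoundScales κ n R) (hp : p ∈ N)
    (hA : A ∈ (Finset.range (n + 1) ×ˢ Finset.range R).powerset) (hw : S.patternWeight κ n R p A ≠ 0)
    {q : V} (hpq : p ∈ S.simplex q) (hq : q ∈ N) : S.patternPoint R A p = ∑ a, (if 0 < S.lam a q then
      patternValue R A (S.c a) - patternValue R A (S.c a + 1) else 0) • S.v a := by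
  obtain ⟨s, hs, h1⟩ := exists_patternValue_eq h hp hA hw
  rw [patternPoint, rescale]
  refine Finset.sum_congr rfl fun a _ => ?_
  rw [patternFactor_mul_lam h hp h1]
  have hsub := (of_mem_simplex hq hpq).2
  by_cases h2 : 0 < S.lam a p
  · rw [if_pos h2, if_pos (hsub a h2)]
  by_cases h3 : 0 < S.lam a q
  · have h4 : S.lvl (S.c a) p = 0 := by
      refine Finset.sum_eq_zero fun b hb => ?_
      by_contra h5
      have hb' : 0 < S.lam b p := lt_of_le_of_ne (S.nonneg p hp b) (Ne.symm h5)
      rw [S.color_inj q hq b a (hsub b hb') h3 (Finset.mem_filter.1 hb).2] at hb'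
      exact h2 hb'
    rw [if_neg h2, if_pos h3, ← patternFactor_mul_lvl h hp h1, h4, mul_zero]
  · rw [if_neg h2, if_neg h3]

theorem isCompactPL_roundAverage [FiniteDimensional ℝ V] (hN : IsCompactPolyhedron N)
    (h : S.RoundScales κ n R) (g : V → K) : IsCompactPL (S.roundAverage κ n R g) N := by
  refine S.isCompactPL_of_simplex fun q hq => ?_
  have hsub : S.simplex q ⊆ N := fun p hp => (of_mem_simplex hq hp).1
  refine (isCompactPL_sum (S.isCompactPolyhedron_simplex q)
    (Finset.range (n + 1) ×ˢ Finset.range R).powerset fun A _ =>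
    ((S.isCompactPL_patternWeight hN κ n R A).mono (S.isCompactPolyhedron_simplex q) hsub).smul_const
      (g (∑ a, (if 0 < S.lam a q then
        patternValue R A (S.c a) - patternValue R A (S.c a + 1) else 0) • S.v a))).congr fun p hp => ?_
  refine Finset.sum_congr rfl fun A hA => ?_
  by_cases hw : S.patternWeight κ n R p A = 0
  · rw [hw, zero_smul, zero_smul]
  · rw [patternPoint_eq h (hsub hp) hA hw hp hq]

/-- An affine function commutes with expectation, and rounding preserves the mean of all weights. -/
theorem roundAverage_eq_of_affineOnSimplices {N₀ : Set V} {g : V → K} (hS : S.AffineOnSimplices N₀ g)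
    (hN₀ : N₀ ⊆ N) (h : S.RoundScales κ n R) (hn : ∀ a, S.c a ≤ n) :
    EqOn (S.roundAverage κ n R g) g N₀ := by
  intro p hp
  have hpN := hN₀ hp
  have key : ∀ A ∈ (Finset.range (n + 1) ×ˢ Finset.range R).powerset,
      S.patternWeight κ n R p A • g (S.patternPoint R A p) = ∑ a, (if 0 < S.lam a p then
        S.patternWeight κ n R p A * patternValue R A (S.c a) -
          S.patternWeight κ n R p A * patternValue R A (S.c a + 1) else 0) • g (S.v a) := by
    intro A hA
    by_cases hw : S.patternWeight κ n R p A = 0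
    · simp [hw]
    · obtain ⟨s, hs, h1⟩ := exists_patternValue_eq h hpN hA hw
      rw [patternPoint, rescale, (hS p hp (fun a => S.patternFactor R A p (S.c a) * S.lam a p)
        (fun a => mul_nonneg (patternFactor_nonneg h hpN hs.1 h1 _) (S.nonneg p hpN a))
        (sum_patternFactor_eq_one h hn hpN hs h1) (fun a ha => pos_of_mul_pos_right ha
          (patternFactor_nonneg h hpN hs.1 h1 _))).2, Finset.smul_sum]
      refine Finset.sum_congr rfl fun a _ => ?_
      rw [patternFactor_mul_lam h hpN h1, smul_smul, mul_ite, mul_zero, mul_sub]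
  rw [roundAverage, Finset.sum_congr rfl key, Finset.sum_comm]
  have h2 := (hS p hp (fun a => S.lam a p) (S.nonneg p hpN) (S.sum_one p hpN) fun a ha => ha).2
  rw [S.sum_smul p hpN] at h2
  rw [h2]
  refine Finset.sum_congr rfl fun a _ => ?_
  rw [← Finset.sum_smul]
  congr 1
  split_ifs with h0
  · rw [Finset.sum_sub_distrib, sum_patternWeight_mul h hpN, sum_patternWeight_mul h hpN, tau_succ,
      add_sub_cancel_right, lvl_eq_lam hpN h0]
  · rw [Finset.sum_const_zero]
    exact (le_antisymm (not_lt.1 h0) (S.nonneg p hpN a)).symm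

/-- Patterns of positive weight with nonzero `i`-th value prescribe points close to a common
centre. -/
theorem exists_norm_patternPoint_sub_le (h : S.RoundScales κ n R) (hp : p ∈ N) (i : ℕ) : ∃ y : V,
    (i = 0 → y = p) ∧ ∀ A ∈ (Finset.range (n + 1) ×ˢ Finset.range R).powerset, S.patternWeight κ n R p A ≠ 0 →
      0 < patternValue R A i → ‖S.patternPoint R A p - y‖ ≤ 2 * (κ (i + 1) + 1 / R) * S.vertexBound := by
  -- The cumulative weights of the centre are the magnified values with the height frozen from `i`
  -- on. For `i = 0` all heights used are `1` and the centre is `p`.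
  set z : ℕ → ℝ := fun j => S.tau j p / roundHeight κ (fun j => S.tau j p) (min i j) with hz
  refine ⟨∑ a, (if 0 < S.lam a p then z (S.c a) - z (S.c a + 1) else 0) • S.v a, ?_, fun A hA hw hi => ?_⟩
  · rintro rfl
    conv_rhs => rw [← S.sum_smul p hp]
    refine Finset.sum_congr rfl fun a _ => ?_
    congr 1
    split_ifs with h0
    · simp only [hz, Nat.zero_min, roundHeight, div_one]
      rw [tau_succ, add_sub_cancel_right, lvl_eq_lam hp h0]
    · exact (le_antisymm (not_lt.1 h0) (S.nonneg p hp a)).symm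
  · obtain ⟨s, hs, h1⟩ := exists_patternValue_eq h hp hA hw
    rw [patternPoint, rescale]
    refine S.norm_sum_smul_vertex_sub_le fun a => ?_
    rw [patternFactor_mul_lam h hp h1]
    have h2 := fun j => (h p hp).abs_roundValue_sub_center_le hs.1
      ((h p hp).lt_height_of_roundValue_pos (by rwa [h1] at hi)) j
    rw [← h1] at h2
    have e1 := abs_le.1 (h2 (S.c a))
    have e2 := abs_le.1 (h2 (S.c a + 1))
    have e3 : 0 ≤ κ (i + 1) + 1 / R := (abs_nonneg _).trans (h2 0)
    split_ifs with h0
    · rw [abs_le]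
      simp only [hz]
      constructor <;> linarith
    · rw [sub_zero, abs_zero]
      positivity

/-- The points prescribed by a pattern for the two points of a fibre agree if the pattern does not
see the difference. -/
theorem FirstDiff.patternPoint_eq {i : ℕ} {q : V} (hpq : S.FirstDiff i p q) (h : S.RoundScales κ n R)
    (hn : ∀ a, S.c a ≤ n) (hA : A ∈ (Finset.range (n + 1) ×ˢ Finset.range R).powerset)
    (hw : S.patternWeight κ n R p A ≠ 0) (hin : i ≤ n) (hi : patternValue R A i = 0) :
    S.patternPoint R A p = S.patternPoint R A q := by
  have hp := hpq.left_mem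
  obtain ⟨s, hs, h1⟩ := exists_patternValue_eq h hp hA hw
  have h0 := fun a => patternFactor_nonneg h hp hs.1 h1 (S.c a)
  have hF : S.patternFactor R A q = S.patternFactor R A p := funext fun j => by
    rw [patternFactor, patternFactor, lvl_eq_of_image_eq hp hpq.right_mem hpq.image_eq]
  -- The new weights of colours `≥ i` are nonnegative and add up to the `i`-th pattern value, which
  -- is zero; only shared vertices are left.
  have h3 : ∀ p' ∈ N, f p = f p' → ∀ a, i ≤ S.c a → S.patternFactor R A p (S.c a) * S.lam a p' = 0 := by
    intro p' hp' hpp' a ha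
    have h4 := sum_patternFactor h hn hp hs.1 h1 hin
    rw [hi, sum_color_mul_lam hn] at h4
    simp only [lvl_eq_of_image_eq hp hp' hpp'] at h4
    rw [← sum_color_mul_lam hn] at h4
    exact (Finset.sum_eq_zero_iff_of_nonneg fun a _ => mul_nonneg (h0 a) (S.nonneg p' hp' a)).1 h4 a
      (by simpa using ha)
  rw [ColoredTriangulation.patternPoint, ColoredTriangulation.patternPoint, hF,
    ColoredTriangulation.rescale, ColoredTriangulation.rescale]
  refine Finset.sum_congr rfl fun a _ => ?_
  rcases lt_or_ge (S.c a) i with ha | ha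
  · rw [hpq.below a ha]
  · rw [h3 p hp rfl a ha, h3 q hpq.right_mem hpq.image_eq a ha]

theorem FirstDiff.patternPoint {i : ℕ} {q : V} (hpq : S.FirstDiff i p q) (h : S.RoundScales κ n R)
    (hn : ∀ a, S.c a ≤ n) (hA : A ∈ (Finset.range (n + 1) ×ˢ Finset.range R).powerset)
    (hw : S.patternWeight κ n R p A ≠ 0) (hin : i ≤ n) (hi : 0 < patternValue R A i) :
    S.FirstDiff i (S.patternPoint R A p) (S.patternPoint R A q) ∧
      κ i / 2 ≤ S.tau i (S.patternPoint R A p) := by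
  have hp := hpq.left_mem
  obtain ⟨s, hs, h1⟩ := exists_patternValue_eq h hp hA hw
  have h0 := fun a => patternFactor_nonneg h hp hs.1 h1 (S.c a)
  have hF : S.patternFactor R A q = S.patternFactor R A p := funext fun j => by
    rw [patternFactor, patternFactor, lvl_eq_of_image_eq hp hpq.right_mem hpq.image_eq]
  have h4 := sum_patternFactor h hn hp hs.1 h1 hin
  have h5 := sum_patternFactor_eq_one h hn hp hs h1
  rw [ColoredTriangulation.patternPoint, ColoredTriangulation.patternPoint, hF]
  refine ⟨hpq.rescale (fun a _ => h0 a) h5 ?_, ?_⟩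
  · by_contra! hcon
    refine hi.ne' (h4.symm.trans (Finset.sum_eq_zero fun a ha => ?_))
    exact le_antisymm (hcon a (Finset.mem_filter.1 ha).2) (mul_nonneg (h0 a) (S.nonneg p hp a))
  · rw [tau, Finset.sum_congr rfl fun a _ => (rescale_mem hp (fun a _ => h0 a) h5).2.1 a, h4, h1]
    exact (h p hp).half_le_roundValue hs.1 hin (by rwa [h1] at hi)

theorem patternPoint_mem (h : S.RoundScales κ n R) (hn : ∀ a, S.c a ≤ n) (hp : p ∈ N)
    (hA : A ∈ (Finset.range (n + 1) ×ˢ Finset.range R).powerset) (hw : S.patternWeight κ n R p A ≠ 0) :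
    S.patternPoint R A p ∈ N := by
  obtain ⟨s, hs, h1⟩ := exists_patternValue_eq h hp hA hw
  exact (rescale_mem hp (fun a _ => patternFactor_nonneg h hp hs.1 h1 (S.c a))
    (sum_patternFactor_eq_one h hn hp hs h1)).1

theorem patternValue_zero (h : S.RoundScales κ n R) (hp : p ∈ N)
    (hA : A ∈ (Finset.range (n + 1) ×ˢ Finset.range R).powerset) (hw : S.patternWeight κ n R p A ≠ 0) :
    patternValue R A 0 = 1 := by
  obtain ⟨s, hs, h1⟩ := exists_patternValue_eq h hp hA hw
  rw [h1, (h p hp).roundValue_zero hs.2]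

end

/-- A weighted sum of vectors that are all close to one of them compared to its norm is nonzero. -/
theorem sum_smul_ne_zero {ι : Type*} {s : Finset ι} {w : ι → ℝ} {D : ι → K} {b : ℝ} (hw : ∀ a ∈ s, 0 ≤ w a)
    (hb : 0 < b) (hD : ∀ a ∈ s, w a ≠ 0 → D a ≠ 0 → b ≤ ‖D a‖)
    (hclose : ∀ a ∈ s, ∀ a' ∈ s, w a ≠ 0 → D a ≠ 0 → w a' ≠ 0 → D a' ≠ 0 → ‖D a - D a'‖ ≤ b / 2)
    (hex : ∃ a ∈ s, w a ≠ 0 ∧ D a ≠ 0) : ∑ a ∈ s, w a • D a ≠ 0 := by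
  classical
  obtain ⟨a₀, ha₀, hw₀, hD₀⟩ := hex
  intro h0
  set t := s.filter fun a => w a ≠ 0 ∧ D a ≠ 0 with ht
  have h1 : ∑ a ∈ t, w a • D a = 0 := by
    rw [← h0]
    refine Finset.sum_filter_of_ne fun a _ h => ⟨fun h' => h ?_, fun h' => h ?_⟩
    · rw [h', zero_smul]
    · rw [h', smul_zero]
  have hW : 0 < ∑ a ∈ t, w a := Finset.sum_pos (fun a ha => by
    rw [ht, Finset.mem_filter] at ha
    exact lt_of_le_of_ne (hw a ha.1) ha.2.1.symm) ⟨a₀, Finset.mem_filter.2 ⟨ha₀, hw₀, hD₀⟩⟩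
  have h2 : (∑ a ∈ t, w a) • D a₀ = ∑ a ∈ t, w a • (D a₀ - D a) := by
    simp only [smul_sub, Finset.sum_sub_distrib, h1, sub_zero, Finset.sum_smul]
  have h3 : ‖(∑ a ∈ t, w a) • D a₀‖ ≤ (∑ a ∈ t, w a) * (b / 2) := by
    rw [h2, Finset.sum_mul]
    refine norm_sum_le_of_le _ fun a ha => ?_
    rw [ht, Finset.mem_filter] at ha
    rw [norm_smul, Real.norm_eq_abs, abs_of_nonneg (hw a ha.1)]
    exact mul_le_mul_of_nonneg_left (hclose a₀ ha₀ a ha.1 hw₀ hD₀ ha.2.1 ha.2.2) (hw a ha.1)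
  rw [norm_smul, Real.norm_eq_abs, abs_of_pos hW] at h3
  have := le_of_mul_le_mul_left h3 hW
  linarith [hD a₀ ha₀ hw₀ hD₀]

/-- Fibrewise injective maps can be approximated by piecewise linear ones. -/
theorem exists_isCompactPL_approx [FiniteDimensional ℝ V] (S : ColoredTriangulation f N)
    (hN : IsCompactPolyhedron N) (hf : ContinuousOn f N) {g : V → K} (hg : ContinuousOn g N)
    (hinj : FiberInjOn f N g) {N₀ : Set V} (hN₀ : N₀ ⊆ N) (hS : S.AffineOnSimplices N₀ g) {ε : ℝ}
    (hε : 0 < ε) : ∃ g' : V → K, IsCompactPL g' N ∧ FiberInjOn f N g' ∧ (∀ p ∈ N, ‖g' p - g p‖ ≤ ε) ∧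
      EqOn g' g N₀ := by
  obtain ⟨n, hn⟩ : ∃ n, ∀ a, S.c a ≤ n := ⟨Finset.univ.sup S.c, fun a => Finset.le_sup (Finset.mem_univ a)⟩
  have hLB := fun (κ : ℝ) (hκ : 0 < κ) => S.exists_fiber_lower_bound hN.isCompact hf hg hinj hκ
  choose! B hB0 hB using hLB
  have huc := Metric.uniformContinuousOn_iff.1 (hN.isCompact.uniformContinuousOn_of_continuous hg)
  choose! d hd0 hd using huc
  have hVB := S.vertexBound_nonneg
  -- With `k = κ i`, the bound `B (k / 2)` is the gap of `g` on pairs with `tau i ≥ κ i / 2`. The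
  -- next value is so small that rounded points clustered at scale `κ (i + 1)` have values of `g`
  -- within a quarter of that gap.
  set step : ℝ → ℝ := fun k => min (k / 2) (d (min ε (B (k / 2) / 4)) / (16 * (S.vertexBound + 1))) with hstep
  let κ : ℕ → ℝ := fun i => Nat.rec 1 (fun _ k => step k) i
  have κs : ∀ i, κ (i + 1) = step (κ i) := fun i => rfl
  have hr0 : ∀ k, 0 < k → 0 < min ε (B (k / 2) / 4) := fun k hk =>
    lt_min hε (div_pos (hB0 _ (half_pos hk)) (by norm_num))
  have κ_pos : ∀ i, 0 < κ i := by
    intro i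
    induction i with
    | zero => exact one_pos
    | succ i ih =>
      rw [κs]
      exact lt_min (half_pos ih) (div_pos (hd0 _ (hr0 _ ih)) (by positivity))
  have κ_half : ∀ i, κ (i + 1) ≤ κ i / 2 := fun i => by rw [κs]; exact min_le_left _ _
  have κ_anti : Antitone κ := antitone_nat_of_succ_le fun j => (κ_half j).trans (by linarith [κ_pos j])
  obtain ⟨R, hR⟩ := exists_nat_gt (4 / κ (n + 1))
  have hR0 : (0 : ℝ) < R := (div_pos four_pos (κ_pos (n + 1))).trans hR
  have hR4 : 4 / (R : ℝ) ≤ κ (n + 1) := by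
    rw [div_lt_iff₀ (κ_pos (n + 1))] at hR
    rw [div_le_iff₀ hR0]
    linarith
  have hRS : S.RoundScales κ n R := fun p hp =>
    { zero := tau_zero hp
      anti := fun i j hij => tau_anti hp hij
      nonneg := fun j => tau_nonneg hp j
      eq_zero := fun j hj => tau_eq_zero_of_lt hn hj p
      κ_zero := rfl
      κ_pos := κ_pos
      κ_half := κ_half
      R_pos := by exact_mod_cast hR0
      R_large := fun j hj => hR4.trans (κ_anti (show j ≤ n + 1 by omega)) }
  have hdist : ∀ i ≤ n, 2 * (2 * (κ (i + 1) + 1 / R) * S.vertexBound) < d (min ε (B (κ i / 2) / 4)) := by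
    intro i hi
    have h1 : κ (i + 1) ≤ d (min ε (B (κ i / 2) / 4)) / (16 * (S.vertexBound + 1)) := by
      rw [κs]; exact min_le_right _ _
    have h2 : 1 / (R : ℝ) ≤ κ (i + 1) := by
      refine le_trans ?_ (hR4.trans (κ_anti (show i + 1 ≤ n + 1 by omega)))
      gcongr
      norm_num
    rw [le_div_iff₀ (by positivity)] at h1
    have h3 := hd0 _ (hr0 _ (κ_pos i))
    have h4 : 1 / (R : ℝ) * S.vertexBound ≤ κ (i + 1) * S.vertexBound := mul_le_mul_of_nonneg_right h2 hVB
    have h5 := mul_nonneg (κ_pos (i + 1)).le hVB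
    have h6 := κ_pos (i + 1)
    nlinarith
  have hclose : ∀ p ∈ N, ∀ i ≤ n, ∀ A ∈ (Finset.range (n + 1) ×ˢ Finset.range R).powerset,
      ∀ A' ∈ (Finset.range (n + 1) ×ˢ Finset.range R).powerset, S.patternWeight κ n R p A ≠ 0 →
      0 < patternValue R A i → S.patternWeight κ n R p A' ≠ 0 → 0 < patternValue R A' i →
      ‖g (S.patternPoint R A p) - g (S.patternPoint R A' p)‖ < B (κ i / 2) / 4 := by
    intro p hp i hi A hA A' hA' hw hv hw' hv'
    obtain ⟨y, -, hy⟩ := exists_norm_patternPoint_sub_le hRS hp i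
    rw [← dist_eq_norm]
    refine (hd _ (hr0 _ (κ_pos i)) _ (patternPoint_mem hRS hn hp hA hw) _ (patternPoint_mem hRS hn hp hA' hw')
      ?_).trans_le (min_le_right _ _)
    refine lt_of_le_of_lt ?_ (hdist i hi)
    have e1 := hy A hA hw hv
    have e2 := hy A' hA' hw' hv'
    rw [← dist_eq_norm] at e1 e2
    linarith [dist_triangle_right (S.patternPoint R A p) (S.patternPoint R A' p) y]
  refine ⟨S.roundAverage κ n R g, isCompactPL_roundAverage hN hRS g, fun p hp q hq hpq heq => ?_, fun p hp => ?_,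
    roundAverage_eq_of_affineOnSimplices hS hN₀ hRS hn⟩
  · by_contra hne
    obtain ⟨i, hi, a, ha⟩ := S.exists_firstDiff hp hq hpq hne
    have hin : i ≤ n := ha ▸ hn a
    -- Pattern weights depend only on cumulative weights by colour, which are constant on fibres; so
    -- the difference of the averages is a weighted sum of differences.
    have hwq : ∀ A, S.patternWeight κ n R q A = S.patternWeight κ n R p A := fun A => by
      rw [patternWeight, patternWeight, funext fun j => tau_eq_of_image_eq hp hq hpq j]
    have hv : ∀ A ∈ (Finset.range (n + 1) ×ˢ Finset.range R).powerset, S.patternWeight κ n R p A ≠ 0 →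
        g (S.patternPoint R A p) - g (S.patternPoint R A q) ≠ 0 → 0 < patternValue R A i := by
      intro A hA hw hD
      refine lt_of_le_of_ne (by unfold patternValue; positivity) fun h0 => hD ?_
      rw [hi.patternPoint_eq hRS hn hA hw hin h0.symm, sub_self]
    have hfar : ∀ A ∈ (Finset.range (n + 1) ×ˢ Finset.range R).powerset, S.patternWeight κ n R p A ≠ 0 →
        0 < patternValue R A i → B (κ i / 2) ≤ ‖g (S.patternPoint R A p) - g (S.patternPoint R A q)‖ := by
      intro A hA hw hv
      obtain ⟨h1, h2⟩ := hi.patternPoint hRS hn hA hw hin hv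
      exact hB _ (half_pos (κ_pos i)) _ h1.left_mem _ h1.right_mem h1.image_eq (h2.trans h1.tau_le_sum)
    have hBpos := hB0 _ (half_pos (κ_pos i))
    refine sum_smul_ne_zero (s := (Finset.range (n + 1) ×ˢ Finset.range R).powerset)
      (w := S.patternWeight κ n R p) (D := fun A => g (S.patternPoint R A p) - g (S.patternPoint R A q))
      (b := B (κ i / 2)) (fun A _ => thresholdWeight_nonneg _ _ _) hBpos ?_ ?_ ?_ ?_
    · exact fun A hA hw hD => hfar A hA hw (hv A hA hw hD)
    · intro A hA A' hA' hw hD hw' hD'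
      have e1 := hclose p hp i hin A hA A' hA' hw (hv A hA hw hD) hw' (hv A' hA' hw' hD')
      have e2 := hclose q hq i hin A hA A' hA' (by rwa [hwq]) (hv A hA hw hD) (by rwa [hwq]) (hv A' hA' hw' hD')
      -- The rounded points of `p` and those of `q` are clustered separately, each contributing at
      -- most a quarter of the gap.
      rw [sub_sub_sub_comm]
      exact (norm_sub_le _ _).trans (by linarith)
    -- The mean of the `i`-th value is `tau i p > 0`, so some pattern of positive weight sees the
    -- difference.
    · by_contra! hcon
      have h1 := sum_patternWeight_mul hRS hp i
      refine (hi.tau_pos).ne' (h1.symm.trans (Finset.sum_eq_zero fun A hA => ?_))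
      by_cases hw : S.patternWeight κ n R p A = 0
      · rw [hw, zero_mul]
      · rcases (show 0 ≤ patternValue R A i by unfold patternValue; positivity).eq_or_lt with h2 | h2
        · rw [← h2, mul_zero]
        · have := hfar A hA hw h2
          rw [hcon A hA hw, norm_zero] at this
          exact absurd this hBpos.not_ge
    · simp only [smul_sub, Finset.sum_sub_distrib]
      rw [sub_eq_zero]
      refine Eq.trans heq (Finset.sum_congr rfl fun A _ => ?_)
      rw [hwq]
  · obtain ⟨y, hyp, hy⟩ := exists_norm_patternPoint_sub_le hRS hp 0
    rw [hyp rfl] at hy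
    have h1 : S.roundAverage κ n R g p - g p = ∑ A ∈ (Finset.range (n + 1) ×ˢ Finset.range R).powerset,
        S.patternWeight κ n R p A • (g (S.patternPoint R A p) - g p) := by
      simp only [smul_sub, Finset.sum_sub_distrib, ← Finset.sum_smul, sum_patternWeight, one_smul]
      rfl
    rw [h1]
    calc _ ≤ ∑ A ∈ (Finset.range (n + 1) ×ˢ Finset.range R).powerset, S.patternWeight κ n R p A * ε := by
          refine norm_sum_le_of_le _ fun A hA => ?_
          have hw0 : 0 ≤ S.patternWeight κ n R p A := thresholdWeight_nonneg _ _ _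
          rw [norm_smul, Real.norm_eq_abs, abs_of_nonneg hw0]
          by_cases hw : S.patternWeight κ n R p A = 0
          · rw [hw, zero_mul, zero_mul]
          refine mul_le_mul_of_nonneg_left ?_ hw0
          rw [← dist_eq_norm]
          refine ((hd _ (hr0 _ (κ_pos 0)) _ (patternPoint_mem hRS hn hp hA hw) _ hp ?_).trans_le
            (min_le_left _ _)).le
          rw [dist_eq_norm]
          have e0 := norm_nonneg (S.patternPoint R A p - p)
          have e1 := hy A hA hw (by rw [patternValue_zero hRS hp hA hw]; exact one_pos)
          have e2 := hdist 0 (Nat.zero_le n)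
          linarith
      _ = ε := by rw [← Finset.sum_mul, sum_patternWeight, one_mul]

end ColoredTriangulation

end Approximation

/-! ### The isotopy over a compact polyhedron. -/

section CompactCore

open ColoredTriangulation in
/-- The isotopy theorem for a compact polyhedron, in terms of the second components of the lifts. -/
theorem exists_fiberwise_isotopy.{u} {V W K : Type} [NormedAddCommGroup V] [NormedSpace ℝ V]
    [NormedAddCommGroup W] [NormedSpace ℝ W] [NormedAddCommGroup K] [NormedSpace ℝ K]
    [FiniteDimensional ℝ V] [FiniteDimensional ℝ W] {f : V → W} {N N₀ : Set V} {g : V → K}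
    (hN : IsCompactPolyhedron N) (hf : IsCompactPL f N) (hnd : NonDegenerateOn f N)
    (hg : ContinuousOn g N) (hinj : FiberInjOn f N g) (hN₀ : N₀ ⊆ N) (hg₀ : IsCompactPL g N₀) {ε : ℝ}
    (hε : 0 < ε) : ∃ δ > 0, ∃ g' : V → K, IsCompactPL g' N ∧ FiberInjOn f N g' ∧
      ∀ (X : Type u) [TopologicalSpace X] (Y : Set X) (G : X → V → K),
        ContinuousOn (fun z : X × V => G z.1 z.2) (univ ×ˢ N) → (∀ x, FiberInjOn f N (G x)) →
        (∀ x, ∀ p ∈ N, ‖G x p - g p‖ < δ) → (∀ x ∈ Y, EqOn (G x) g N₀) →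
        ∃ H : X × ℝ → V → K, ContinuousOn (fun z : (X × ℝ) × V => H z.1 z.2) (univ ×ˢ N) ∧
          (∀ z, FiberInjOn f N (H z)) ∧ (∀ x, EqOn (H (x, 0)) (G x) N) ∧ (∀ x, EqOn (H (x, 1)) g' N) ∧
          (∀ z, ∀ p ∈ N, ‖H z p - g p‖ < ε) ∧ ∀ x ∈ Y, ∀ t, EqOn (H (x, t)) g N₀ := by
  obtain ⟨H₁, hH₁, hN₁, hf₁⟩ := hf.exists_cellwiseAffine
  obtain ⟨H₂, hH₂, hN₂, hg₂⟩ := hg₀.exists_cellwiseAffine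
  obtain ⟨S, hS⟩ := exists_coloredTriangulation hN.isCompact.isBounded (hH₁.union hH₂)
    (hN₁.mono subset_union_left) (hf₁.mono subset_union_left subset_rfl) hnd
  have hS₀ := hS K N₀ g hN₀ (hN₂.mono subset_union_right) (hg₂.mono subset_union_right subset_rfl)
  obtain ⟨n, hn⟩ : ∃ n, ∀ a, S.c a ≤ n := ⟨Finset.univ.sup S.c, fun a => Finset.le_sup (Finset.mem_univ a)⟩
  obtain ⟨δ₀, hδ₀, η, hη₀⟩ := S.exists_goodScales hN.isCompact hf.continuousOn hg hinj n (half_pos hε)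
  set δ := min δ₀ (ε / 4) with hδ
  have hδpos : 0 < δ := lt_min hδ₀ (by linarith)
  have hη : S.GoodScales n g (ε / 2) δ η := ⟨hη₀.mem, hη₀.eps, fun i hi => by
    obtain ⟨b, h1, h2⟩ := hη₀.sep i hi
    exact ⟨b, (mul_le_mul_of_nonneg_left (min_le_left _ _) (by norm_num)).trans_lt h1, h2⟩⟩
  obtain ⟨g', hg', hg'inj, hg'g, hg'₀⟩ := S.exists_isCompactPL_approx hN hf.continuousOn hg hinj hN₀ hS₀ hδpos
  refine ⟨δ, hδpos, g', hg', hg'inj, fun X _ Y G hG hGinj hGδ hGY => ?_⟩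
  -- `β` interpolates from `G` to `g'` during the middle third. The coning time `σ` rises from `0`
  -- to `1` in the first third and returns to `0` in the last, so interpolation happens only under
  -- full coning.
  set β : ℝ → ℝ := fun t => max 0 (min 1 (3 * t - 1)) with hβ
  set σ : ℝ → ℝ := fun t => max 0 (min 1 (min (3 * t) (3 - 3 * t))) with hσ
  have hβ01 : ∀ t, 0 ≤ β t ∧ β t ≤ 1 := fun t => ⟨le_max_left _ _, max_le zero_le_one (min_le_left _ _)⟩
  have hσ01 : ∀ t, σ t ∈ Icc (0 : ℝ) 1 := fun t => ⟨le_max_left _ _, max_le zero_le_one (min_le_left _ _)⟩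
  set M : X × ℝ → V → K := fun z p => (1 - β z.2) • G z.1 p + β z.2 • g' p with hM
  have hMδ : ∀ z, ∀ p ∈ N, ‖M z p - g p‖ ≤ δ := fun z p hp => by
    rw [show M z p - g p = (1 - β z.2) • (G z.1 p - g p) + β z.2 • (g' p - g p) by
      simp only [hM, smul_sub, sub_smul, one_smul]; abel]
    exact norm_combo_le (hβ01 _).1 (hβ01 _).2 (hGδ _ p hp).le (hg'g p hp)
  have hMG : ∀ x t, t ≤ 1 / 3 → M (x, t) = G x := fun x t ht => by
    have : β t = 0 := max_eq_left ((min_le_right _ _).trans (by linarith))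
    funext p
    simp [hM, this]
  have hMg : ∀ x t, 2 / 3 ≤ t → M (x, t) = g' := fun x t ht => by
    have : β t = 1 := by simp only [hβ]; rw [min_eq_left (by linarith), max_eq_right zero_le_one]
    funext p
    simp [hM, this]
  have hscale0 : ∀ t, σ t = 0 → ∀ j, 0 ≤ j → scalesAt η n (σ t) j = 0 := fun t ht j _ => by
    rw [scalesAt, ht, mul_zero, zero_sub, max_eq_left ((min_le_right _ _).trans (by simp)), mul_zero]
  refine ⟨fun z => S.coneIter (scalesAt η n (σ z.2)) 0 n (M z), ?_, fun z => ?_, fun x => ?_, fun x => ?_,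
    fun z p hp => ?_, fun x hx t => ?_⟩
  · refine continuousOn_coneIter (S := S) (η := fun z : X × ℝ => scalesAt η n (σ z.2)) (G := M) hN.isCompact
      (fun i => (continuous_scalesAt η n i).comp (by fun_prop)) (fun z i => scalesAt_mem hη.mem n _ i) ?_ 0 n
    have hβc : Continuous fun z : (X × ℝ) × V => β z.1.2 := by fun_prop
    refine ((continuous_const.sub hβc).continuousOn.smul (hG.comp (f := fun z : (X × ℝ) × V => (z.1.1, z.2))
      (by fun_prop) fun z hz => ⟨mem_univ _, hz.2⟩)).add (hβc.continuousOn.smul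
      (hg'.continuousOn.comp (f := fun z : (X × ℝ) × V => z.2) (by fun_prop) fun z hz => hz.2))
  · refine hη.fiberInjOn_scalesAt hn (hσ01 _) (hMδ z) ?_
    -- In the outer thirds the coned function is `G` or `g'`, injective by hypothesis. In the middle
    -- it may fail to be injective, but all cones are fully on.
    rcases le_total z.2 (1 / 3) with h1 | h1
    · exact Or.inr (by rw [show M z = G z.1 from hMG z.1 z.2 h1]; exact hGinj _)
    rcases le_total (2 / 3) z.2 with h2 | h2
    · exact Or.inr (by rw [show M z = g' from hMg z.1 z.2 h2]; exact hg'inj)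
    · left
      simp only [hσ]
      rw [min_eq_left (le_min (by linarith) (by linarith)), max_eq_right zero_le_one]
  · have h0 : σ 0 = 0 := by simp [hσ]
    have := coneIter_eqOn_of_zero (S := S) (scalesAt_mem hη.mem n (σ 0)) 0 n (hscale0 0 h0) (M (x, 0))
    rw [hMG x 0 (by norm_num)] at this
    simp only [hMG x 0 (by norm_num)]
    exact this
  · have h0 : σ 1 = 0 := by norm_num [hσ]
    have := coneIter_eqOn_of_zero (S := S) (scalesAt_mem hη.mem n (σ 1)) 0 n (hscale0 1 h0) (M (x, 1))
    rw [hMg x 1 (by norm_num)] at this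
    simp only [hMg x 1 (by norm_num)]
    exact this
  · have h1 := hη.norm_coneIter_scalesAt_le (half_pos hε).le (σ z.2) (hMδ z) p hp
    have h2 : δ ≤ ε / 4 := min_le_right _ _
    dsimp only
    linarith
  · refine coneIter_eq_of_affineOnSimplices hS₀ hN₀ (scalesAt_mem hη.mem n _) (fun p hp => ?_) 0 n
    simp only [hM]
    rw [hGY x hx hp, hg'₀ hp, ← add_smul, sub_add_cancel, one_smul]

end CompactCore

/-! ### From fibrewise injectivity to topological embeddings. -/

section FiberwiseEmbedding

/-- A continuous family of injective maps of a compact space is a closed embedding. -/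
theorem isClosedEmbedding_of_fiberwise_injective {A Z B : Type*} [TopologicalSpace A] [TopologicalSpace Z]
    [TopologicalSpace B] [CompactSpace A] [T2Space B] {F : A × Z → B} (hF : Continuous F)
    (hinj : ∀ z a a', F (a, z) = F (a', z) → a = a') :
    IsClosedEmbedding (fun y : A × Z => (F y, y.2)) := by
  refine IsClosedEmbedding.of_continuous_injective_isClosedMap (hF.prodMk continuous_snd) ?_ ?_
  · rintro ⟨a, z⟩ ⟨a', z'⟩ h
    obtain rfl : z = z' := congrArg Prod.snd h
    rw [hinj z a a' (congrArg Prod.fst h)]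
  · intro C hC
    -- The image of `C` is the projection, along the compact factor `A`, of this part of the graph,
    -- and such projections are closed maps.
    have h1 : IsClosed {y : A × (B × Z) | (y.1, y.2.2) ∈ C ∧ F (y.1, y.2.2) = y.2.1} :=
      (hC.preimage (by fun_prop)).inter (isClosed_eq (hF.comp (by fun_prop)) (by fun_prop))
    convert isClosedMap_snd_of_compactSpace _ h1 using 1
    ext ⟨b, z⟩
    constructor
    · rintro ⟨⟨a, z'⟩, hC, h⟩
      obtain rfl : z' = z := congrArg Prod.snd h
      exact ⟨(a, (b, z')), ⟨hC, congrArg Prod.fst h⟩, rfl⟩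
    · rintro ⟨⟨a, b', z'⟩, ⟨h1, h2⟩, h3⟩
      obtain rfl : b' = b := congrArg Prod.fst h3
      obtain rfl : z' = z := congrArg Prod.snd h3
      exact ⟨(a, z'), h1, Prod.ext h2 rfl⟩

/-- A fibrewise injective homotopy of lifts is a topological isotopy. -/
theorem isEmbeddingOn_track {V W K U : Type*} [TopologicalSpace V] [TopologicalSpace W] [TopologicalSpace K]
    [T2Space W] [T2Space K] [TopologicalSpace U] {f : V → W} {N : Set V} (hN : IsCompact N)
    (hf : ContinuousOn f N) {X : Set U} {h : (V × U) × ℝ → K} (hh : ContinuousOn h ((N ×ˢ X) ×ˢ Icc (0 : ℝ) 1))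
    (hinj : ∀ x ∈ X, ∀ t ∈ Icc (0 : ℝ) 1, FiberInjOn f N fun p => h ((p, x), t)) :
    IsEmbeddingOn (track fun z : (V × U) × ℝ => ((f z.1.1, h z), z.1.2)) ((N ×ˢ X) ×ˢ Icc (0 : ℝ) 1) := by
  have : CompactSpace N := isCompact_iff_compactSpace.1 hN
  let F : N × (X × Icc (0 : ℝ) 1) → W × K := fun y => (f y.1, h ((y.1, y.2.1), y.2.2))
  have hF : Continuous F := by
    refine (hf.domRestrict.comp continuous_fst).prodMk ?_
    exact hh.comp_continuous (f := fun y : N × (X × Icc (0 : ℝ) 1) => (((y.1 : V), (y.2.1 : U)), (y.2.2 : ℝ))) (by fun_prop)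
      fun y => ⟨⟨y.1.2, y.2.1.2⟩, y.2.2.2⟩
  have h1 := isClosedEmbedding_of_fiberwise_injective hF fun z a a' haa =>
    Subtype.ext (hinj z.1 z.1.2 z.2 z.2.2 a a.2 a' a'.2 (congrArg Prod.fst haa) (congrArg Prod.snd haa))
  let e : ((N ×ˢ X) ×ˢ Icc (0 : ℝ) 1 : Set ((V × U) × ℝ)) → N × (X × Icc (0 : ℝ) 1) := fun z =>
    (⟨z.1.1.1, z.2.1.1⟩, ⟨⟨z.1.1.2, z.2.1.2⟩, ⟨z.1.2, z.2.2⟩⟩)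
  have he : IsEmbedding e := by
    refine IsEmbedding.of_comp (g := fun y : N × (X × Icc (0 : ℝ) 1) => (((y.1 : V), (y.2.1 : U)), (y.2.2 : ℝ))) ?_ (by fun_prop)
      IsEmbedding.subtypeVal
    exact (Continuous.subtype_mk (by fun_prop) _).prodMk
      ((Continuous.subtype_mk (by fun_prop) _).prodMk (Continuous.subtype_mk (by fun_prop) _))
  have hi : IsEmbedding fun y : (W × K) × (X × Icc (0 : ℝ) 1) => ((y.1, (y.2.1 : U)), (y.2.2 : ℝ)) :=
    (Homeomorph.prodAssoc (W × K) U ℝ).symm.isEmbedding.comp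
      (IsEmbedding.id.prodMap (IsEmbedding.subtypeVal.prodMap IsEmbedding.subtypeVal))
  exact (hi.comp h1.isEmbedding).comp he

end FiberwiseEmbedding

/-! ### Products with the identity of a parameter space. -/

section Products

theorem fiberInjOn_prodMap_id {V W K Z : Type*} {f : V → W} {N : Set V} {Q : Set Z} {g : V × Z → K} :
    FiberInjOn (Prod.map f (id : Z → Z)) (N ×ˢ Q) g ↔ ∀ z ∈ Q, FiberInjOn f N fun p => g (p, z) := by
  constructor
  · intro h z hz p hp q hq hpq hg
    exact congrArg Prod.fst (h (p, z) ⟨hp, hz⟩ (q, z) ⟨hq, hz⟩ (by simp [hpq]) hg)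
  · rintro h ⟨p, z⟩ ⟨hp, hz⟩ ⟨q, z'⟩ ⟨hq, -⟩ hpq hg
    obtain ⟨h1, rfl⟩ : f p = f q ∧ z = z' := by simpa [Prod.map] using hpq
    rw [h z hz p hp q hq h1 hg]

variable {V W K Z : Type} [NormedAddCommGroup V] [NormedSpace ℝ V]
  [NormedAddCommGroup W] [NormedSpace ℝ W] [NormedAddCommGroup K] [NormedSpace ℝ K]
  [NormedAddCommGroup Z] [NormedSpace ℝ Z] {f : V → W} {N : Set V} {Q : Set Z}

/-- A segment in a fibre of `f × id` has constant second coordinate, so it projects to a non-trivial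
segment in a fibre of `f`. -/
theorem NonDegenerateOn.prodMap_id {W' : Type} {f : V → W'} (hnd : NonDegenerateOn f N) (Q : Set Z) :
    NonDegenerateOn (Prod.map f (id : Z → Z)) (N ×ˢ Q) := by
  classical
  rintro ⟨w, z⟩ s - hs
  by_contra! hcard
  obtain ⟨a, ha, b, hb, hab⟩ := Finset.one_lt_card.1 (show 1 < s.card by omega)
  have hsub : ∀ y ∈ segment ℝ a b, y.1 ∈ N ∩ f ⁻¹' {w} ∧ y.2 = z := fun y hy => by
    obtain ⟨h1, h2⟩ := hs (segment_subset_convexHull (𝕜 := ℝ) ha hb hy)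
    simp only [mem_preimage, mem_singleton_iff, Prod.map, id, Prod.mk.injEq] at h2
    exact ⟨⟨h1.1, h2.1⟩, h2.2⟩
  have hab' : a.1 ≠ b.1 := fun h => hab (Prod.ext h
    ((hsub a (left_mem_segment ℝ a b)).2.trans (hsub b (right_mem_segment ℝ a b)).2.symm))
  have h1 := hnd w {a.1, b.1} ?_ ?_
  · rw [Finset.card_pair hab'] at h1
    omega
  · refine ((affineIndependent_of_ne ℝ hab').range).mono (s := (({a.1, b.1} : Finset V) : Set V)) ?_
    simp [Set.pair_subset_iff]
  · rw [Finset.coe_pair, convexHull_pair]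
    rintro y ⟨α, β, hα, hβ, hαβ, rfl⟩
    exact (hsub (α • a + β • b) ⟨α, β, hα, hβ, hαβ, rfl⟩).1

theorem IsCompactPL.prodMap_id [FiniteDimensional ℝ V] [FiniteDimensional ℝ Z] (hf : IsCompactPL f N)
    (hQ : IsCompactPolyhedron Q) : IsCompactPL (Prod.map f (id : Z → Z)) (N ×ˢ Q) := by
  have hNQ := hf.isCompactPolyhedron.prod hQ
  exact (hf.comp_affineMap hNQ (LinearMap.fst ℝ V Z).toAffineMap fun _ h => h.1).prodMk
    (hNQ.isCompactPL_affine (LinearMap.snd ℝ V Z).toAffineMap)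

end Products

/-! ### Polyhedrality of the set of parameters where two PL families agree. -/

section ZeroFibers

variable {V U K : Type} [NormedAddCommGroup V] [NormedSpace ℝ V] [NormedAddCommGroup U] [NormedSpace ℝ U]
  [NormedAddCommGroup K] [NormedSpace ℝ K]

theorem IsCompactPolyhedron.image_affineMap {P : Set V} (hP : IsCompactPolyhedron P) (A : V →ᵃ[ℝ] U) :
    IsCompactPolyhedron (A '' P) := by
  classical
  obtain ⟨C, rfl⟩ := hP
  refine ⟨C.image fun F => F.image A, ?_⟩
  simp [image_iUnion, AffineMap.image_convexHull]

theorem tendsto_lineMap_apply (h : V →ᵃ[ℝ] ℝ) (a b : V) (s : ℝ) :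
    Filter.Tendsto (fun s : ℝ => h (AffineMap.lineMap a b s)) (𝓝 s) (𝓝 (h (AffineMap.lineMap a b s))) := by
  have h1 : ∀ s : ℝ, h (AffineMap.lineMap a b s) = h a + s * (h b - h a) := fun s => by
    rw [AffineMap.apply_lineMap, AffineMap.lineMap_apply]; simp; ring
  simp only [h1]
  exact Continuous.tendsto (by fun_prop) _

/-- Points of a segment near its endpoint have this endpoint in their closed cell. -/
theorem exists_mem_closedCell_lineMap {H : Set (V →ᵃ[ℝ] ℝ)} (hH : H.Finite) (a b : V) :
    ∃ s : ℝ, 0 < s ∧ s < 1 ∧ a ∈ closedCell H (AffineMap.lineMap a b s) := by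
  have h1 : ∀ᶠ s : ℝ in 𝓝 0, a ∈ closedCell H (AffineMap.lineMap a b s) := by
    refine (Filter.eventually_all_finite hH).2 fun h _ => ?_
    have ht := tendsto_lineMap_apply h a b 0
    rw [AffineMap.lineMap_apply_zero] at ht
    rcases lt_trichotomy (h a) 0 with h0 | h0 | h0
    · exact (ht.eventually (gt_mem_nhds h0)).mono fun s hs => ⟨fun h2 => absurd h2 (not_le.2 hs), fun _ => h0.le⟩
    · exact Filter.Eventually.of_forall fun s => ⟨fun _ => h0.ge, fun _ => h0.le⟩
    · exact (ht.eventually (lt_mem_nhds h0)).mono fun s hs => ⟨fun _ => h0.le, fun h2 => absurd h2 (not_le.2 hs)⟩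
  have h2 : ∀ᶠ s : ℝ in 𝓝[>] 0, s < 1 := nhdsWithin_le_nhds (gt_mem_nhds one_pos)
  obtain ⟨s, hs, h3, h4⟩ := ((eventually_mem_nhdsWithin (s := Ioi (0 : ℝ))).and (h2.and (nhdsWithin_le_nhds h1))).exists
  exact ⟨s, hs, h3, h4⟩

/-- A segment from a point of the closed cell of `x` to `x` can be extended beyond `x` inside the cell. -/
theorem exists_lineMap_mem_closedCell {H : Set (V →ᵃ[ℝ] ℝ)} (hH : H.Finite) {x x' : V}
    (hx' : x' ∈ closedCell H x) {s : ℝ} (hs0 : 0 < s) (hs1 : s < 1) :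
    ∃ τ : ℝ, 1 < τ ∧ AffineMap.lineMap x' x τ ∈ closedCell H (AffineMap.lineMap x' x s) := by
  have h1 : ∀ᶠ τ : ℝ in 𝓝 1, AffineMap.lineMap x' x τ ∈ closedCell H (AffineMap.lineMap x' x s) := by
    refine (Filter.eventually_all_finite hH).2 fun h hh => ?_
    have ht := tendsto_lineMap_apply h x' x 1
    rw [AffineMap.lineMap_apply_one] at ht
    have hl : ∀ s : ℝ, h (AffineMap.lineMap x' x s) = (1 - s) * h x' + s * h x := fun s => by
      rw [AffineMap.apply_lineMap, AffineMap.lineMap_apply]; simp; ring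
    rcases lt_trichotomy (h x) 0 with h0 | h0 | h0
    · have h2 := (hx' h hh).2 h0.le
      have h3 : h (AffineMap.lineMap x' x s) < 0 := by rw [hl]; nlinarith
      exact (ht.eventually (gt_mem_nhds h0)).mono fun τ hτ => ⟨fun h4 => absurd h4 (not_le.2 h3), fun _ => hτ.le⟩
    · have h2 : h x' = 0 := le_antisymm ((hx' h hh).2 h0.le) ((hx' h hh).1 h0.ge)
      exact Filter.Eventually.of_forall fun τ => by rw [hl, hl, h0, h2]; simp
    · have h2 := (hx' h hh).1 h0.le
      have h3 : 0 < h (AffineMap.lineMap x' x s) := by rw [hl]; nlinarith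
      exact (ht.eventually (lt_mem_nhds h0)).mono fun τ hτ => ⟨fun _ => hτ.le, fun h4 => absurd h4 (not_le.2 h3)⟩
  obtain ⟨τ, hτ, h3⟩ := ((eventually_mem_nhdsWithin (s := Ioi (1 : ℝ))).and (nhdsWithin_le_nhds h1)).exists
  exact ⟨τ, hτ, h3⟩

variable [FiniteDimensional ℝ V]

theorem isCompactPolyhedron_closedCell {H : Set (V →ᵃ[ℝ] ℝ)} (hH : H.Finite) {p : V}
    (hb : Bornology.IsBounded (closedCell H p)) : IsCompactPolyhedron (closedCell H p) :=
  isCompactPolyhedron_of_adapted hH hb fun _ hq => closedCell_subset_of_mem hq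

variable [FiniteDimensional ℝ U]

/-- The parameters for which a nonnegative piecewise linear family of functions vanishes form a
polyhedron. -/
theorem isCompactPolyhedron_zeroFibers {P : Set V} {Q : Set U} (hQ : IsCompactPolyhedron Q) {w : V × U → ℝ}
    (hw : IsCompactPL w (P ×ˢ Q)) (hw0 : ∀ z ∈ P ×ˢ Q, 0 ≤ w z) :
    IsCompactPolyhedron {x ∈ Q | ∀ p ∈ P, w (p, x) = 0} := by
  obtain ⟨L, hL, hLa, hLw⟩ := hw.exists_cellwiseAffine
  obtain ⟨H₀, hH₀, hH₀Q⟩ := hQ.exists_adapted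
  -- The arrangement in the parameter space is adapted to the projections of all cells on which `w`
  -- is affine.
  have hcell : ∀ c ∈ P ×ˢ Q, ∃ H : Set (U →ᵃ[ℝ] ℝ), H.Finite ∧ Adapted H (Prod.snd '' closedCell L c) := by
    intro c hc
    exact ((isCompactPolyhedron_closedCell hL (hw.isCompactPolyhedron.isCompact.isBounded.subset
      (hLa c hc))).image_affineMap (LinearMap.snd ℝ V U).toAffineMap).exists_adapted
  have hcell' : ∀ S : Set (V × U), ∃ H : Set (U →ᵃ[ℝ] ℝ), S ∈ closedCell L '' (P ×ˢ Q) →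
      H.Finite ∧ Adapted H (Prod.snd '' S) := by
    intro S
    by_cases hS : S ∈ closedCell L '' (P ×ˢ Q)
    · obtain ⟨c, hc, rfl⟩ := hS
      exact (hcell c hc).imp fun _ h _ => h
    · exact ⟨∅, fun h => absurd h hS⟩
  choose HS hHS using hcell'
  have hfin : (closedCell L '' (P ×ˢ Q)).Finite := (finite_range_closedCell hL).subset (image_subset_range _ _)
  set H := H₀ ∪ ⋃ S ∈ closedCell L '' (P ×ˢ Q), HS S with hH
  have hHfin : H.Finite := hH₀.union (hfin.biUnion fun S hS => (hHS S hS).1)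
  refine isCompactPolyhedron_of_adapted hHfin (hQ.isCompact.isBounded.subset (sep_subset _ _)) ?_
  rintro x ⟨hxQ, hx⟩ x' hx'
  have hHQ : closedCell H x ⊆ Q := (hH₀Q.mono subset_union_left) x hxQ
  refine ⟨hHQ hx', fun p hp => ?_⟩
  -- The point `c` lies on the way from `(p, x')` to `(p, x)`, so near the start that its closed
  -- cell contains `(p, x')`.
  obtain ⟨s, hs0, hs1, hs⟩ := exists_mem_closedCell_lineMap hL (p, x') (p, x)
  set c : V × U := AffineMap.lineMap (p, x') (p, x) s with hc
  have hc1 : c.1 = p := by simp [hc, AffineMap.lineMap_apply]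
  have hc2 : c.2 = AffineMap.lineMap x' x s := by simp [hc, AffineMap.lineMap_apply]
  have hcm : c ∈ P ×ˢ Q := ⟨by rw [hc1]; exact hp, by
    rw [hc2]
    exact hHQ ((convex_closedCell H x).lineMap_mem hx' (mem_closedCell_self H x) ⟨hs0.le, hs1.le⟩)⟩
  have hCm : closedCell L c ∈ closedCell L '' (P ×ˢ Q) := mem_image_of_mem _ hcm
  obtain ⟨τ, hτ, hτm⟩ := exists_lineMap_mem_closedCell hHfin hx' hs0 hs1
  have hadp := (hHS _ hCm).2.mono (show HS (closedCell L c) ⊆ H from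
    (subset_biUnion_of_mem hCm).trans subset_union_right)
  rw [← hc2] at hτm
  -- By adaptedness the projection of the cell of `c` reaches beyond `x`. So a segment inside that
  -- cell, starting at `(p, x')`, has over `x` an interior point `y`. There `w` vanishes, and as `w`
  -- is affine and nonnegative on the segment it vanishes at the start too. The point `y` may lie
  -- over another point of `P`, so vanishing for all points of `P` is what is used.
  obtain ⟨⟨p'', x''⟩, hC'', hx''⟩ := hadp c.2 ⟨c, mem_closedCell_self L c, rfl⟩ hτm
  obtain rfl : x'' = AffineMap.lineMap x' x τ := hx''
  obtain ⟨A, hA⟩ := hLw c hcm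
  have hτ0 : 0 < τ := one_pos.trans hτ
  set y : V × U := AffineMap.lineMap (p, x') (p'', AffineMap.lineMap x' x τ) (1 / τ) with hy
  have hyC : y ∈ closedCell L c := (convex_closedCell L c).lineMap_mem hs hC''
    ⟨by positivity, by rw [div_le_one hτ0]; exact hτ.le⟩
  have hy2 : y.2 = x := by
    have : y.2 = AffineMap.lineMap x' (AffineMap.lineMap x' x τ) (1 / τ) := by simp [hy, AffineMap.lineMap_apply]
    rw [this]
    simp only [AffineMap.lineMap_apply, vsub_eq_sub, vadd_eq_add, add_sub_cancel_right, smul_smul]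
    rw [one_div_mul_cancel hτ0.ne', one_smul, sub_add_cancel]
  have hwy : w y = 0 := by
    have h1 := hx y.1 (hLa c hcm hyC).1
    rwa [← hy2] at h1
  have h2 : w y = w (p, x') + 1 / τ * (w (p'', AffineMap.lineMap x' x τ) - w (p, x')) := by
    rw [hA hyC, hA hs, hA hC'', hy, AffineMap.apply_lineMap, AffineMap.lineMap_apply]
    simp; ring
  have h3 := hw0 _ (hLa c hcm hs)
  have h4 := hw0 _ (hLa c hcm hC'')
  have h5 : 0 < 1 / τ := by positivity
  have h6 : 1 / τ < 1 := by rw [div_lt_one hτ0]; exact hτ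
  rw [hwy] at h2
  nlinarith [mul_nonneg h5.le h4]

/-- The parameters for which a piecewise linear family of maps coincides with a given map form a
polyhedron. -/
theorem isCompactPolyhedron_eqFibers [FiniteDimensional ℝ K] {P : Set V} {Q : Set U} (hP : IsCompactPolyhedron P)
    (hQ : IsCompactPolyhedron Q) {u : V × U → K} (hu : IsCompactPL u (P ×ˢ Q)) {g : V → K}
    (hg : IsCompactPL g P) : IsCompactPolyhedron {x ∈ Q | ∀ p ∈ P, u (p, x) = g p} := by
  have hPQ := hP.prod hQ
  let b := Module.finBasis ℝ K
  have hg' := hg.comp_affineMap hPQ (LinearMap.fst ℝ V U).toAffineMap fun _ h => h.1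
  have hd : IsCompactPL (fun z : V × U => u z - g z.1) (P ×ˢ Q) :=
    (hu.prodMk hg').affine_comp (LinearMap.fst ℝ K K - LinearMap.snd ℝ K K).toAffineMap
  have hi : ∀ i, IsCompactPL (fun z : V × U => |b.coord i (u z - g z.1)|) (P ×ˢ Q) := fun i =>
    have h1 : IsCompactPL (fun z : V × U => b.coord i (u z - g z.1)) (P ×ˢ Q) :=
      hd.affine_comp (b.coord i).toAffineMap
    h1.max h1.neg
  convert isCompactPolyhedron_zeroFibers (P := P) hQ (w := fun z : V × U => ∑ i, |b.coord i (u z - g z.1)|)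
    (isCompactPL_sum hPQ _ fun i _ => hi i) (fun z _ => Finset.sum_nonneg fun i _ => abs_nonneg _) using 1
  ext x
  refine and_congr_right fun _ => forall₂_congr fun p _ => ?_
  rw [Finset.sum_eq_zero_iff_of_nonneg fun i _ => abs_nonneg _, ← sub_eq_zero, ← b.forall_coord_eq_zero_iff]
  simp

end ZeroFibers

/-! ### Making a homotopy PL over a noncompact parameter polyhedron. -/

section PiecewiseLinearHomotopy

/-- The domain `N × Q × I` of a homotopy of families. -/
abbrev cylinder {V U : Type*} (N : Set V) (Q : Set U) : Set ((V × U) × ℝ) := (N ×ˢ Q) ×ˢ Icc (0 : ℝ) 1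

theorem fiberInjOn_cylinder {V W K U : Type*} {f : V → W} {N : Set V} {Q : Set U} {g : (V × U) × ℝ → K} :
    FiberInjOn (Prod.map (Prod.map f (id : U → U)) (id : ℝ → ℝ)) (cylinder N Q) g ↔
      ∀ x ∈ Q, ∀ t ∈ Icc (0 : ℝ) 1, FiberInjOn f N fun p => g ((p, x), t) := by
  rw [fiberInjOn_prodMap_id]
  simp only [fiberInjOn_prodMap_id]
  exact ⟨fun h x hx t ht => h t ht x hx, fun h t ht x hx => h x hx t ht⟩

variable {V W K U : Type} [NormedAddCommGroup V] [NormedSpace ℝ V]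
  [NormedAddCommGroup W] [NormedSpace ℝ W] [NormedAddCommGroup K] [NormedSpace ℝ K]
  [NormedAddCommGroup U] [NormedSpace ℝ U]

theorem isCompactPolyhedron_Icc (a b : ℝ) (hab : a ≤ b) : IsCompactPolyhedron (Icc a b) :=
  ⟨{{a, b}}, by simp [convexHull_pair, segment_eq_Icc hab]⟩

variable [FiniteDimensional ℝ V] [FiniteDimensional ℝ W] [FiniteDimensional ℝ U]

theorem IsPolyhedron.exists_nhd {X : Set U} (hX : IsPolyhedron X) {x : U} (hx : x ∈ X) :
    ∃ (P Q : Set U) (ψ : U → ℝ), IsCompactPolyhedron P ∧ P ⊆ X ∧ IsCompactPolyhedron Q ∧ Q ⊆ X ∧ Q ∈ 𝓝[X] x ∧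
      Continuous ψ ∧ (∀ y ∈ Q, 2 ≤ ψ y) ∧ ∀ y ∈ X, 0 < ψ y → y ∈ P := by
  classical
  obtain ⟨P, hP, hPX, hPx⟩ := hX x hx
  obtain ⟨r, hr, hrP⟩ := Metric.mem_nhdsWithin_iff.1 hPx
  obtain ⟨b, hb1, hb2⟩ := exists_mem_interior_convexHull_affineBasis (Metric.closedBall_mem_nhds x
    (show 0 < r / 3 by positivity))
  have hb : IsCompactPolyhedron (convexHull ℝ (range b)) := by
    have := isCompactPolyhedron_convexHull (Finset.univ.image b)
    rwa [Finset.coe_image, Finset.coe_univ, image_univ] at this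
  refine ⟨P, P ∩ convexHull ℝ (range b), fun y => 3 - dist y x / (r / 3), hP, hPX, hP.inter hb,
    inter_subset_left.trans hPX, Filter.inter_mem hPx (nhdsWithin_le_nhds (mem_interior_iff_mem_nhds.1 hb1)),
    -- The cut-off `3 - dist y x / (r / 3)` is at least `2` within distance `r / 3` of `x`, where
    -- `Q` lies, and positive only within distance `r`, where `X` lies in `P`.
    by fun_prop, fun y hy => ?_, fun y hy h => hrP ⟨?_, hy⟩⟩
  · have h1 : dist y x / (r / 3) ≤ 1 := by
      rw [div_le_one (by positivity)]
      exact hb2 hy.2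
    linarith
  · have h1 : dist y x / (r / 3) < 3 := by linarith
    rw [div_lt_iff₀ (by positivity)] at h1
    rw [Metric.mem_ball]
    linarith

/-- A countable family of polyhedral neighbourhoods with cut-off functions. -/
theorem IsPolyhedron.exists_exhaustion {X : Set U} (hX : IsPolyhedron X) :
    ∃ (P Q : ℕ → Set U) (ψ : ℕ → U → ℝ), (∀ i, IsCompactPolyhedron (P i) ∧ P i ⊆ X ∧ IsCompactPolyhedron (Q i) ∧
      Q i ⊆ X ∧ Continuous (ψ i) ∧ (∀ y ∈ Q i, 2 ≤ ψ i y) ∧ ∀ y ∈ X, 0 < ψ i y → y ∈ P i) ∧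
      ∀ x ∈ X, ∃ i, Q i ∈ 𝓝[X] x := by
  have : ProperSpace U := FiniteDimensional.proper ℝ U
  rcases X.eq_empty_or_nonempty with rfl | hne
  · exact ⟨fun _ => ∅, fun _ => ∅, fun _ _ => 0, fun _ => ⟨⟨∅, by simp⟩, subset_rfl, ⟨∅, by simp⟩, subset_rfl,
      continuous_const, by simp, by simp⟩, by simp⟩
  choose! P Q ψ hP hPX hQ hQX hQx hψ hψQ hψP using fun x (hx : x ∈ X) => hX.exists_nhd hx
  obtain ⟨t, htX, htc, ht⟩ := TopologicalSpace.countable_cover_nhdsWithin (f := fun x => {y | Q x ∈ 𝓝[X] y})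
    fun x hx => eventually_eventually_nhdsWithin.2 (hQx x hx)
  have htne : t.Nonempty := by
    obtain ⟨x, hx⟩ := hne
    obtain ⟨i, hi, -⟩ := mem_iUnion₂.1 (ht hx)
    exact ⟨i, hi⟩
  obtain ⟨c, rfl⟩ := htc.exists_eq_range htne
  have hc : ∀ i, c i ∈ X := fun i => htX (mem_range_self i)
  refine ⟨fun i => P (c i), fun i => Q (c i), fun i => ψ (c i), fun i => ⟨hP _ (hc i), hPX _ (hc i), hQ _ (hc i),
    hQX _ (hc i), hψ _ (hc i), hψQ _ (hc i), hψP _ (hc i)⟩, fun x hx => ?_⟩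
  obtain ⟨_, ⟨i, rfl⟩, hi⟩ := mem_iUnion₂.1 (ht hx)
  exact ⟨i, hi⟩

variable {f : V → W} {N : Set V}

/-- A homotopy can be made piecewise linear over a compact part of the parameter space. -/
theorem exists_piecewiseLinear_modification (hN : IsCompactPolyhedron N) (hf : IsCompactPL f N)
    (hnd : NonDegenerateOn f N) {X P Q : Set U} (hP : IsCompactPolyhedron P) (hPX : P ⊆ X)
    (hQ : IsCompactPolyhedron Q) (hQX : Q ⊆ X) {ψ : U → ℝ} (hψ : Continuous ψ) (hψQ : ∀ y ∈ Q, 2 ≤ ψ y)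
    (hψP : ∀ y ∈ X, 0 < ψ y → y ∈ P) {g : (V × U) × ℝ → K} (hg : ContinuousOn g (cylinder N X))
    (hinj : ∀ x ∈ X, ∀ t ∈ Icc (0 : ℝ) 1, FiberInjOn f N fun p => g ((p, x), t)) {R : Set ((V × U) × ℝ)}
    (hRP : R ⊆ cylinder N P) (hgR : IsCompactPL g R) {ε : ℝ} (hε : 0 < ε) :
    ∃ g' : (V × U) × ℝ → K, ContinuousOn g' (cylinder N X) ∧
      (∀ x ∈ X, ∀ t ∈ Icc (0 : ℝ) 1, FiberInjOn f N fun p => g' ((p, x), t)) ∧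
      IsCompactPL g' (cylinder N Q) ∧ (∀ z ∈ cylinder N X, ‖g' z - g z‖ ≤ ε) ∧ EqOn g' g R ∧
      ∀ z ∈ cylinder N X, z.1.2 ∉ P → g' z = g z := by
  classical
  have hI := isCompactPolyhedron_Icc 0 1 zero_le_one
  have hsub : cylinder N P ⊆ cylinder N X := prod_mono (prod_mono subset_rfl hPX) subset_rfl
  have hQP : Q ⊆ P := fun y hy => hψP y (hQX hy) (by linarith [hψQ y hy])
  -- The parameters and the time become part of the source: the compact theorem is applied to `f ×
  -- id × id` on `N × P × I`, with a one-point parameter space and the family consisting of `g`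
  -- alone.
  obtain ⟨δ, hδ, g₁, hg₁, -, hH⟩ := exists_fiberwise_isotopy.{0}
    (f := Prod.map (Prod.map f (id : U → U)) (id : ℝ → ℝ)) ((hN.prod hP).prod hI) ((hf.prodMap_id hP).prodMap_id hI)
    ((hnd.prodMap_id P).prodMap_id (Icc (0 : ℝ) 1)) (hg.mono hsub)
    (fiberInjOn_cylinder.2 fun x hx => hinj x (hPX hx)) hRP hgR hε
  obtain ⟨H, hHc, hHinj, hH0, hH1, hHε, hHR⟩ := hH Unit univ (fun _ => g)
    ((hg.mono hsub).comp continuousOn_snd fun z hz => hz.2)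
    (fun _ => fiberInjOn_cylinder.2 fun x hx => hinj x (hPX hx)) (fun _ _ _ => by simpa using hδ)
    fun _ _ => eqOn_refl _ _
  -- The isotopy is tapered off: its time is `1` over `Q`, where `ψ ≥ 2`, and `0` where `ψ ≤ 1`,
  -- before the boundary of the region in which it is defined is reached.
  set φ : U → ℝ := fun y => max 0 (min 1 (ψ y - 1)) with hφ
  set g' : (V × U) × ℝ → K := fun z => if 0 < ψ z.1.2 then H ((), φ z.1.2) z else g z with hg'
  have hval : ∀ z ∈ cylinder N X, (z ∈ cylinder N P ∧ g' z = H ((), φ z.1.2) z) ∨ g' z = g z := by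
    intro z hz
    by_cases h : 0 < ψ z.1.2
    · exact Or.inl ⟨⟨⟨hz.1.1, hψP _ hz.1.2 h⟩, hz.2⟩, if_pos h⟩
    · exact Or.inr (if_neg h)
  refine ⟨g', ?_, fun x hx t ht => ?_, ?_, fun z hz => ?_, fun z hz => ?_, fun z hz hzP => ?_⟩
  · refine continuousOn_of_locally_continuousOn fun z hz => ?_
    rcases lt_or_ge 0 (ψ z.1.2) with h | h
    · refine ⟨{z | 0 < ψ z.1.2}, isOpen_lt continuous_const (by fun_prop), h, ?_⟩
      refine ContinuousOn.congr (f := fun z : (V × U) × ℝ => H ((), φ z.1.2) z) ?_ fun y hy =>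
        if_pos (show 0 < ψ y.1.2 from hy.2)
      refine hHc.comp (f := fun z : (V × U) × ℝ => ((((), φ z.1.2) : Unit × ℝ), z)) (by fun_prop) fun y hy => ?_
      exact ⟨mem_univ _, ⟨hy.1.1.1, hψP _ hy.1.1.2 hy.2⟩, hy.1.2⟩
    · refine ⟨{z | ψ z.1.2 < 1}, isOpen_lt (by fun_prop) continuous_const, h.trans_lt one_pos, ?_⟩
      refine (hg.mono inter_subset_left).congr fun y hy => ?_
      by_cases h' : 0 < ψ y.1.2
      · have hφ0 : φ y.1.2 = 0 := max_eq_left ((min_le_right _ _).trans (by linarith [show ψ y.1.2 < 1 from hy.2]))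
        simp only [hg', if_pos h', hφ0]
        exact hH0 () ⟨⟨hy.1.1.1, hψP _ hy.1.1.2 h'⟩, hy.1.2⟩
      · exact if_neg h'
  · by_cases h : 0 < ψ x
    · have := fiberInjOn_cylinder.1 (hHinj ((), φ x)) x (hψP x hx h) t ht
      simpa only [hg', if_pos h] using this
    · simpa only [hg', if_neg h] using hinj x hx t ht
  · refine (hg₁.mono ((hN.prod hQ).prod hI) (prod_mono (prod_mono subset_rfl hQP) subset_rfl)).congr fun z hz => ?_
    have h2 := hψQ _ hz.1.2
    have hφ1 : φ z.1.2 = 1 := by simp only [hφ]; rw [min_eq_left (by linarith), max_eq_right zero_le_one]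
    simp only [hg', if_pos (show 0 < ψ z.1.2 by linarith), hφ1]
    exact (hH1 () ⟨⟨hz.1.1, hQP hz.1.2⟩, hz.2⟩).symm
  · rcases hval z hz with ⟨h1, h2⟩ | h
    · rw [h2]; exact (hHε _ z h1).le
    · rw [h]; simpa using hε.le
  · rcases hval z (hsub (hRP hz)) with ⟨h1, h2⟩ | h
    · rw [h2]; exact hHR () (mem_univ _) _ hz
    · exact h
  · rcases hval z hz with ⟨h1, -⟩ | h
    · exact absurd h1.1.2 hzP
    · exact h

/-- A homotopy of families that is piecewise linear on a subset can be approximated by a piecewise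
linear one that coincides with it there. -/
theorem exists_piecewiseLinear_homotopy (hN : IsCompactPolyhedron N) (hf : IsCompactPL f N)
    (hnd : NonDegenerateOn f N) {X : Set U} (hX : IsPolyhedron X) {h₀ : (V × U) × ℝ → K}
    (hc : ContinuousOn h₀ (cylinder N X))
    (hinj : ∀ x ∈ X, ∀ t ∈ Icc (0 : ℝ) 1, FiberInjOn f N fun p => h₀ ((p, x), t)) {D : Set ((V × U) × ℝ)}
    (hD : ∀ Q, IsCompactPolyhedron Q → Q ⊆ X → IsCompactPL h₀ (cylinder N Q ∩ D)) {ε : ℝ} (hε : 0 < ε) :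
    ∃ h : (V × U) × ℝ → K, (∀ x ∈ X, ∀ t ∈ Icc (0 : ℝ) 1, FiberInjOn f N fun p => h ((p, x), t)) ∧
      (∀ x ∈ X, ∃ Q, IsCompactPolyhedron Q ∧ Q ⊆ X ∧ Q ∈ 𝓝[X] x ∧ IsCompactPL h (cylinder N Q)) ∧
      EqOn h h₀ (cylinder N X ∩ D) ∧ ∀ z ∈ cylinder N X, ‖h z - h₀ z‖ < ε := by
  classical
  have hI := isCompactPolyhedron_Icc 0 1 zero_le_one
  obtain ⟨P, Q, ψ, hPQ, hcov⟩ := hX.exists_exhaustion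
  have hmono : ∀ {A B : Set U}, A ⊆ B → cylinder N A ⊆ cylinder N B := fun h =>
    prod_mono (prod_mono subset_rfl h) subset_rfl
  let Good : ℕ → ((V × U) × ℝ → K) → Prop := fun i g => ContinuousOn g (cylinder N X) ∧
    (∀ x ∈ X, ∀ t ∈ Icc (0 : ℝ) 1, FiberInjOn f N fun p => g ((p, x), t)) ∧
    (∀ j < i, IsCompactPL g (cylinder N (Q j))) ∧ EqOn g h₀ (cylinder N X ∩ D) ∧
    ∀ z ∈ cylinder N X, ‖g z - h₀ z‖ ≤ ε * (1 - (1 / 2) ^ i)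
  have hstep : ∀ i g, Good i g → ∃ g', Good (i + 1) g' ∧ ∀ j < i, EqOn g' g (cylinder N (Q j)) := by
    rintro i g ⟨g1, g2, g3, g4, g5⟩
    obtain ⟨hP, hPX, hQ, hQX, hψ, hψQ, hψP⟩ := hPQ i
    -- The modification is made relative to the earlier pieces, where the homotopy is PL already,
    -- and to `D`.
    have hR1 : IsCompactPL g (⋃ j ∈ Iio i, cylinder N (Q j ∩ P i)) :=
      isCompactPL_biUnion (finite_Iio i) fun j hj => (g3 j hj).mono
        ((hN.prod ((hPQ j).2.2.1.inter hP)).prod hI) (hmono inter_subset_left)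
    have hR2 : IsCompactPL g (cylinder N (P i) ∩ D) := (hD (P i) hP hPX).congr fun z hz =>
      (g4 ⟨hmono hPX hz.1, hz.2⟩).symm
    obtain ⟨g', e1, e2, e3, e4, e5, e6⟩ := exists_piecewiseLinear_modification hN hf hnd hP hPX hQ hQX hψ hψQ hψP
      g1 g2 (union_subset (iUnion₂_subset fun j _ => hmono inter_subset_right) inter_subset_left) (hR1.union hR2)
      (show 0 < ε * (1 / 2) ^ (i + 1) by positivity)
    have hkeep : ∀ j < i, EqOn g' g (cylinder N (Q j)) := fun j hj z hz => by
      by_cases h : z.1.2 ∈ P i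
      · exact e5 (Or.inl (mem_biUnion (mem_Iio.2 hj) ⟨⟨hz.1.1, hz.1.2, h⟩, hz.2⟩))
      · exact e6 z (hmono (hPQ j).2.2.2.1 hz) h
    refine ⟨g', ⟨e1, e2, fun j hj => ?_, fun z hz => ?_, fun z hz => ?_⟩, hkeep⟩
    · rcases Nat.lt_succ_iff_lt_or_eq.1 hj with h | rfl
      · exact (g3 j h).congr (hkeep j h).symm
      · exact e3
    · by_cases h : z.1.2 ∈ P i
      · rw [e5 (Or.inr ⟨⟨⟨hz.1.1.1, h⟩, hz.1.2⟩, hz.2⟩), g4 hz]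
      · rw [e6 z hz.1 h, g4 hz]
    · rw [← sub_add_sub_cancel (g' z) (g z) (h₀ z)]
      refine (norm_add_le _ _).trans ((add_le_add (e4 z hz) (g5 z hz)).trans (le_of_eq ?_))
      rw [pow_succ]; ring
  choose! next hnext using hstep
  let G : ℕ → (V × U) × ℝ → K := fun i => Nat.rec h₀ (fun i g => next i g) i
  have hGs : ∀ i, G (i + 1) = next i (G i) := fun i => rfl
  have hG : ∀ i, Good i (G i) := by
    intro i
    induction i with
    | zero => exact ⟨hc, hinj, fun j hj => absurd hj (Nat.not_lt_zero j), eqOn_refl _ _, fun z _ => by simp [G]⟩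
    | succ i ih => rw [hGs]; exact (hnext i _ ih).1
  -- Over `Q l` nothing changes after step `l`, so the limit exists without any local finiteness of
  -- the cover. The errors form a geometric series with sum `ε`.
  have hstable : ∀ l j, l + 1 ≤ j → EqOn (G j) (G (l + 1)) (cylinder N (Q l)) := by
    intro l j hlj
    induction j, hlj using Nat.le_induction with
    | base => exact eqOn_refl _ _
    | succ j hj ih => rw [hGs]; exact ((hnext j _ (hG j)).2 l (by omega)).trans ih
  choose! ι hι using hcov
  have hιQ : ∀ x ∈ X, x ∈ Q (ι x) := fun x hx => mem_of_mem_nhdsWithin hx (hι x hx)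
  have hval : ∀ l, EqOn (fun z : (V × U) × ℝ => G (ι z.1.2 + 1) z) (G (l + 1)) (cylinder N (Q l)) := by
    intro l z hz
    have hzX := (hPQ l).2.2.2.1 hz.1.2
    have h1 := hstable l (max l (ι z.1.2) + 1) (by omega) hz
    have h2 := hstable (ι z.1.2) (max l (ι z.1.2) + 1) (by omega) (x := z) ⟨⟨hz.1.1, hιQ _ hzX⟩, hz.2⟩
    exact h2.symm.trans h1
  refine ⟨fun z => G (ι z.1.2 + 1) z, fun x hx t ht => (hG (ι x + 1)).2.1 x hx t ht, fun x hx => ?_, fun z hz => ?_,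
    fun z hz => ?_⟩
  · exact ⟨Q (ι x), (hPQ _).2.2.1, (hPQ _).2.2.2.1, hι x hx,
      ((hG (ι x + 1)).2.2.1 (ι x) (Nat.lt_succ_self _)).congr (hval (ι x)).symm⟩
  · exact (hG (ι z.1.2 + 1)).2.2.2.1 hz
  · refine ((hG (ι z.1.2 + 1)).2.2.2.2 z hz).trans_lt ?_
    have : (0 : ℝ) < (1 / 2) ^ (ι z.1.2 + 1) := by positivity
    nlinarith

end PiecewiseLinearHomotopy

/-! ### Local criteria for PL maps and PL embeddings. -/

section Local

variable {V W : Type} [NormedAddCommGroup V] [NormedSpace ℝ V] [NormedAddCommGroup W] [NormedSpace ℝ W]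

theorem isPLOn_of_locally {f : V → W} {P : Set V}
    (h : ∀ x ∈ P, ∃ Q ⊆ P, Q ∈ 𝓝[P] x ∧ IsCompactPL f Q) : IsPLOn f P := by
  intro x hx
  obtain ⟨_, hQP, hQx, C, rfl, hC⟩ := h x hx
  exact ⟨C, hQP, hQx, hC⟩

/-- A topological embedding that is piecewise linear has a piecewise linear inverse. -/
theorem isPLEmbeddingOn_of_locally {f : V → W} {P : Set V} (hf : IsEmbeddingOn f P)
    (h : ∀ x ∈ P, ∃ Q ⊆ P, Q ∈ 𝓝[P] x ∧ IsCompactPL f Q) : IsPLEmbeddingOn f P := by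
  have hinj : InjOn f P := fun x hx y hy hxy => congrArg Subtype.val (@hf.injective ⟨x, hx⟩ ⟨y, hy⟩ hxy)
  refine ⟨isPLOn_of_locally h, Function.invFunOn f P, ?_, fun x hx => hinj.leftInvOn_invFunOn hx⟩
  rintro _ ⟨x, hx, rfl⟩
  obtain ⟨Q, hQP, hQx, hQ⟩ := h x hx
  obtain ⟨C, hC, hCA⟩ := hQ.exists_inverse (hinj.mono hQP)
  refine ⟨C, hC ▸ image_mono hQP, ?_, fun F hF => ?_⟩
  · rw [← hC]
    -- A topological embedding carries neighbourhoods in `P` to neighbourhoods in the image; hence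
    -- `f '' Q` is one, and the inverse is PL on it.
    have h1 := hf.isInducing.map_nhds_eq ⟨x, hx⟩
    rw [range_domRestrict] at h1
    change Filter.map (P.domRestrict f) (𝓝 ⟨x, hx⟩) = 𝓝[f '' P] f x at h1
    rw [← h1, Filter.mem_map]
    exact Filter.mem_of_superset (preimage_coe_mem_nhds_subtype.2 hQx) fun y hy => mem_image_of_mem f hy
  · obtain ⟨A, hA⟩ := hCA F hF
    refine ⟨A, fun y hy => ?_⟩
    rw [← hA hy]
    obtain ⟨z, hz, rfl⟩ : y ∈ f '' Q := by rw [hC]; exact mem_biUnion hF hy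
    rw [hinj.leftInvOn_invFunOn (hQP hz), (hinj.mono hQP).leftInvOn_invFunOn hz]

end Local

/-! ### Isotopies of lifts, topological and PL. -/

section LiftIsotopy

/-- The isotopy of lifts given by a homotopy of second components. -/
theorem isLiftIsotopy_of_homotopy {V W K U : Type*} [TopologicalSpace V] [MetricSpace W]
    [NormedAddCommGroup K] [TopologicalSpace U] {f : V → W} {N : Set V} (hN : IsCompact N)
    (hf : ContinuousOn f N) {X : Set U} {ε : ℝ} {E : V × U → (W × K) × U} (hE : IsFamilyLiftOn f N X E)
    {e' : V → W × K} (he' : IsLiftOn f N e') {g : V → K} {h : (V × U) × ℝ → K}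
    (hh : ContinuousOn h (cylinder N X))
    (hinj : ∀ x ∈ X, ∀ t ∈ Icc (0 : ℝ) 1, FiberInjOn f N fun p => h ((p, x), t))
    (h0 : ∀ p ∈ N, ∀ x ∈ X, h ((p, x), 0) = (E (p, x)).1.2) (h1 : ∀ p ∈ N, ∀ x ∈ X, h ((p, x), 1) = (e' p).2)
    (hε : ∀ z ∈ cylinder N X, ‖h z - g z.1.1‖ < ε / 2) :
    IsLiftIsotopy f N X ε E e' fun z => ((f z.1.1, h z), z.1.2) where
  embedding := isEmbeddingOn_track hN hf hh hinj
  lift _ _ _ _ _ _ := ⟨rfl, rfl⟩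
  initial p hp x hx := Prod.ext (Prod.ext (hE p hp x hx).1.symm (h0 p hp x hx)) (hE p hp x hx).2.symm
  final p hp x hx := Prod.ext (Prod.ext (he' p hp).symm (h1 p hp x hx)) rfl
  small p hp x hx s hs t ht := by
    have e1 := hε ((p, x), s) ⟨⟨hp, hx⟩, hs⟩
    have e2 := hε ((p, x), t) ⟨⟨hp, hx⟩, ht⟩
    rw [← dist_eq_norm] at e1 e2
    have e3 := dist_triangle_right (h ((p, x), s)) (h ((p, x), t)) (g p)
    simp only [Prod.dist_eq, dist_self]
    exact max_lt (by linarith [dist_nonneg.trans_lt e1]) (by dsimp only at e1 e2; linarith)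

theorem IsEmbeddingOn.continuousOn {A B : Type*} [TopologicalSpace A] [TopologicalSpace B] {f : A → B}
    {S : Set A} (h : IsEmbeddingOn f S) : ContinuousOn f S :=
  continuousOn_iff_continuous_domRestrict.2 h.continuous

theorem IsEmbeddingOn.injOn {A B : Type*} [TopologicalSpace A] [TopologicalSpace B] {f : A → B}
    {S : Set A} (h : IsEmbeddingOn f S) : InjOn f S :=
  fun x hx y hy hxy => congrArg Subtype.val (@h.injective ⟨x, hx⟩ ⟨y, hy⟩ hxy)

theorem IsFamilyLiftOn.fiberInjOn {V W K U : Type*} {f : V → W} {N : Set V} {X : Set U}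
    {E : V × U → (W × K) × U} (hE : IsFamilyLiftOn f N X E) (hinj : InjOn E (N ×ˢ X)) {x : U} (hx : x ∈ X) :
    FiberInjOn f N fun p => (E (p, x)).1.2 := fun p hp q hq hpq hg => by
  refine congrArg Prod.fst (hinj (x₁ := (p, x)) (x₂ := (q, x)) ⟨hp, hx⟩ ⟨hq, hx⟩ (Prod.ext (Prod.ext ?_ hg) ?_))
  · rw [(hE p hp x hx).1, (hE q hq x hx).1, hpq]
  · rw [(hE p hp x hx).2, (hE q hq x hx).2]

variable {V W K U : Type} [NormedAddCommGroup V] [NormedSpace ℝ V] [FiniteDimensional ℝ V]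
  [NormedAddCommGroup W] [NormedSpace ℝ W] [FiniteDimensional ℝ W]
  [NormedAddCommGroup K] [NormedSpace ℝ K]
  [NormedAddCommGroup U] [NormedSpace ℝ U] [FiniteDimensional ℝ U] {f : V → W} {N N₀ : Set V}

theorem IsCompactPL.comp_fst {A : Set V} {B : Set U} {u : V → K} (hu : IsCompactPL u A)
    (hB : IsCompactPolyhedron B) : IsCompactPL (fun z : V × U => u z.1) (A ×ˢ B) :=
  have hAB : IsCompactPolyhedron (A ×ˢ B) := hu.isCompactPolyhedron.prod hB
  hu.comp_affineMap hAB (LinearMap.fst ℝ V U).toAffineMap fun _ h => h.1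

theorem isCompactPL_of_boundary {Q Y : Set U} (hQ : IsCompactPolyhedron Q) (hY : IsCompactPolyhedron Y)
    {u : V × U → K} {g g' : V → K} {h : (V × U) × ℝ → K} (hu : IsCompactPL u (N ×ˢ Q)) (hg : IsCompactPL g N₀)
    (hg' : IsCompactPL g' N) (h0 : ∀ p ∈ N, ∀ x ∈ Q, h ((p, x), 0) = u (p, x))
    (h1 : ∀ p ∈ N, ∀ x ∈ Q, h ((p, x), 1) = g' p)
    (hfix : ∀ p ∈ N₀, ∀ x ∈ Y, ∀ t ∈ Icc (0 : ℝ) 1, h ((p, x), t) = g p) :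
    IsCompactPL h ((N ×ˢ Q) ×ˢ {0} ∪ (N ×ˢ Q) ×ˢ {1} ∪ cylinder N₀ Y) := by
  have hpt : ∀ t : ℝ, IsCompactPolyhedron {t} := fun t => ⟨{{t}}, by simp⟩
  refine (IsCompactPL.union ?_ ?_).union ?_
  · refine (hu.comp_fst (hpt 0)).congr ?_
    rintro ⟨⟨p, x⟩, t⟩ ⟨⟨hp, hx⟩, ht⟩
    rw [show t = 0 from ht]
    exact (h0 p hp x hx).symm
  · refine ((hg'.comp_fst hQ).comp_fst (hpt 1)).congr ?_
    rintro ⟨⟨p, x⟩, t⟩ ⟨⟨hp, hx⟩, ht⟩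
    rw [show t = 1 from ht]
    exact (h1 p hp x hx).symm
  · refine ((hg.comp_fst hY).comp_fst (isCompactPolyhedron_Icc 0 1 zero_le_one)).congr ?_
    rintro ⟨⟨p, x⟩, t⟩ ⟨⟨hp, hx⟩, ht⟩
    exact (hfix p hp x hx t ht).symm

/-- A homotopy of lifts between piecewise linear ones can be replaced by a piecewise linear isotopy. -/
theorem exists_piecewiseLinear_isotopy [FiniteDimensional ℝ K] (hN : IsCompactPolyhedron N) (hf : IsCompactPL f N)
    (hnd : NonDegenerateOn f N) (hN₀ : N₀ ⊆ N) {g g' : V → K} (hg : IsCompactPL g N₀) (hg' : IsCompactPL g' N)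
    {X : Set U} (hX : IsPolyhedron X) {E : V × U → (W × K) × U} (hEPL : IsPLOn E (N ×ˢ X))
    (hE : IsFamilyLiftOn f N X E) {ε : ℝ} (hε : 0 < ε) {h₀ : (V × U) × ℝ → K}
    (hc : ContinuousOn h₀ (cylinder N X))
    (hinj : ∀ x ∈ X, ∀ t ∈ Icc (0 : ℝ) 1, FiberInjOn f N fun p => h₀ ((p, x), t))
    (h0 : ∀ p ∈ N, ∀ x ∈ X, h₀ ((p, x), 0) = (E (p, x)).1.2) (h1 : ∀ p ∈ N, ∀ x ∈ X, h₀ ((p, x), 1) = g' p)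
    (hsmall : ∀ z ∈ cylinder N X, ‖h₀ z - g z.1.1‖ < ε / 4)
    (hfix : ∀ x ∈ X, (∀ p ∈ N₀, (E (p, x)).1.2 = g p) → ∀ p ∈ N₀, ∀ t ∈ Icc (0 : ℝ) 1, h₀ ((p, x), t) = g p) :
    ∃ H : (V × U) × ℝ → (W × K) × U, IsLiftIsotopy f N X ε E (fun p => (f p, g' p)) H ∧
      IsPLEmbeddingOn (track H) (cylinder N X) ∧
      ∀ x ∈ X, (∀ p ∈ N₀, (E (p, x)).1.2 = g p) → ∀ p ∈ N₀, ∀ t ∈ Icc (0 : ℝ) 1, H ((p, x), t) = E (p, x) := by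
  have hI := isCompactPolyhedron_Icc 0 1 zero_le_one
  -- An arbitrary set of parameters where `E` is prescribed need not be polyhedral. The set of all
  -- parameters where `E` agrees with `g` on `N₀` is polyhedral over each compact piece, and the
  -- isotopy is kept fixed there.
  set Y : Set U := {x ∈ X | ∀ p ∈ N₀, (E (p, x)).1.2 = g p} with hY
  set D : Set ((V × U) × ℝ) := {z | z.2 = 0 ∨ z.2 = 1 ∨ z.1.1 ∈ N₀ ∧ z.1.2 ∈ Y} with hD
  have hu : ∀ Q, IsCompactPolyhedron Q → Q ⊆ X → IsCompactPL (fun y => (E y).1.2) (N ×ˢ Q) := fun Q hQ hQX =>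
    (hEPL.isCompactPL (hN.prod hQ) (prod_mono subset_rfl hQX)).affine_comp
      ((LinearMap.snd ℝ W K).comp (LinearMap.fst ℝ (W × K) U)).toAffineMap
  have hDQ : ∀ Q, IsCompactPolyhedron Q → Q ⊆ X → IsCompactPL h₀ (cylinder N Q ∩ D) := by
    intro Q hQ hQX
    have hYQ : IsCompactPolyhedron {x ∈ Q | ∀ p ∈ N₀, (E (p, x)).1.2 = g p} :=
      isCompactPolyhedron_eqFibers (u := fun y => (E y).1.2) hg.isCompactPolyhedron hQ
        ((hu Q hQ hQX).mono (hg.isCompactPolyhedron.prod hQ) (prod_mono hN₀ subset_rfl)) hg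
    convert isCompactPL_of_boundary hQ hYQ (hu Q hQ hQX) hg hg' (fun p hp x hx => h0 p hp x (hQX hx))
      (fun p hp x hx => h1 p hp x (hQX hx)) (fun p hp x hx t ht => hfix x (hQX hx.1) hx.2 p hp t ht) using 1
    ext ⟨⟨p, x⟩, t⟩
    simp only [cylinder, hD, hY, mem_inter_iff, mem_prod, mem_union, mem_ofPred_eq, mem_singleton_iff]
    constructor
    · rintro ⟨⟨⟨hp, hx⟩, ht⟩, rfl | rfl | ⟨hp', -, hx'⟩⟩
      exacts [Or.inl (Or.inl ⟨⟨hp, hx⟩, rfl⟩), Or.inl (Or.inr ⟨⟨hp, hx⟩, rfl⟩), Or.inr ⟨⟨hp', hx, hx'⟩, ht⟩]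
    · rintro ((⟨hp, rfl⟩ | ⟨hp, rfl⟩) | ⟨⟨hp, hx, hx'⟩, ht⟩)
      · exact ⟨⟨hp, ⟨le_rfl, zero_le_one⟩⟩, Or.inl rfl⟩
      · exact ⟨⟨hp, ⟨zero_le_one, le_rfl⟩⟩, Or.inr (Or.inl rfl)⟩
      · exact ⟨⟨⟨hN₀ hp, hx⟩, ht⟩, Or.inr (Or.inr ⟨hp, hQX hx, hx'⟩)⟩
  -- The tolerance `ε / 4`, added to the distance `ε / 4` between `h₀` and `g`, stays within the `ε
  -- / 2` that an `ε`-isotopy allows.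
  obtain ⟨h, k1, k2, k3, k4⟩ := exists_piecewiseLinear_homotopy hN hf hnd hX hc hinj hDQ
    (show 0 < ε / 4 by positivity)
  have hnhd : ∀ z ∈ cylinder N X, ∃ Q, IsCompactPolyhedron Q ∧ Q ⊆ X ∧ cylinder N Q ∈ 𝓝[cylinder N X] z ∧
      IsCompactPL h (cylinder N Q) := by
    rintro ⟨⟨p, x⟩, t⟩ hz
    obtain ⟨Q, q1, q2, q3, q4⟩ := k2 x hz.1.2
    exact ⟨Q, q1, q2, nhdsWithin_prod (nhdsWithin_prod self_mem_nhdsWithin q3) self_mem_nhdsWithin, q4⟩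
  have hcont : ContinuousOn h (cylinder N X) := fun z hz => by
    obtain ⟨Q, -, -, q3, q4⟩ := hnhd z hz
    exact (q4.continuousOn z (mem_of_mem_nhdsWithin hz q3)).mono_of_mem_nhdsWithin q3
  have hiso : IsLiftIsotopy f N X ε E (fun p => (f p, g' p)) fun z => ((f z.1.1, h z), z.1.2) := by
    refine isLiftIsotopy_of_homotopy (g := g) hN.isCompact hf.continuousOn hE (fun _ _ => rfl) hcont k1
      (fun p hp x hx => ?_) (fun p hp x hx => ?_) fun z hz => ?_
    · rw [← h0 p hp x hx]
      exact k3 ⟨⟨⟨hp, hx⟩, ⟨le_rfl, zero_le_one⟩⟩, Or.inl rfl⟩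
    · rw [k3 ⟨⟨⟨hp, hx⟩, ⟨zero_le_one, le_rfl⟩⟩, Or.inr (Or.inl rfl)⟩, h1 p hp x hx]
    · rw [← sub_add_sub_cancel (h z) (h₀ z)]
      linarith [norm_add_le (h z - h₀ z) (h₀ z - g z.1.1), k4 z hz, hsmall z hz]
  refine ⟨_, hiso, isPLEmbeddingOn_of_locally hiso.embedding fun z hz => ?_, fun x hx hxY p hp t ht => ?_⟩
  · obtain ⟨Q, q1, q2, q3, q4⟩ := hnhd z hz
    refine ⟨_, prod_mono (prod_mono subset_rfl q2) subset_rfl, q3, ?_⟩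
    have hcyl := (hN.prod q1).prod hI
    have hf' : IsCompactPL (fun z : (V × U) × ℝ => f z.1.1) (cylinder N Q) :=
      (hf.comp_fst q1).comp_fst hI
    exact ((hf'.prodMk q4).prodMk (hcyl.isCompactPL_affine ((LinearMap.snd ℝ V U).comp
      (LinearMap.fst ℝ (V × U) ℝ)).toAffineMap)).prodMk (hcyl.isCompactPL_affine
        (LinearMap.snd ℝ (V × U) ℝ).toAffineMap)
  · have h2 : h ((p, x), t) = g p := by
      rw [k3 ⟨⟨⟨hN₀ hp, hx⟩, ht⟩, Or.inr (Or.inr ⟨hp, hx, hxY⟩)⟩, hfix x hx hxY p hp t ht]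
    exact Prod.ext (Prod.ext (hE p (hN₀ hp) x hx).1.symm (h2.trans (hxY p hp).symm)) (hE p (hN₀ hp) x hx).2.symm

end LiftIsotopy

/-! ### The main theorem. -/

theorem mainTheorem2 {n m k : ℕ}
    (N : Set (EuclideanSpace ℝ (Fin n))) (M : Set (EuclideanSpace ℝ (Fin m)))
    (hN : IsCompactPolyhedron N) (hM : IsCompactPolyhedron M)
    (f : EuclideanSpace ℝ (Fin n) → EuclideanSpace ℝ (Fin m))
    (hfM : MapsTo f N M) (hf : IsPLOn f N) (hnd : NonDegenerateOn f N)
    (e : EuclideanSpace ℝ (Fin n) → EuclideanSpace ℝ (Fin m) × EuclideanSpace ℝ (Fin k))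
    (he : IsEmbeddingOn e N) (hef : IsLiftOn f N e)
    (N₀ : Set (EuclideanSpace ℝ (Fin n))) (hN₀ : IsCompactPolyhedron N₀) (hN₀N : N₀ ⊆ N)
    (heN₀ : IsPLOn e N₀) (ε : ℝ) (hε : 0 < ε) :
    ∃ δ : ℝ, 0 < δ ∧
    ∃ e' : EuclideanSpace ℝ (Fin n) → EuclideanSpace ℝ (Fin m) × EuclideanSpace ℝ (Fin k),
      IsPLEmbeddingOn e' N ∧ IsLiftOn f N e' ∧
      -- arbitrary parameter spaces
      (∀ (X : Type*) [TopologicalSpace X] (Y : Set X)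
        (E : EuclideanSpace ℝ (Fin n) × X →
          (EuclideanSpace ℝ (Fin m) × EuclideanSpace ℝ (Fin k)) × X),
        IsEmbeddingOn E (N ×ˢ univ) → IsFamilyLiftOn f N univ E →
        (∀ p ∈ N, ∀ x : X, dist (E (p, x)).1 (e p) < δ) →
        (∀ p ∈ N₀, ∀ x ∈ Y, E (p, x) = (e p, x)) →
        ∃ H : (EuclideanSpace ℝ (Fin n) × X) × ℝ →
            (EuclideanSpace ℝ (Fin m) × EuclideanSpace ℝ (Fin k)) × X,
          IsLiftIsotopy f N univ ε E e' H ∧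
          ∀ p ∈ N₀, ∀ x ∈ Y, ∀ t ∈ Icc (0 : ℝ) 1, H ((p, x), t) = E (p, x)) ∧
      -- polyhedral parameter spaces and PL families
      (∀ (q : ℕ) (X Y : Set (EuclideanSpace ℝ (Fin q))) (_ : IsPolyhedron X) (_ : Y ⊆ X)
        (E : EuclideanSpace ℝ (Fin n) × EuclideanSpace ℝ (Fin q) →
          (EuclideanSpace ℝ (Fin m) × EuclideanSpace ℝ (Fin k)) × EuclideanSpace ℝ (Fin q)),
        IsEmbeddingOn E (N ×ˢ X) → IsPLOn E (N ×ˢ X) → IsFamilyLiftOn f N X E →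
        (∀ p ∈ N, ∀ x ∈ X, dist (E (p, x)).1 (e p) < δ) →
        (∀ p ∈ N₀, ∀ x ∈ Y, E (p, x) = (e p, x)) →
        ∃ H : (EuclideanSpace ℝ (Fin n) × EuclideanSpace ℝ (Fin q)) × ℝ →
            (EuclideanSpace ℝ (Fin m) × EuclideanSpace ℝ (Fin k)) × EuclideanSpace ℝ (Fin q),
          IsLiftIsotopy f N X ε E e' H ∧
          IsPLEmbeddingOn (track H) ((N ×ˢ X) ×ˢ Icc (0 : ℝ) 1) ∧
          ∀ p ∈ N₀, ∀ x ∈ Y, ∀ t ∈ Icc (0 : ℝ) 1, H ((p, x), t) = E (p, x)) := by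
  have hf' := hf.isCompactPL hN subset_rfl
  have hec := he.continuousOn
  have hg : ContinuousOn (fun p => (e p).2) N := continuous_snd.comp_continuousOn hec
  have hinj : FiberInjOn f N fun p => (e p).2 := fun p hp q hq hpq h =>
    he.injOn hp hq (Prod.ext (by rw [hef p hp, hef q hq, hpq]) h)
  have hg₀ : IsCompactPL (fun p => (e p).2) N₀ := (heN₀.isCompactPL hN₀ subset_rfl).affine_comp
    (LinearMap.snd ℝ (EuclideanSpace ℝ (Fin m)) (EuclideanSpace ℝ (Fin k))).toAffineMap
  -- One `δ` and one `g'` serve both parts. The bound `ε / 4` leaves room for the PL approximation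
  -- in the second part.
  obtain ⟨δ, hδ, g', hg', hg'inj, hH⟩ := exists_fiberwise_isotopy hN hf' hnd hg hinj hN₀N hg₀
    (show 0 < ε / 4 by positivity)
  refine ⟨δ, hδ, fun p => (f p, g' p), (hf'.prodMk hg').isPLEmbeddingOn fun p hp q hq h =>
    hg'inj p hp q hq (congrArg Prod.fst h) (congrArg Prod.snd h), fun _ _ => rfl, ?_, ?_⟩
  · intro X _ Y E hE hEf hEδ hEY
    obtain ⟨H, H1, H2, H3, H4, H5, H6⟩ := hH X Y (fun x p => (E (p, x)).1.2)
      (continuous_snd.comp_continuousOn (continuous_fst.comp_continuousOn (hE.continuousOn.comp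
        (f := fun z : X × EuclideanSpace ℝ (Fin n) => (z.2, z.1)) (by fun_prop) fun z hz => ⟨hz.2, mem_univ _⟩)))
      (fun x => hEf.fiberInjOn hE.injOn (mem_univ x))
      (fun x p hp => by
        rw [← dist_eq_norm]
        exact (le_max_right _ _).trans_lt (hEδ p hp x))
      fun x hx p hp => by simp only [hEY p hp x hx]
    refine ⟨_, isLiftIsotopy_of_homotopy (g := fun p => (e p).2) (h := fun z => H (z.1.2, z.2) z.1.1)
      hN.isCompact hf'.continuousOn hEf (fun _ _ => rfl) (H1.comp
        (f := fun z : (EuclideanSpace ℝ (Fin n) × X) × ℝ => ((z.1.2, z.2), z.1.1)) (by fun_prop)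
        fun z hz => ⟨mem_univ _, hz.1.1⟩) (fun x _ t _ => H2 (x, t)) (fun p hp x _ => H3 x hp)
      (fun p hp x _ => H4 x hp) (fun z hz => (H5 _ _ hz.1.1).trans (by linarith)), fun p hp x hx t ht => ?_⟩
    have h1 := H6 x hx t hp
    have h2 := hEY p hp x hx
    rw [h2]
    exact Prod.ext (Prod.ext (hef p (hN₀N hp)).symm h1) rfl
  · intro q X Y hX hYX E hE hEPL hEf hEδ hEY
    classical
    -- Lifting `X` brings it into the universe in which the parameter spaces of the first part live.
    -- The given `Y` is enlarged to all parameters where `E` agrees with `e` on `N₀`.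
    obtain ⟨H, H1, H2, H3, H4, H5, H6⟩ := hH (ULift X) {x | ∀ p ∈ N₀, (E (p, x.down)).1.2 = (e p).2}
      (fun x p => (E (p, x.down)).1.2)
      (continuous_snd.comp_continuousOn (continuous_fst.comp_continuousOn (hE.continuousOn.comp
        (f := fun z : ULift X × EuclideanSpace ℝ (Fin n) => (z.2, (z.1.down : EuclideanSpace ℝ (Fin q))))
        (Continuous.continuousOn (continuous_snd.prodMk (continuous_subtype_val.comp
          (continuous_uliftDown.comp continuous_fst)))) fun z hz => ⟨hz.2, z.1.down.2⟩)))
      (fun x => hEf.fiberInjOn hE.injOn x.down.2)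
      (fun x p hp => by
        rw [← dist_eq_norm]
        exact (le_max_right _ _).trans_lt (hEδ p hp x.down x.down.2))
      fun x hx p hp => hx p hp
    -- The homotopy is extended by an irrelevant value to parameters outside `X`.
    set h₀ : (EuclideanSpace ℝ (Fin n) × EuclideanSpace ℝ (Fin q)) × ℝ → EuclideanSpace ℝ (Fin k) := fun z =>
      if hx : z.1.2 ∈ X then H (⟨⟨z.1.2, hx⟩⟩, z.2) z.1.1 else 0 with hh₀
    have hval : ∀ p x (hx : x ∈ X) t, h₀ ((p, x), t) = H (⟨⟨x, hx⟩⟩, t) p := fun p x hx t => dif_pos hx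
    have hc : ContinuousOn h₀ (cylinder N X) := by
      rw [continuousOn_iff_continuous_domRestrict]
      have h1 : Continuous fun z : cylinder N X =>
          (fun y : (ULift X × ℝ) × EuclideanSpace ℝ (Fin n) => H y.1 y.2) ((⟨⟨z.1.1.2, z.2.1.2⟩⟩, z.1.2), z.1.1.1) :=
        H1.comp_continuous (((continuous_uliftUp.comp (Continuous.subtype_mk (by fun_prop) _)).prodMk
          (by fun_prop)).prodMk (by fun_prop)) fun z => ⟨mem_univ _, z.2.1.1⟩
      exact h1.congr fun z => (hval z.1.1.1 z.1.1.2 z.2.1.2 z.1.2).symm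
    obtain ⟨G, G1, G2, G3⟩ := exists_piecewiseLinear_isotopy (h₀ := h₀) hN hf' hnd hN₀N hg₀ hg' hX hEPL hEf hε hc
      (fun x hx t _ => by simp only [hval _ x hx]; exact H2 _)
      (fun p hp x hx => by rw [hval p x hx]; exact H3 _ hp)
      (fun p hp x hx => by rw [hval p x hx]; exact H4 _ hp)
      (fun z hz => by rw [hval z.1.1 z.1.2 hz.1.2 z.2]; exact H5 _ _ hz.1.1)
      (fun x hx hxY p hp t _ => by rw [hval p x hx]; exact H6 ⟨⟨x, hx⟩⟩ hxY t hp)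
    exact ⟨G, G1, G2, fun p hp x hx t ht => G3 x (hYX hx) (fun p hp => by rw [hEY p hp x hx]) p hp t ht⟩
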